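/- **Theorem 4.2.** Let $X$ be an 8-manifold with a $\mathrm{Spin}(7)$-structure $\Phi$, not necessarily torsion-free, $X$ not necessarily compact. That is, $\Phi$ is a smooth 4-form on $X$ such that each tangent space $T_pX$ has a basis $e_0,\dots,e_7$ with dual basis $e^0,\dots,e^7$ for which, with $e^{ijkl}=e^i\wedge e^j\wedge e^k\wedge e^l$, $$\Phi_p=e^{0123}+e^{0145}+e^{0167}+e^{0246}-e^{0257}-e^{0347}-e^{0356}+e^{4567}+e^{2367}+e^{2345}+e^{1357}-e^{1346}-e^{1256}-e^{1247}.$$ The form $\Phi$ determines a Riemannian metric $g$ and an orientation, for which every such basis is orthonormal and oriented. Let $*$, $\langle\cdot,\cdot\rangle$, $|\cdot|$ and $\sharp$ be the associated Hodge star, inner product and (Hermitian) norm of forms, normalized so that the forms $e^{i_1}\wedge\dots\wedge e^{i_k}$, $i_1<\dots<i_k$, are orthonormal, and musical isomorphism. Denote by $\pi^k_7$ the orthogonal projection of the $k$-forms onto the irreducible $\mathrm{Spin}(7)$-component of rank $7$ for $k=2,4$ (extended complex-linearly to complex-valued forms). These components are $$\Lambda^2_7=\{\alpha\mid\alpha\wedge\Phi=3*\alpha\},\qquad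 \Lambda^4_7=\mathrm{span}\{\,a^\flat\wedge i(b)\Phi-b^\flat\wedge i(a)\Phi\mid a,b\in T_pX\,\}.$$ Let $L\to X$ be a smooth complex line bundle with a Hermitian metric, let $\nabla$ be a Hermitian connection on $L$, and let $F$ be its curvature, regarded as a $\sqrt{-1}\,\mathbb R$-valued 2-form on $X$; powers of $F$ are wedge powers. Let $(-\sqrt{-1}F)^\sharp\in\Gamma(X,\mathrm{End}\,TX)$ be the endomorphism $u\mapsto(-\sqrt{-1}\,i(u)F)^\sharp$. Call $\nabla$ a *$\mathrm{Spin}(7)$-dDT connection* (deformed Donaldson–Thomas connection) if $$\pi^2_7\Bigl(F+\tfrac16*F^3\Bigr)=0\quad\text{and}\quad \pi^4_7(F^2)=0\qquad\text{on all of }X.$$ Then, for every Hermitian connection $\nabla$ on $L$, at every point of $X$, $$\Bigl(1+\tfrac12\langle F^2,\Phi\rangle+\tfrac{*F^4}{24}\Bigr)^2+4\,\Bigl|\pi^2_7\Bigl(F+\tfrac16*F^3\Bigr)\Bigr|^2+2\,\bigl|\pi^4_7(F^2)\bigr|^2=\det\bigl(\mathrm{id}_{TX}+(-\sqrt{-1}F)^\sharp\bigr).$$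 In particular, at every point of $X$, $$\Bigl|1+\tfrac12\langle F^2,\Phi\rangle+\tfrac{*F^4}{24}\Bigr|\le\sqrt{\det\bigl(\mathrm{id}_{TX}+(-\sqrt{-1}F)^\sharp\bigr)},$$ and equality holds at every point of $X$ if and only if $\nabla$ is a $\mathrm{Spin}(7)$-dDT connection. -/

import Mathlib

open scoped Manifold ContDiff Bundle Topology TensorProduct
open Bundle VectorField

namespace Spin7dDT

/-- The model space of 8-manifolds. -/
abbrev R8 := EuclideanSpace ℝ (Fin 8)

section Forms

variable (W : Type*) [AddCommGroup W] [Module ℝ W]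

/-- `Λ^k W^* ⊗ ℂ`: complex-valued alternating `k`-linear forms on the real vector space `W`. -/
abbrev CForm (k : ℕ) : Type _ := W [⋀^Fin k]→ₗ[ℝ] ℂ

variable {W}

/-- A real form, regarded as a complex-valued form. -/
noncomputable def complexify {k : ℕ} (α : W [⋀^Fin k]→ₗ[ℝ] ℝ) : CForm W k :=
  Complex.ofRealCLM.toLinearMap.compAlternatingMap α

/-- The exterior product, `(α ∧ β)(v₁, …, v_{k+l}) = ∑ sgn(σ) α(v_{σ(1)}, …) β(v_{σ(k+1)}, …)`, the sum running over
the `(k, l)`-shuffles `σ`. -/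
noncomputable def wedge {k l : ℕ} (α : CForm W k) (β : CForm W l) : CForm W (k + l) :=
  ((LinearMap.mul' ℝ ℂ).compAlternatingMap (α.domCoprod β)).domDomCongr finSumFinEquiv

/-- Interior product `i(u) α`. -/
noncomputable def interiorProd {k : ℕ} (u : W) (α : CForm W (k + 1)) : CForm W k :=
  α.curryLeft u

/-- `e^{i₁} ∧ ⋯ ∧ e^{i_k}` for the basis `e^0, …, e^7` dual to `e`; its value on `(v₁, …, v_k)` is
`det (e^{i_a}(v_b))`. -/
noncomputable def coordWedge (e : Module.Basis (Fin 8) ℝ W) {k : ℕ} (i : Fin k → Fin 8) :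
    W [⋀^Fin k]→ₗ[ℝ] ℝ :=
  MultilinearMap.alternatization
    ((MultilinearMap.mkPiAlgebra ℝ (Fin k) ℝ).compLinearMap fun m => e.coord (i m))

/-- The standard Cayley 4-form in the basis `e_0, …, e_7`. When `Φ = cayleyForm e`, the inner product `g_Φ`
and the orientation that `Φ` determines are those for which `e` is an oriented orthonormal basis (the
stabilizer `Spin(7)` of `Φ` lies in `SO(8)`, so that they do not depend on `e`). Below, the metric
operations are written in such a basis `e`. -/
noncomputable def cayleyForm (e : Module.Basis (Fin 8) ℝ W) : W [⋀^Fin 4]→ₗ[ℝ] ℝ :=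
  coordWedge e ![0, 1, 2, 3] + coordWedge e ![0, 1, 4, 5] + coordWedge e ![0, 1, 6, 7]
    + coordWedge e ![0, 2, 4, 6] - coordWedge e ![0, 2, 5, 7] - coordWedge e ![0, 3, 4, 7]
    - coordWedge e ![0, 3, 5, 6]
    + coordWedge e ![4, 5, 6, 7] + coordWedge e ![2, 3, 6, 7] + coordWedge e ![2, 3, 4, 5]
    + coordWedge e ![1, 3, 5, 7] - coordWedge e ![1, 3, 4, 6] - coordWedge e ![1, 2, 5, 6]
    - coordWedge e ![1, 2, 4, 7]

variable (e : Module.Basis (Fin 8) ℝ W)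

/-- The 1-form `u^♭`, for the inner product in which `e` is orthonormal. -/
noncomputable def flat (u : W) : CForm W 1 :=
  complexify (∑ j, e.coord j u • coordWedge e ![j])

/-- The Hermitian inner product `⟨α, β⟩ = ∑_{i₁ < ⋯ < i_k} conj α(e_{i₁}, …, e_{i_k}) β(e_{i₁}, …, e_{i_k})`
extending the inner product of real `k`-forms in which the `e^{i₁} ∧ ⋯ ∧ e^{i_k}`, `i₁ < ⋯ < i_k`, are
orthonormal (written as a sum over all indices, divided by `k!`). -/
noncomputable def formInner {k : ℕ} (α β : CForm W k) : ℂ :=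
  (k.factorial : ℂ)⁻¹ * ∑ i : Fin k → Fin 8,
    (starRingEnd ℂ) (α fun m => e (i m)) * β fun m => e (i m)

/-- `|α|²`. -/
noncomputable def formNormSq {k : ℕ} (α : CForm W k) : ℝ := (formInner e α α).re

/-- `formInner` is an inner product on the space of complex-valued `k`-forms. -/
@[reducible]
noncomputable def formInnerCore (k : ℕ) : InnerProductSpace.Core ℂ (CForm W k) where
  inner α β := formInner e α β
  conj_inner_symm α β := by
    simp only [formInner, map_mul, map_sum, map_inv₀, Complex.conj_conj, map_natCast]
    simp only [mul_comm]
  re_inner_nonneg α := by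
    have h : formInner e α α =
        (((k.factorial : ℝ)⁻¹ * ∑ i : Fin k → Fin 8, ‖α fun m => e (i m)‖ ^ 2 : ℝ) : ℂ) := by
      simp [formInner, Complex.conj_mul']
    rw [h]
    simp only [RCLike.re_eq_complex_re, Complex.ofReal_re]
    positivity
  add_left α β γ := by
    simp [formInner, add_mul, Finset.sum_add_distrib, mul_add]
  smul_left α β r := by
    simp only [formInner, AlternatingMap.smul_apply, smul_eq_mul, map_mul, Finset.mul_sum]
    exact Finset.sum_congr rfl fun _ _ => by ring
  definite α h := by
    have h' : formInner e α α =
        (((k.factorial : ℝ)⁻¹ * ∑ i : Fin k → Fin 8, ‖α fun m => e (i m)‖ ^ 2 : ℝ) : ℂ) := by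
      simp [formInner, Complex.conj_mul']
    have h2 := h'.symm.trans h
    rw [Complex.ofReal_eq_zero, mul_eq_zero, or_iff_right (by positivity),
      Finset.sum_eq_zero_iff_of_nonneg (fun _ _ => by positivity)] at h2
    refine Module.Basis.ext_alternating e fun i _ => ?_
    simpa using h2 i (Finset.mem_univ _)

theorem finiteDimensional_cForm (e : Module.Basis (Fin 8) ℝ W) (k : ℕ) : FiniteDimensional ℂ (CForm W k) := by
  let f : CForm W k →ₗ[ℂ] ((Fin k → Fin 8) → ℂ) :=
    { toFun := fun α i => α fun m => e (i m)
      map_add' := fun _ _ => rfl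
      map_smul' := fun _ _ => rfl }
  refine FiniteDimensional.of_injective f fun α β h => ?_
  exact Module.Basis.ext_alternating e fun i _ => congrFun h i

/-- The orthogonal projection of `k`-forms onto the subspace `S`. -/
noncomputable def formProj {k : ℕ} (S : Submodule ℂ (CForm W k)) (α : CForm W k) : CForm W k :=
  letI : NormedAddCommGroup (CForm W k) := (formInnerCore e k).toNormedAddCommGroup
  letI : InnerProductSpace ℂ (CForm W k) := InnerProductSpace.ofCore (formInnerCore e k).toCore
  haveI : FiniteDimensional ℂ (CForm W k) := finiteDimensional_cForm e k
  S.starProjection α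

theorem append_cast_update {k l : ℕ} (h : k + l = 8) (w : Fin k → W) (v : Fin l → W) (j : Fin l)
    (x : W) [DecidableEq (Fin l)] :
    (fun m => Fin.append w (Function.update v j x) (Fin.cast h.symm m)) =
      Function.update (fun m => Fin.append w v (Fin.cast h.symm m))
        (Fin.cast h (Fin.natAdd k j)) x := by
  ext m
  rw [Function.update_apply]
  obtain ⟨m, rfl⟩ : ∃ m', m = Fin.cast h m' := ⟨Fin.cast h.symm m, by simp⟩
  simp only [Fin.cast_cast, Fin.cast_eq_self]
  refine Fin.addCases (fun m => ?_) (fun m => ?_) m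
  · rw [if_neg]
    · simp
    · intro hh
      have := congrArg Fin.val hh
      simp at this
      omega
  · simp [Function.update_apply, Fin.ext_iff]

/-- The Hodge star `Λ^k → Λ^l`, `k + l = 8`, for the oriented orthonormal basis `e`:
`(*α)(v₁, …, v_l) = ∑_{i₁ < ⋯ < i_k} α(e_{i₁}, …, e_{i_k}) vol(e_{i₁}, …, e_{i_k}, v₁, …, v_l)`. -/
noncomputable def hodge {k l : ℕ} (h : k + l = 8) (α : CForm W k) : CForm W l where
  toFun v := (k.factorial : ℂ)⁻¹ * ∑ i : Fin k → Fin 8, (α fun m => e (i m)) *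
    (e.det fun m => Fin.append (fun m => e (i m)) v (Fin.cast h.symm m) : ℝ)
  map_update_add' v j x y := by
    have key := fun (i : Fin k → Fin 8) (x : W) =>
      congrArg e.det (append_cast_update h (fun m => e (i m)) v j x)
    simp only [key, AlternatingMap.map_update_add, Complex.ofReal_add, mul_add,
      Finset.sum_add_distrib]
  map_update_smul' v j c x := by
    have key := fun (i : Fin k → Fin 8) (x : W) =>
      congrArg e.det (append_cast_update h (fun m => e (i m)) v j x)
    simp only [key, AlternatingMap.map_update_smul, smul_eq_mul,
      Complex.ofReal_mul, Complex.real_smul, Finset.mul_sum]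
    exact Finset.sum_congr rfl fun _ _ => by ring
  map_eq_zero_of_eq' v j j' hv hj := by
    rw [Finset.sum_eq_zero, mul_zero]
    intro i _
    rw [AlternatingMap.map_eq_zero_of_eq (i := Fin.cast h (Fin.natAdd k j))
      (j := Fin.cast h (Fin.natAdd k j'))]
    · simp
    · simpa using hv
    · simpa [Fin.ext_iff] using hj

theorem hodge_add {k l : ℕ} (h : k + l = 8) (α β : CForm W k) :
    hodge e h (α + β) = hodge e h α + hodge e h β := by
  ext v
  simp [hodge, add_mul, mul_add, Finset.sum_add_distrib]

theorem hodge_smul {k l : ℕ} (h : k + l = 8) (c : ℂ) (α : CForm W k) :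
    hodge e h (c • α) = c • hodge e h α := by
  ext v
  simp only [hodge, AlternatingMap.coe_mk, MultilinearMap.coe_mk, AlternatingMap.smul_apply,
    smul_eq_mul, Finset.mul_sum]
  exact Finset.sum_congr rfl fun _ _ => by ring

theorem add_wedge {k l : ℕ} (α β : CForm W k) (γ : CForm W l) :
    wedge (α + β) γ = wedge α γ + wedge β γ := by
  have := LinearMap.map_add (AlternatingMap.domCoprod' (R' := ℝ) (Mᵢ := W) (N₁ := ℂ) (N₂ := ℂ) (ιa := Fin k) (ιb := Fin l)) (α ⊗ₜ γ) (β ⊗ₜ γ)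
  rw [← TensorProduct.add_tmul] at this
  simp only [AlternatingMap.domCoprod'_apply] at this
  simp only [wedge, this]
  ext v
  simp

theorem smul_wedge {k l : ℕ} (c : ℂ) (α : CForm W k) (γ : CForm W l) :
    wedge (c • α) γ = c • wedge α γ := by
  ext v
  simp only [wedge, AlternatingMap.domDomCongr_apply, LinearMap.compAlternatingMap_apply,
    AlternatingMap.domCoprod_apply, AlternatingMap.smul_apply, sum_apply, map_sum,
    Finset.smul_sum]
  refine Finset.sum_congr rfl fun σ _ => ?_
  induction σ using Quotient.inductionOn' with | _ σ
  simp only [AlternatingMap.domCoprod.summand_mk'', smul_apply, MultilinearMap.domDomCongr_apply, MultilinearMap.domCoprod_apply]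
  rcases Int.units_eq_one_or (Equiv.Perm.sign σ) with h | h <;> simp [h, mul_assoc]

/-- `Λ²₇ = {α | α ∧ Φ = 3 * α}` (complexified), the irreducible `Spin(7)`-component of rank 7 of the 2-forms. -/
noncomputable def Lambda27 (Φ : W [⋀^Fin 4]→ₗ[ℝ] ℝ) : Submodule ℂ (CForm W 2) where
  carrier := {α | wedge α (complexify Φ) = 3 • hodge e (l := 6) rfl α}
  add_mem' {α β} hα hβ := by
    simp only [Set.mem_ofPred_eq] at *
    rw [add_wedge, hodge_add, hα, hβ, smul_add]
  zero_mem' := by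
    have h1 := smul_wedge (0 : ℂ) (0 : CForm W 2) (complexify Φ)
    have h2 := hodge_smul e (l := 6) rfl (0 : ℂ) (0 : CForm W 2)
    simp only [zero_smul] at h1 h2
    simp only [Set.mem_ofPred_eq, h1, h2, smul_zero]
  smul_mem' c α hα := by
    simp only [Set.mem_ofPred_eq] at *
    rw [smul_wedge, hodge_smul, hα, smul_comm]

/-- `Λ⁴₇` (complexified), the irreducible `Spin(7)`-component of rank 7 of the 4-forms. It is the span of the
forms `a^♭ ∧ i(b)Φ - b^♭ ∧ i(a)Φ`. Writing `Φ = e^0 ∧ φ + *₇φ`, those with `a = e_0` and `b ⟂ e_0` are the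
`e^0 ∧ i(b)(*₇φ) - b^♭ ∧ φ`, which already span it. -/
noncomputable def Lambda47 (Φ : W [⋀^Fin 4]→ₗ[ℝ] ℝ) : Submodule ℂ (CForm W 4) :=
  Submodule.span ℂ (Set.range fun p : W × W =>
    (wedge (flat e p.1) (interiorProd p.2 (complexify Φ)) : CForm W 4)
      - (wedge (flat e p.2) (interiorProd p.1 (complexify Φ)) : CForm W 4))

/-- For a real 2-form `α`, the endomorphism `u ↦ (i(u)α)^♯`, i.e. `g(α^♯ u, v) = α(u, v)`.
(`α` is real, hence equal to its real part, for the forms `-√-1 F` to which this is applied.) -/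
noncomputable def sharp (α : CForm W 2) : W →ₗ[ℝ] W where
  toFun u := ∑ j, (α ![u, e j]).re • e j
  map_add' u v := by
    have h (w : W) : α ![u + v, w] = α ![u, w] + α ![v, w] :=
      congrArg (fun f => f ![w]) (α.curryLeft.map_add u v)
    simp only [h, Complex.add_re, add_smul, Finset.sum_add_distrib]
  map_smul' c u := by
    have h (w : W) : α ![c • u, w] = c • α ![u, w] :=
      congrArg (fun f => f ![w]) (α.curryLeft.map_smul c u)
    simp [h, Finset.smul_sum, smul_smul]

end Forms

section Connection

variable {E : Type*} [NormedAddCommGroup E] [NormedSpace ℝ E] {H : Type*} [TopologicalSpace H]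
  (I : ModelWithCorners ℝ E H)
  {X : Type*} [TopologicalSpace X] [ChartedSpace H X] [IsManifold I ∞ X]
  (L : X → Type*) [∀ x, NormedAddCommGroup (L x)] [∀ x, InnerProductSpace ℂ (L x)]
  [TopologicalSpace (TotalSpace ℂ L)] [FiberBundle ℂ L] [VectorBundle ℝ ℂ L]

/-- The section `σ` of `L` is differentiable at `x`. -/
abbrev DiffSectionAt (σ : Π x, L x) (x : X) : Prop :=
  MDifferentiableAt I (I.prod 𝓘(ℝ, ℂ)) (fun y => TotalSpace.mk' ℂ y (σ y)) x

/-- The section `σ` of `L` is smooth on `u`. -/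
abbrev SmoothSectionOn (σ : Π x, L x) (u : Set X) : Prop :=
  ContMDiffOn I (I.prod 𝓘(ℝ, ℂ)) ∞ (fun y => TotalSpace.mk' ℂ y (σ y)) u

/-- The Hermitian inner products of the fibres of `L` form a smooth Hermitian metric: the inner product of
smooth local sections is smooth. -/
class IsSmoothHermitian : Prop where
  /-- smoothness of `⟨σ, τ⟩` for smooth local sections `σ`, `τ` -/
  contMDiffOn_inner : ∀ {u : Set X} {σ τ : Π x, L x}, IsOpen u → SmoothSectionOn I L σ u →
    SmoothSectionOn I L τ u → ContMDiffOn I 𝓘(ℝ, ℂ) ∞ (fun y => (inner ℂ (σ y) (τ y) : ℂ)) u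

/-- A smooth Hermitian connection `∇` on the complex line bundle `L`: a complex-linear covariant derivative
with `d⟨σ, τ⟩ = ⟨∇σ, τ⟩ + ⟨σ, ∇τ⟩`, mapping smooth sections to smooth sections. -/
structure HermitianConnection extends CovariantDerivative I ℂ L where
  map_I_smul : ∀ {σ : Π x, L x} {x : X}, DiffSectionAt I L σ x → ∀ v : TangentSpace I x,
    toFun (fun y => Complex.I • σ y) x v = Complex.I • toFun σ x v
  metric : ∀ {σ τ : Π x, L x} {x : X}, DiffSectionAt I L σ x → DiffSectionAt I L τ x →
    ∀ v : TangentSpace I x,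
      mvfderiv I (fun y => inner ℂ (σ y) (τ y)) x v =
        inner ℂ (toFun σ x v) (τ x) + inner ℂ (σ x) (toFun τ x v)
  smooth : ∀ u : Set X, IsOpen u → ContMDiffCovariantDerivativeOn ℂ ∞ toFun u

variable {I L}
namespace HermitianConnection
variable [CompleteSpace E]

/-- `∇_U ∇_V σ - ∇_V ∇_U σ - ∇_{[U, V]} σ`. -/
noncomputable def curvatureOp (D : HermitianConnection I L) (σ : Π x, L x)
    (U V : Π x : X, TangentSpace I x) (x : X) : L x :=
  D.toFun (fun y => D.toFun σ y (V y)) x (U x) - D.toFun (fun y => D.toFun σ y (U y)) x (V x)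
    - D.toFun σ x (mlieBracket I U V x)

theorem mdiffAt_apply (D : HermitianConnection I L) {σ : Π x, L x} {x : X} {u : Set X}
    (hu : u ∈ 𝓝 x) (hσ : SmoothSectionOn I L σ u) {U : Π x : X, TangentSpace I x}
    (hU : MDiffAt (T% U) x) : DiffSectionAt I L (fun y => D.toFun σ y (U y)) x := by
  obtain ⟨w, hwu, hw, hxw⟩ := mem_nhds_iff.1 hu
  have h := ((D.smooth w hw).contMDiff (σ := σ) (by simpa using hσ.mono hwu) x hxw).contMDiffAt
    (hw.mem_nhds hxw)
  exact MDifferentiableAt.clm_bundle_apply (h.mdifferentiableAt (by simp)) hU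

theorem curvatureOp_swap (D : HermitianConnection I L) (σ : Π x, L x)
    (U V : Π x : X, TangentSpace I x) (x : X) :
    D.curvatureOp σ U V x = - D.curvatureOp σ V U x := by
  simp only [curvatureOp]
  rw [mlieBracket_swap_apply, map_neg]
  abel

theorem tensorialAt_curvatureOp (D : HermitianConnection I L) {σ : Π x, L x} {x : X} {u : Set X}
    (hu : u ∈ 𝓝 x) (hσ : SmoothSectionOn I L σ u) {V : Π x : X, TangentSpace I x}
    (hV : MDiffAt (T% V) x) :
    TensorialAt I E (fun U => D.curvatureOp σ U V x) x where
  smul {f U} hf hU := by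
    have h1 := D.mdiffAt_apply hu hσ hU
    have h2 : (fun y => D.toFun σ y ((f • U) y)) = f • (fun y => D.toFun σ y (U y)) := by
      ext y; simp
    simp only [curvatureOp, h2, mlieBracket_smul_left hf hU,
      D.isCovariantDerivativeOnUniv.leibniz h1 hf]
    simp
    module
  add {U U'} hU hU' := by
    have h1 := D.mdiffAt_apply hu hσ hU
    have h1' := D.mdiffAt_apply hu hσ hU'
    have h2 : (fun y => D.toFun σ y ((U + U') y)) =
      (fun y => D.toFun σ y (U y)) + (fun y => D.toFun σ y (U' y)) := by
      ext y; simp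
    simp only [curvatureOp, h2, mlieBracket_add_left hU hU',
      D.isCovariantDerivativeOnUniv.add h1 h1']
    simp
    module

theorem tensorialAt_curvatureOp' (D : HermitianConnection I L) {σ : Π x, L x} {x : X} {u : Set X}
    (hu : u ∈ 𝓝 x) (hσ : SmoothSectionOn I L σ u) {U : Π x : X, TangentSpace I x}
    (hU : MDiffAt (T% U) x) :
    TensorialAt I E (fun V => D.curvatureOp σ U V x) x where
  smul {f V} hf hV := by
    rw [curvatureOp_swap, (D.tensorialAt_curvatureOp hu hσ hU).smul hf hV, curvatureOp_swap D σ U V,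
      smul_neg]
  add {V V'} hV hV' := by
    rw [curvatureOp_swap, (D.tensorialAt_curvatureOp hu hσ hU).add hV hV', curvatureOp_swap D σ U V,
      curvatureOp_swap D σ U V']
    abel


theorem curvatureOp_self (D : HermitianConnection I L) (σ : Π x, L x)
    (U : Π x : X, TangentSpace I x) (x : X) : D.curvatureOp σ U U x = 0 := by
  simp [curvatureOp]

variable [FiniteDimensional ℝ E] [ContMDiffVectorBundle ∞ ℂ L I]

variable (L) in
/-- A nonzero vector of the complex line `L x`: `1 : ℂ` in a local trivialization. -/
noncomputable def frameVector (x : X) : L x := (trivializationAt ℂ L x).symm x 1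

/-- `R(u, v) s₀ = (∇_U ∇_V σ - ∇_V ∇_U σ - ∇_{[U, V]} σ)(x)` for a local section `σ` through the nonzero
vector `s₀` of the line `L x` and vector fields `U`, `V` through `u`, `v`. -/
noncomputable def curvatureHom (D : HermitianConnection I L) (x : X) :
    TangentSpace I x →L[ℝ] TangentSpace I x →L[ℝ] L x :=
  TensorialAt.mkHom₂ (I := I) (F := E) (F' := E)
    (fun U V => D.curvatureOp (FiberBundle.extend ℂ (frameVector L x)) U V x) x
    (fun _ hV => by
      obtain ⟨u, hu, hσ⟩ := FiberBundle.exists_contMDiffOn_extend (k := ∞) I ℂ (frameVector L x)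
      exact D.tensorialAt_curvatureOp hu hσ hV)
    (fun _ hU => by
      obtain ⟨u, hu, hσ⟩ := FiberBundle.exists_contMDiffOn_extend (k := ∞) I ℂ (frameVector L x)
      exact D.tensorialAt_curvatureOp' hu hσ hU)

/-- The curvature 2-form `F` at `x`: the complex-valued 2-form with `R(u, v) s = F(u, v) s` on the complex line
`L x`. Since the connection is Hermitian, it takes values in `iℝ`. -/
noncomputable def curvature (D : HermitianConnection I L) (x : X) :
    CForm (TangentSpace I x) 2 where
  toFun v := (inner ℂ (frameVector L x) (D.curvatureHom x (v 0) (v 1)) : ℂ) /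
    inner ℂ (frameVector L x) (frameVector L x)
  map_update_add' v i a b := by
    fin_cases i <;> simp [Function.update, add_div]
  map_update_smul' v i c a := by
    fin_cases i <;> simp [Function.update, inner_smul_right_eq_smul, mul_div_assoc]
  map_eq_zero_of_eq' v i j hv hij := by
    have h : v 0 = v 1 := by
      fin_cases i <;> fin_cases j <;> first | exact absurd rfl hij | exact hv | exact hv.symm
    rw [h, curvatureHom, TensorialAt.mkHom₂_apply_eq_extend, curvatureOp_self]
    simp

end HermitianConnection
end Connection

section Powers

variable {W : Type*} [AddCommGroup W] [Module ℝ W]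

/-- `F² = F ∧ F`. -/
noncomputable def wedgeSq (F : CForm W 2) : CForm W 4 := wedge F F

/-- `F³ = F ∧ F ∧ F`. -/
noncomputable def wedgeCube (F : CForm W 2) : CForm W 6 := wedge (wedgeSq F) F

/-- `F⁴ = F ∧ F ∧ F ∧ F`. -/
noncomputable def wedgeFourth (F : CForm W 2) : CForm W 8 := wedge (wedgeCube F) F

end Powers

section Spin7

variable (X : Type*) [TopologicalSpace X] [ChartedSpace R8 X] [IsManifold (𝓡 8) ∞ X]

/-- A (not necessarily torsion-free) `Spin(7)`-structure on the 8-manifold `X`: a smooth 4-form which at each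
point is the Cayley 4-form in some basis of the tangent space. -/
structure Spin7Structure where
  /-- the 4-form -/
  Φ : ∀ x : X, TangentSpace (𝓡 8) x [⋀^Fin 4]→L[ℝ] ℝ
  smooth : ContMDiff (𝓡 8) ((𝓡 8).prod 𝓘(ℝ, R8 [⋀^Fin 4]→L[ℝ] ℝ)) ∞
    (fun x => (⟨x, Φ x⟩ : TotalSpace (R8 [⋀^Fin 4]→L[ℝ] ℝ)
      (fun x : X => TangentSpace (𝓡 8) x [⋀^Fin 4]→L[ℝ] Bundle.Trivial X ℝ x)))
  exists_frame : ∀ x, ∃ e : Module.Basis (Fin 8) ℝ (TangentSpace (𝓡 8) x),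
    (Φ x).toAlternatingMap = cayleyForm e

variable {X}

namespace Spin7Structure

/-- A basis of the tangent space in which `Φ` is the Cayley 4-form. It is orthonormal and oriented for the
inner product `g_Φ` and the orientation determined by `Φ`; these, and so the inner product of forms, `*` and
`♯` below, do not depend on the choice. -/
noncomputable def frame (S : Spin7Structure X) (x : X) :
    Module.Basis (Fin 8) ℝ (TangentSpace (𝓡 8) x) :=
  Classical.choose (S.exists_frame x)

variable {L : X → Type*} [∀ x, NormedAddCommGroup (L x)] [∀ x, InnerProductSpace ℂ (L x)]
  [TopologicalSpace (TotalSpace ℂ L)] [FiberBundle ℂ L] [VectorBundle ℝ ℂ L]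
  [ContMDiffVectorBundle ∞ ℂ L (𝓡 8)]

/-- `1 + ½⟨F², Φ⟩ + *F⁴/24` at `x`. -/
noncomputable def scalar (S : Spin7Structure X) (D : HermitianConnection (𝓡 8) L) (x : X) : ℂ :=
  1 + 1 / 2 * formInner (S.frame x) (wedgeSq (D.curvature x))
      (complexify (S.Φ x).toAlternatingMap)
    + hodge (S.frame x) (l := 0) rfl (wedgeFourth (D.curvature x)) ![] / 24

/-- `π²₇(F + *F³/6)` at `x`. -/
noncomputable def proj27 (S : Spin7Structure X) (D : HermitianConnection (𝓡 8) L) (x : X) :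
    CForm (TangentSpace (𝓡 8) x) 2 :=
  formProj (S.frame x) (Lambda27 (S.frame x) (S.Φ x).toAlternatingMap)
    (D.curvature x + (1 / 6 : ℂ) • hodge (S.frame x) (l := 2) rfl (wedgeCube (D.curvature x)))

/-- `π⁴₇(F²)` at `x`. -/
noncomputable def proj47 (S : Spin7Structure X) (D : HermitianConnection (𝓡 8) L) (x : X) :
    CForm (TangentSpace (𝓡 8) x) 4 :=
  formProj (S.frame x) (Lambda47 (S.frame x) (S.Φ x).toAlternatingMap) (wedgeSq (D.curvature x))

/-- `det (id + (-√-1 F)^♯)` at `x`. -/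
noncomputable def detTerm (S : Spin7Structure X) (D : HermitianConnection (𝓡 8) L) (x : X) : ℝ :=
  LinearMap.det (LinearMap.id + sharp (S.frame x) (-Complex.I • D.curvature x))

/-- `∇` is a deformed Donaldson--Thomas connection for the `Spin(7)`-structure:
`π²₇(F + *F³/6) = 0` and `π⁴₇(F²) = 0`. -/
def IsSpin7DDT (S : Spin7Structure X) (D : HermitianConnection (𝓡 8) L) : Prop :=
  (∀ x, S.proj27 D x = 0) ∧ ∀ x, S.proj47 D x = 0

end Spin7Structure
end Spin7

end Spin7dDT

open Spin7dDT

/-! The theorem is pointwise, and all but one of its ingredients is linear algebra in a single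
tangent space. The exception is that `F` is purely imaginary. For `f = |σ|²`, the identity `[U, V] f
= U(V f) - V(U f)` together with metric compatibility gives `⟨Rσ, σ⟩ + ⟨σ, Rσ⟩ = 0`
(`HermitianConnection.inner_curvatureOp`). In a frame adapted to `Φ` the curvature is therefore `√-1
x` with `x` a real skew-symmetric 8 by 8 matrix.

The right side: `det (1 + x)` is the sum of the principal minors of `x`. Those of odd size vanish
and those of even size are squares of Pfaffians (`det_one_add_skew`), so the determinant is `1 + ∑
x_{pq}² + ∑ Pf₄² + ∑ Pf₆² + Pf₈²`.

The left side: the coefficients of `F^k` are `k! (√-1)^k` times sub-Pfaffians of `x`. The spaces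
`Λ²₇` and `Λ⁴₇` have explicit orthogonal bases `η_j` and `ω_j`, of squared lengths 4 and 8, which
the factors 4 and 2 of the theorem absorb. Let `c` be the pairing of `Φ` with the 4 by 4 Pfaffians,
`p = Pf₈`, and `x*` the Hodge dual of `x³/6`, where `x` is read as a 2-form. The left side becomes
`(1 - c + p)² + ∑ ⟨η_j, x - x*⟩² + ∑ ω_j(x)²`, where `ω_j(x)` pairs `ω_j` with the Pfaffians.

The two sides agree degree by degree in `x` (`cayley_det_identity`). Degrees 0 and 8 are immediate.
Degree 2 is `sum_listSum2_eta_sq`, degree 6 is the same identity at `x*` combined with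
`listPf4_cayley_dual`, and degree 4 is `quartic_identity`. The inequality and its equality case
follow since the two squared norms are nonnegative and vanish only with the projections. -/

namespace Spin7dDT

/-! ### The Lie bracket as a commutator of derivations -/

section LieDerivative

variable {E : Type*} [NormedAddCommGroup E] [NormedSpace ℝ E] {H : Type*} [TopologicalSpace H]
  {I : ModelWithCorners ℝ E H} [I.Boundaryless]
  {X : Type*} [TopologicalSpace X] [ChartedSpace H X] [IsManifold I ∞ X]
  {G : Type*} [NormedAddCommGroup G] [NormedSpace ℝ G]

theorem two_le_infty : (2 : WithTop ℕ∞) ≤ ∞ :=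
  WithTop.coe_le_coe.2 (le_top : (2 : ℕ∞) ≤ ⊤)

theorem contMDiffAt_extChartAt_symm_target {x : X} {z : E} (hz : z ∈ (extChartAt I x).target) :
    ContMDiffAt 𝓘(ℝ, E) I ∞ (extChartAt I x).symm z :=
  (contMDiffOn_extChartAt_symm (I := I) (n := ∞) x _ hz).contMDiffAt
    ((isOpen_extChartAt_target x).mem_nhds hz)

/-- A tangent vector at `y` in the chart at `x`. -/
noncomputable def chartVec (x y : X) (w : TangentSpace I y) : E :=
  mfderiv I 𝓘(ℝ, E) (extChartAt I x) y w

theorem mvfderiv_congr {f g : X → G} {x : X} (h : f =ᶠ[𝓝 x] g) (w : TangentSpace I x) :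
    mvfderiv I f x w = mvfderiv I g x w :=
  congrArg (fun A : E →L[ℝ] G => A w) h.mfderiv_eq

theorem mvfderiv_comp_extChartAt {g : E → G} {x y : X} (hy : y ∈ (extChartAt I x).source)
    (hg : DifferentiableAt ℝ g (extChartAt I x y)) (w : TangentSpace I y) :
    mvfderiv I (g ∘ extChartAt I x) y w =
      fderiv ℝ g (extChartAt I x y) (chartVec x y w) := by
  have hφ : MDifferentiableAt I 𝓘(ℝ, E) (extChartAt I x) y :=
    mdifferentiableAt_extChartAt (by simpa using hy)
  have h := mfderiv_comp y hg.mdifferentiableAt hφ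
  simp only [mvfderiv, h, mfderiv_eq_fderiv]
  rfl

theorem eventuallyEq_comp_extChartAt (f : X → G) {x y : X} (hy : y ∈ (extChartAt I x).source) :
    f =ᶠ[𝓝 y] (f ∘ (extChartAt I x).symm) ∘ extChartAt I x := by
  filter_upwards [(isOpen_extChartAt_source x).mem_nhds hy] with z hz
  rw [Function.comp_apply, Function.comp_apply, (extChartAt I x).left_inv hz]

theorem mvfderiv_eq_fderiv_extChartAt {f : X → G} {x y : X} (hy : y ∈ (extChartAt I x).source)
    (hf : MDifferentiableAt I 𝓘(ℝ, G) f y) (w : TangentSpace I y) :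
    mvfderiv I f y w = fderiv ℝ (f ∘ (extChartAt I x).symm) (extChartAt I x y)
      (chartVec x y w) := by
  have hs := (contMDiffAt_extChartAt_symm_target
    ((extChartAt I x).map_source hy)).mdifferentiableAt (by simp)
  have hg : MDifferentiableAt 𝓘(ℝ, E) 𝓘(ℝ, G) (f ∘ (extChartAt I x).symm) (extChartAt I x y) := by
    refine MDifferentiableAt.comp _ ?_ hs
    rwa [(extChartAt I x).left_inv hy]
  rw [← mvfderiv_comp_extChartAt hy hg.differentiableAt]
  exact mvfderiv_congr (eventuallyEq_comp_extChartAt f hy) w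

/-- A vector field in the chart at `x`. -/
noncomputable def chartField (x : X) (U : Π y : X, TangentSpace I y) : E → E :=
  fun z => mpullbackWithin 𝓘(ℝ, E) I (extChartAt I x).symm U (Set.range I) z

/-- The pullback is defined by inverting the derivative of the inverse chart, and that inverse is
the derivative of the chart. -/
theorem chartField_apply {x y : X} (U : Π y : X, TangentSpace I y)
    (hy : y ∈ (extChartAt I x).source) :
    chartField x U (extChartAt I x y) = chartVec x y (U y) := by
  have hz := (extChartAt I x).map_source hy
  have : IsManifold I 1 X := IsManifold.of_le (n := ∞) (one_le_two.trans two_le_infty)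
  have h1 := mfderivWithin_extChartAt_symm_comp_mfderiv_extChartAt (I := I) hz
  have h2 := mfderiv_extChartAt_comp_mfderivWithin_extChartAt_symm (I := I) hz
  have h3 := ContinuousLinearMap.inverse_eq h1 h2
  unfold chartField
  rw [mpullbackWithin_apply, h3, (extChartAt I x).left_inv hy]
  rfl

variable [CompleteSpace E]

theorem differentiableAt_chartField {x : X} {U : Π y : X, TangentSpace I y}
    (hU : MDiffAt (T% U) x) : DifferentiableAt ℝ (chartField x U) (extChartAt I x x) := by
  have : IsManifold I 2 X := IsManifold.of_le (n := ∞) two_le_infty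
  have := MDifferentiableWithinAt.differentiableWithinAt_mpullbackWithin_vectorField
    (s := Set.univ) hU.mdifferentiableWithinAt
  -- Without boundary, the set on which the pullback is known to be differentiable is all of `E`.
  -- Quantifying over `s` makes the substitution possible.
  have key : ∀ s : Set E, s = Set.univ → DifferentiableWithinAt ℝ (chartField x U) s
      (extChartAt I x x) → DifferentiableAt ℝ (chartField x U) (extChartAt I x x) := by
    rintro _ rfl h
    exact differentiableWithinAt_univ.1 h
  exact key _ (by simp [I.range_eq_univ]) this

/-- The product rule in a chart: one term differentiates the vector field, the other is the Hessian
of `f`, which cancels in commutators. -/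
theorem mvfderiv_mvfderiv_apply {f : X → G} {x : X} (hf : ContMDiffAt I 𝓘(ℝ, G) 2 f x)
    {U : Π y : X, TangentSpace I y} (hU : MDiffAt (T% U) x) (w : TangentSpace I x) :
    mvfderiv I (fun y => mvfderiv I f y (U y)) x w =
      fderiv ℝ (f ∘ (extChartAt I x).symm) (extChartAt I x x)
        (fderiv ℝ (chartField x U) (extChartAt I x x) (chartVec x x w))
      + fderiv ℝ (fderiv ℝ (f ∘ (extChartAt I x).symm)) (extChartAt I x x)
        (chartVec x x w)
        (chartVec x x (U x)) := by
  have hx := mem_extChartAt_source (I := I) x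
  have hz := (extChartAt I x).map_source hx
  have hf' : ContDiffAt ℝ 2 (f ∘ (extChartAt I x).symm) (extChartAt I x x) := by
    refine ContMDiffAt.contDiffAt (ContMDiffAt.comp _ ?_
      ((contMDiffAt_extChartAt_symm_target hz).of_le two_le_infty))
    rwa [(extChartAt I x).left_inv hx]
  have hd : DifferentiableAt ℝ (fderiv ℝ (f ∘ (extChartAt I x).symm)) (extChartAt I x x) :=
    (hf'.fderiv_right (m := 1) (by norm_num [one_add_one_eq_two])).differentiableAt (by simp)
  have hev : ∀ᶠ y in 𝓝 x, MDifferentiableAt I 𝓘(ℝ, G) f y := by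
    have : IsManifold I 2 X := IsManifold.of_le (n := ∞) two_le_infty
    obtain ⟨u, hu, hfu⟩ := (contMDiffAt_iff_contMDiffOn_nhds (by simp)).1 hf
    obtain ⟨w, hwu, hw, hxw⟩ := mem_nhds_iff.1 hu
    filter_upwards [hw.mem_nhds hxw] with y hy
    exact ((hfu y (hwu hy)).contMDiffAt (mem_nhds_iff.2 ⟨w, hwu, hw, hy⟩)).mdifferentiableAt
      (by simp)
  have he : (fun y => mvfderiv I f y (U y)) =ᶠ[𝓝 x]
      (fun z => fderiv ℝ (f ∘ (extChartAt I x).symm) z (chartField x U z)) ∘ extChartAt I x := by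
    filter_upwards [hev, (isOpen_extChartAt_source x).mem_nhds hx] with y hy hys
    rw [mvfderiv_eq_fderiv_extChartAt hys hy, Function.comp_apply, chartField_apply U hys]
  have hU' := differentiableAt_chartField hU
  rw [mvfderiv_congr he, mvfderiv_comp_extChartAt hx (hd.clm_apply hU'), fderiv_clm_apply hd hU',
    chartField_apply U hx]
  rfl

/-- `d f([U, V]) = U (V f) - V (U f)`. -/
theorem mvfderiv_mlieBracket {f : X → G} {x : X} (hf : ContMDiffAt I 𝓘(ℝ, G) 2 f x)
    {U V : Π y : X, TangentSpace I y} (hU : MDiffAt (T% U) x) (hV : MDiffAt (T% V) x) :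
    mvfderiv I f x (mlieBracket I U V x) =
      mvfderiv I (fun y => mvfderiv I f y (V y)) x (U x)
      - mvfderiv I (fun y => mvfderiv I f y (U y)) x (V x) := by
  have hx := mem_extChartAt_source (I := I) x
  have hz := (extChartAt I x).map_source hx
  have hf' : ContDiffAt ℝ 2 (f ∘ (extChartAt I x).symm) (extChartAt I x x) := by
    refine ContMDiffAt.contDiffAt (ContMDiffAt.comp _ ?_
      ((contMDiffAt_extChartAt_symm_target hz).of_le two_le_infty))
    rwa [(extChartAt I x).left_inv hx]
  -- Symmetry of the Hessian leaves only the terms with derivatives of the fields, whose difference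
  -- is the bracket in the chart.
  have hsymm := hf'.isSymmSndFDerivAt (by simp)
  have : IsManifold I 1 X := IsManifold.of_le (n := ∞) (one_le_two.trans two_le_infty)
  have hinv := isInvertible_mfderiv_extChartAt (I := I) hx
  rw [mvfderiv_eq_fderiv_extChartAt hx (hf.mdifferentiableAt (by simp)),
    mvfderiv_mvfderiv_apply hf hU, mvfderiv_mvfderiv_apply hf hV,
    hsymm.eq (chartVec x x (U x))]
  have hb : chartVec x x (mlieBracket I U V x) =
      lieBracket ℝ (chartField x U) (chartField x V) (extChartAt I x x) := by
    rw [← mlieBracketWithin_univ, mlieBracketWithin_apply, chartVec]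
    have key : ∀ s : Set E, s = Set.univ → lieBracketWithin ℝ (chartField x U) (chartField x V) s
        (extChartAt I x x) = lieBracket ℝ (chartField x U) (chartField x V) (extChartAt I x x) := by
      rintro _ rfl
      rw [lieBracketWithin_univ]
    exact (hinv.self_apply_inverse _).trans (key _ (by simp [I.range_eq_univ]))
  rw [hb, lieBracket, chartField_apply U hx, chartField_apply V hx, map_sub]
  abel

end LieDerivative

/-! ### The curvature of a Hermitian connection is imaginary -/

section Curvature

variable {E : Type*} [NormedAddCommGroup E] [NormedSpace ℝ E] [FiniteDimensional ℝ E]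
  [CompleteSpace E] {H : Type*} [TopologicalSpace H]
  {I : ModelWithCorners ℝ E H} [I.Boundaryless]
  {X : Type*} [TopologicalSpace X] [ChartedSpace H X] [IsManifold I ∞ X]
  {L : X → Type*} [∀ x, NormedAddCommGroup (L x)] [∀ x, InnerProductSpace ℂ (L x)]
  [TopologicalSpace (TotalSpace ℂ L)] [FiberBundle ℂ L] [VectorBundle ℝ ℂ L]
  [ContMDiffVectorBundle ∞ ℂ L I]

namespace HermitianConnection

theorem exists_isOpen_smoothSectionOn_extend (x : X) :
    ∃ u : Set X, IsOpen u ∧ x ∈ u ∧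
      SmoothSectionOn I L (FiberBundle.extend ℂ (frameVector L x)) u := by
  obtain ⟨u, hu, hσ⟩ := FiberBundle.exists_contMDiffOn_extend (k := ∞) I ℂ (frameVector L x)
  obtain ⟨w, hwu, hw, hxw⟩ := mem_nhds_iff.1 hu
  exact ⟨w, hw, hxw, hσ.mono hwu⟩

theorem smoothSectionOn_apply (D : HermitianConnection I L) {σ : Π x, L x} {u : Set X}
    (hu : IsOpen u) (hσ : SmoothSectionOn I L σ u) {U : Π x : X, TangentSpace I x}
    (hU : ContMDiffOn I (I.prod 𝓘(ℝ, E)) ∞ (T% U) u) :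
    SmoothSectionOn I L (fun y => D.toFun σ y (U y)) u :=
  ContMDiffOn.clm_bundle_apply ((D.smooth u hu).contMDiff (σ := σ) (by simpa using hσ)) hU

theorem mdifferentiableAt_inner [IsSmoothHermitian I L] {σ τ : Π x, L x} {u : Set X}
    (hu : IsOpen u) (hσ : SmoothSectionOn I L σ u) (hτ : SmoothSectionOn I L τ u) {x : X}
    (hx : x ∈ u) : MDifferentiableAt I 𝓘(ℝ, ℂ) (fun y => (inner ℂ (σ y) (τ y) : ℂ)) x :=
  ((IsSmoothHermitian.contMDiffOn_inner hu hσ hτ).contMDiffAt (hu.mem_nhds hx)).mdifferentiableAt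
    (by simp)

/-- Metric compatibility used twice. The two mixed terms together are symmetric in `U x` and `w`, so
they drop out of `U(V f) - V(U f)`. -/
theorem mvfderiv_mvfderiv_inner [IsSmoothHermitian I L] (D : HermitianConnection I L)
    {σ : Π x, L x} {u : Set X} (hu : IsOpen u) (hσ : SmoothSectionOn I L σ u)
    {U : Π x : X, TangentSpace I x} (hU : ContMDiffOn I (I.prod 𝓘(ℝ, E)) ∞ (T% U) u) {x : X}
    (hx : x ∈ u) (w : TangentSpace I x) :
    mvfderiv I (fun y => mvfderiv I (fun y => (inner ℂ (σ y) (σ y) : ℂ)) y (U y)) x w =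
      (inner ℂ (D.toFun (fun y => D.toFun σ y (U y)) x w) (σ x)
        + inner ℂ (D.toFun σ x (U x)) (D.toFun σ x w))
      + (inner ℂ (D.toFun σ x w) (D.toFun σ x (U x))
        + inner ℂ (σ x) (D.toFun (fun y => D.toFun σ y (U y)) x w)) := by
  have hd : ∀ {τ : Π x, L x}, SmoothSectionOn I L τ u → ∀ y ∈ u, DiffSectionAt I L τ y :=
    fun hτ y hy => (hτ.contMDiffAt (hu.mem_nhds hy)).mdifferentiableAt (by simp)
  have hτ := D.smoothSectionOn_apply hu hσ hU
  have he : (fun y => mvfderiv I (fun y => (inner ℂ (σ y) (σ y) : ℂ)) y (U y)) =ᶠ[𝓝 x]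
      (fun y => (inner ℂ (D.toFun σ y (U y)) (σ y) : ℂ))
        + fun y => (inner ℂ (σ y) (D.toFun σ y (U y)) : ℂ) := by
    filter_upwards [hu.mem_nhds hx] with y hy
    rw [D.metric (hd hσ y hy) (hd hσ y hy)]
    rfl
  rw [mvfderiv_congr he, mvfderiv_add (mdifferentiableAt_inner hu hτ hσ hx)
    (mdifferentiableAt_inner hu hσ hτ hx), _root_.add_apply,
    D.metric (hd hτ x hx) (hd hσ x hx), D.metric (hd hσ x hx) (hd hτ x hx)]

/-- The function `f = |σ|²` satisfies `U(V f) - V(U f) - [U, V] f = 0`; metric compatibility turns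
this into skewness of the curvature operator. -/
theorem inner_curvatureOp [IsSmoothHermitian I L] (D : HermitianConnection I L)
    {σ : Π x, L x} {u : Set X} (hu : IsOpen u) (hσ : SmoothSectionOn I L σ u)
    {U V : Π x : X, TangentSpace I x} (hU : ContMDiffOn I (I.prod 𝓘(ℝ, E)) ∞ (T% U) u)
    (hV : ContMDiffOn I (I.prod 𝓘(ℝ, E)) ∞ (T% V) u) {x : X} (hx : x ∈ u) :
    (inner ℂ (D.curvatureOp σ U V x) (σ x) : ℂ) + inner ℂ (σ x) (D.curvatureOp σ U V x) = 0 := by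
  have hf : ContMDiffAt I 𝓘(ℝ, ℂ) 2 (fun y => (inner ℂ (σ y) (σ y) : ℂ)) x :=
    ((IsSmoothHermitian.contMDiffOn_inner hu hσ hσ).contMDiffAt (hu.mem_nhds hx)).of_le two_le_infty
  have h := mvfderiv_mlieBracket hf
    ((hU.contMDiffAt (hu.mem_nhds hx)).mdifferentiableAt (by simp))
    ((hV.contMDiffAt (hu.mem_nhds hx)).mdifferentiableAt (by simp))
  have hd : DiffSectionAt I L σ x :=
    (hσ.contMDiffAt (hu.mem_nhds hx)).mdifferentiableAt (by simp)
  rw [D.mvfderiv_mvfderiv_inner hu hσ hU hx, D.mvfderiv_mvfderiv_inner hu hσ hV hx,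
    D.metric hd hd] at h
  simp only [curvatureOp, inner_sub_left, inner_sub_right]
  linear_combination -h

/-- The curvature of a Hermitian connection is purely imaginary. -/
theorem curvature_re [IsSmoothHermitian I L] (D : HermitianConnection I L) (x : X)
    (v : Fin 2 → TangentSpace I x) : (D.curvature x v).re = 0 := by
  obtain ⟨u, hu, hxu, hσ⟩ := exists_isOpen_smoothSectionOn_extend (I := I) (L := L) x
  obtain ⟨u₁, hu₁, hU⟩ := FiberBundle.exists_contMDiffOn_extend (k := ∞) I E (v 0)
  obtain ⟨u₂, hu₂, hV⟩ := FiberBundle.exists_contMDiffOn_extend (k := ∞) I E (v 1)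
  obtain ⟨w, hwu, hw, hxw⟩ := mem_nhds_iff.1
    (Filter.inter_mem (hu.mem_nhds hxu) (Filter.inter_mem hu₁ hu₂))
  have h := D.inner_curvatureOp hw (hσ.mono fun y hy => (hwu hy).1)
    (hU.mono fun y hy => (hwu hy).2.1) (hV.mono fun y hy => (hwu hy).2.2) hxw
  -- Tensoriality allows the curvature to be computed with smooth extensions of the two tangent
  -- vectors.
  have hv : D.curvatureHom x (v 0) (v 1) =
      D.curvatureOp (FiberBundle.extend ℂ (frameVector L x)) (FiberBundle.extend E (v 0))
        (FiberBundle.extend E (v 1)) x := by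
    rw [curvatureHom, TensorialAt.mkHom₂_apply_eq_extend]
  rw [← hv, FiberBundle.extend_apply_self, ← inner_conj_symm] at h
  have h' := congrArg Complex.re h
  have h2 : ∀ z : ℂ, ((starRingEnd ℂ) z + z).re = 0 → z.re = 0 := fun z hz => by
    simp at hz; linarith
  have h3 := h2 _ h'
  -- The denominator in `curvature` is real, so dividing by it keeps the real part zero.
  have h4 : (inner ℂ (frameVector L x) (frameVector L x) : ℂ) =
      ((‖frameVector L x‖ ^ 2 : ℝ) : ℂ) := by
    rw [inner_self_eq_norm_sq_to_K]; simp
  change ((inner ℂ (frameVector L x) (D.curvatureHom x (v 0) (v 1)) : ℂ) /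
    inner ℂ (frameVector L x) (frameVector L x)).re = 0
  rw [h4, Complex.div_ofReal_re, h3, zero_div]

end HermitianConnection
end Curvature

/-! ### Exterior products as alternating sums -/

section AlternatingSum

variable {W : Type*}

/-- The alternating sum of `f` over the permutations of its arguments. -/
noncomputable def altSum {n : ℕ} (f : (Fin n → W) → ℂ) (v : Fin n → W) : ℂ :=
  ∑ σ : Equiv.Perm (Fin n), ((Equiv.Perm.sign σ : ℤ) : ℂ) * f (v ∘ σ)

/-- Reindexing by right multiplication with `ρ`. This is what exchanges the factors of an exterior
product below. -/
theorem altSum_comp_perm {n : ℕ} (f : (Fin n → W) → ℂ) (ρ : Equiv.Perm (Fin n)) (v : Fin n → W) :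
    altSum (fun w => f (w ∘ ρ)) v = ((Equiv.Perm.sign ρ : ℤ) : ℂ) * altSum f v := by
  unfold altSum
  rw [Finset.mul_sum, ← Equiv.sum_comp (Equiv.mulRight ρ) fun σ => _ * (_ * f (v ∘ σ))]
  refine Finset.sum_congr rfl fun σ _ => ?_
  have h : ((Equiv.Perm.sign ρ : ℤ) : ℂ) * ((Equiv.Perm.sign ρ : ℤ) : ℂ) = 1 := by
    rcases Int.units_eq_one_or (Equiv.Perm.sign ρ) with h | h <;> simp [h]
  simp only [Equiv.coe_mulRight, Equiv.Perm.sign_mul, Units.val_mul, Int.cast_mul,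
    Equiv.Perm.coe_mul, Function.comp_assoc]
  linear_combination (-((Equiv.Perm.sign σ : ℤ) : ℂ) * f (v ∘ σ ∘ ρ)) * h

/-- The permutation with `0 ↦ a` and `j + 1 ↦ a.succAbove (τ j)`. -/
noncomputable def insertPerm {n : ℕ} (a : Fin (n + 1)) (τ : Equiv.Perm (Fin n)) : Equiv.Perm (Fin (n + 1)) :=
  a.cycleRange⁻¹ * Equiv.Perm.decomposeFin.symm (0, τ)

theorem insertPerm_zero {n : ℕ} (a : Fin (n + 1)) (τ : Equiv.Perm (Fin n)) :
    insertPerm a τ 0 = a := by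
  simp [insertPerm, Equiv.Perm.inv_def]

theorem insertPerm_succ {n : ℕ} (a : Fin (n + 1)) (τ : Equiv.Perm (Fin n)) (j : Fin n) :
    insertPerm a τ j.succ = a.succAbove (τ j) := by
  simp [insertPerm, Equiv.Perm.inv_def]

theorem sign_insertPerm {n : ℕ} (a : Fin (n + 1)) (τ : Equiv.Perm (Fin n)) :
    Equiv.Perm.sign (insertPerm a τ) = (-1) ^ (a : ℕ) * Equiv.Perm.sign τ := by
  simp [insertPerm]

theorem insertPerm_bijective {n : ℕ} : Function.Bijective
    (fun p : Fin (n + 1) × Equiv.Perm (Fin n) => insertPerm p.1 p.2) := by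
  rw [Fintype.bijective_iff_injective_and_card]
  refine ⟨?_, by simp [Fintype.card_perm, Nat.factorial_succ]⟩
  rintro ⟨a, τ⟩ ⟨b, τ'⟩ h
  have h0 : a = b := by simpa [insertPerm_zero] using congrArg (fun ρ => ρ 0) h
  subst h0
  refine Prod.ext rfl (Equiv.ext fun j => ?_)
  simpa [insertPerm_succ] using congrArg (fun ρ => ρ j.succ) h

/-- Laplace expansion of an alternating sum along the first argument. -/
theorem altSum_succ {n : ℕ} (f : (Fin (n + 1) → W) → ℂ) (v : Fin (n + 1) → W) :
    altSum f v = ∑ a : Fin (n + 1), (-1) ^ (a : ℕ) *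
      altSum (fun w => f (Matrix.vecCons (v a) w)) (fun j => v (a.succAbove j)) := by
  unfold altSum
  rw [← insertPerm_bijective.sum_comp, Fintype.sum_prod_type]
  refine Finset.sum_congr rfl fun a _ => ?_
  rw [Finset.mul_sum]
  refine Finset.sum_congr rfl fun τ _ => ?_
  have h : v ∘ insertPerm a τ = Matrix.vecCons (v a) ((fun j => v (a.succAbove j)) ∘ τ) := by
    funext j
    refine Fin.cases ?_ (fun j => ?_) j
    · simp [insertPerm_zero]
    · simp [insertPerm_succ]
  rw [h, sign_insertPerm]
  push_cast
  ring

theorem altSum_mul_left {n : ℕ} (c : ℂ) (f : (Fin n → W) → ℂ) (v : Fin n → W) :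
    altSum (fun w => c * f w) v = c * altSum f v := by
  simp only [altSum, Finset.mul_sum]
  exact Finset.sum_congr rfl fun _ _ => by ring

variable [AddCommGroup W] [Module ℝ W]

theorem altSum_alternating {n : ℕ} (α : CForm W n) (v : Fin n → W) :
    altSum (fun w => α w) v = n.factorial * α v := by
  have h : ∀ σ : Equiv.Perm (Fin n), ((Equiv.Perm.sign σ : ℤ) : ℂ) * α (v ∘ σ) = α v := by
    intro σ
    rw [α.map_perm]
    rcases Int.units_eq_one_or (Equiv.Perm.sign σ) with h | h <;> simp [h]
  simp [altSum, h, Fintype.card_perm]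

/-- The exterior product sums over shuffles, and the full alternating sum meets each shuffle `k! l!`
times. -/
theorem wedge_eq_altSum {k l : ℕ} (α : CForm W k) (β : CForm W l) (v : Fin (k + l) → W) :
    (k.factorial * l.factorial : ℂ) * wedge α β v =
      altSum (fun w => α (fun i => w (Fin.castAdd l i)) * β fun i => w (Fin.natAdd k i)) v := by
  have h := congrArg (fun γ => LinearMap.mul' ℝ ℂ (γ (fun i => v (finSumFinEquiv i))))
    (MultilinearMap.domCoprod_alternization_eq α β)
  simp only [AlternatingMap.smul_apply, map_nsmul, Fintype.card_fin] at h
  have h2 : LinearMap.mul' ℝ ℂ ((α.domCoprod β) fun i => v (finSumFinEquiv i)) = wedge α β v := rfl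
  rw [h2, nsmul_eq_mul, MultilinearMap.alternatization_apply, map_sum] at h
  push_cast at h
  rw [← h, altSum, ← (Equiv.permCongr finSumFinEquiv).sum_comp]
  refine Finset.sum_congr rfl fun σ _ => ?_
  rw [Equiv.Perm.sign_permCongr, Units.smul_def, map_zsmul, zsmul_eq_mul]
  simp [MultilinearMap.domCoprod_apply, Equiv.permCongr_apply]

end AlternatingSum


/-! ### Explicit exterior products in low degree -/

section WedgeFormulas

variable {W : Type*} [AddCommGroup W] [Module ℝ W]

/-- Two Laplace expansions use up the arguments of `α`; the remaining sum only permutes those of the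
alternating form `β`, hence the factor `n!`. -/
theorem altSum_two_mul {n : ℕ} (α : CForm W 2) (β : CForm W n) (v : Fin (n + 1 + 1) → W) :
    altSum (fun w => α ![w 0, w 1] * β fun j => w j.succ.succ) v =
      n.factorial * ∑ a : Fin (n + 1 + 1), ∑ b : Fin (n + 1), (-1) ^ (a : ℕ) * (-1) ^ (b : ℕ) *
        (α ![v a, v (a.succAbove b)] * β fun j => v (a.succAbove (b.succAbove j))) := by
  rw [altSum_succ, Finset.mul_sum]
  refine Finset.sum_congr rfl fun a _ => ?_
  rw [altSum_succ, Finset.mul_sum, Finset.mul_sum]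
  refine Finset.sum_congr rfl fun b _ => ?_
  have h : ∀ w : Fin n → W, (Matrix.vecCons (v a) (Matrix.vecCons (v (a.succAbove b)) w) : Fin (n + 1 + 1) → W) 1
      = v (a.succAbove b) := fun w => rfl
  simp only [Matrix.cons_val_zero, Matrix.cons_val_succ, h]
  rw [altSum_mul_left, altSum_alternating]
  ring

theorem altSum_one_mul {n : ℕ} (α : CForm W 1) (β : CForm W n) (v : Fin (n + 1) → W) :
    altSum (fun w => α ![w 0] * β fun j => w j.succ) v =
      n.factorial * ∑ a : Fin (n + 1), (-1) ^ (a : ℕ) *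
        (α ![v a] * β fun j => v (a.succAbove j)) := by
  rw [altSum_succ, Finset.mul_sum]
  refine Finset.sum_congr rfl fun a _ => ?_
  simp only [Matrix.cons_val_zero, Matrix.cons_val_succ]
  rw [altSum_mul_left, altSum_alternating]
  ring

theorem CForm.swap (α : CForm W 2) (u v : W) : α ![v, u] = -α ![u, v] := by
  have := α.map_swap ![u, v] (i := 0) (j := 1) (by simp)
  rw [← this]
  congr 1
  ext i
  fin_cases i <;> rfl

theorem CForm.apply_vec4 (β : CForm W 4) (w : Fin 4 → W) : β w = β ![w 0, w 1, w 2, w 3] := by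
  congr 1; ext i; fin_cases i <;> rfl

theorem CForm.apply_vec2 (β : CForm W 2) (w : Fin 2 → W) : β w = β ![w 0, w 1] := by
  congr 1; ext i; fin_cases i <;> rfl

theorem CForm.apply_vec6 (β : CForm W 6) (w : Fin 6 → W) :
    β w = β ![w 0, w 1, w 2, w 3, w 4, w 5] := by
  congr 1; ext i; fin_cases i <;> rfl

theorem wedge_two_two (α : CForm W 2) (β : CForm W 2) (v : Fin 4 → W) :
    (wedge α β : CForm W 4) v =
      α ![v 0, v 1] * β ![v 2, v 3]
      - α ![v 0, v 2] * β ![v 1, v 3]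
      + α ![v 0, v 3] * β ![v 1, v 2]
      + α ![v 1, v 2] * β ![v 0, v 3]
      - α ![v 1, v 3] * β ![v 0, v 2]
      + α ![v 2, v 3] * β ![v 0, v 1] := by
  have h0 := wedge_eq_altSum α β v
  have h1 := altSum_two_mul α β v
  have h2 : altSum (fun w => α (fun i => w (Fin.castAdd 2 i)) * β fun i => w (Fin.natAdd 2 i)) v
      = altSum (fun w => α ![w 0, w 1] * β fun j => w j.succ.succ) v := by
    congr 1
    funext w
    rw [α.apply_vec2]
    congr 2
    funext i
    fin_cases i <;> rfl
  have h3 : ((2).factorial * (2).factorial : ℂ) * (wedge α β : CForm W 4) v = ((2).factorial : ℂ) *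
      ∑ a : Fin 4, ∑ b : Fin 3, (-1 : ℂ) ^ (a : ℕ) * (-1) ^ (b : ℕ) *
        (α ![v a, v (a.succAbove b)] *
          β ![v (a.succAbove (b.succAbove 0)), v (a.succAbove (b.succAbove 1))]) := by
    refine (h0.trans (h2.trans h1)).trans ?_
    congr 1
    refine Finset.sum_congr rfl fun a _ => Finset.sum_congr rfl fun b _ => ?_
    rw [β.apply_vec2 fun j => v (a.succAbove (b.succAbove j))]
  rw [Fin.sum_univ_four] at h3
  simp only [Fin.sum_univ_three] at h3
  -- The same double sum with the `succAbove` indices evaluated, which holds by computation. An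
  -- ordered pair and its reverse give equal terms, so the right side is `2! · 2` times the claimed
  -- sum, whence the final factor 1/4. The next two lemmas obtain 1/48 and 1/1440 in the same way.
  have h4 : ((2).factorial * (2).factorial : ℂ) * (wedge α β : CForm W 4) v = ((2).factorial : ℂ) * (
    ((-1) ^ 0 * (-1) ^ 0 * (α ![v 0, v 1] * β ![v 2, v 3])
      + (-1) ^ 0 * (-1) ^ 1 * (α ![v 0, v 2] * β ![v 1, v 3])
      + (-1) ^ 0 * (-1) ^ 2 * (α ![v 0, v 3] * β ![v 1, v 2]))
    + ((-1) ^ 1 * (-1) ^ 0 * (α ![v 1, v 0] * β ![v 2, v 3])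
      + (-1) ^ 1 * (-1) ^ 1 * (α ![v 1, v 2] * β ![v 0, v 3])
      + (-1) ^ 1 * (-1) ^ 2 * (α ![v 1, v 3] * β ![v 0, v 2]))
    + ((-1) ^ 2 * (-1) ^ 0 * (α ![v 2, v 0] * β ![v 1, v 3])
      + (-1) ^ 2 * (-1) ^ 1 * (α ![v 2, v 1] * β ![v 0, v 3])
      + (-1) ^ 2 * (-1) ^ 2 * (α ![v 2, v 3] * β ![v 0, v 1]))
    + ((-1) ^ 3 * (-1) ^ 0 * (α ![v 3, v 0] * β ![v 1, v 2])
      + (-1) ^ 3 * (-1) ^ 1 * (α ![v 3, v 1] * β ![v 0, v 2])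
      + (-1) ^ 3 * (-1) ^ 2 * (α ![v 3, v 2] * β ![v 0, v 1]))) := h3
  rw [α.swap (v 0) (v 1), α.swap (v 0) (v 2), α.swap (v 0) (v 3), α.swap (v 1) (v 2), α.swap (v 1) (v 3), α.swap (v 2) (v 3)] at h4
  norm_num [Nat.factorial] at h4
  linear_combination (1 / 4) * h4

theorem wedge_two_four (α : CForm W 2) (β : CForm W 4) (v : Fin 6 → W) :
    (wedge α β : CForm W 6) v =
      α ![v 0, v 1] * β ![v 2, v 3, v 4, v 5]
      - α ![v 0, v 2] * β ![v 1, v 3, v 4, v 5]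
      + α ![v 0, v 3] * β ![v 1, v 2, v 4, v 5]
      - α ![v 0, v 4] * β ![v 1, v 2, v 3, v 5]
      + α ![v 0, v 5] * β ![v 1, v 2, v 3, v 4]
      + α ![v 1, v 2] * β ![v 0, v 3, v 4, v 5]
      - α ![v 1, v 3] * β ![v 0, v 2, v 4, v 5]
      + α ![v 1, v 4] * β ![v 0, v 2, v 3, v 5]
      - α ![v 1, v 5] * β ![v 0, v 2, v 3, v 4]
      + α ![v 2, v 3] * β ![v 0, v 1, v 4, v 5]
      - α ![v 2, v 4] * β ![v 0, v 1, v 3, v 5]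
      + α ![v 2, v 5] * β ![v 0, v 1, v 3, v 4]
      + α ![v 3, v 4] * β ![v 0, v 1, v 2, v 5]
      - α ![v 3, v 5] * β ![v 0, v 1, v 2, v 4]
      + α ![v 4, v 5] * β ![v 0, v 1, v 2, v 3] := by
  have h0 := wedge_eq_altSum α β v
  have h1 := altSum_two_mul α β v
  have h2 : altSum (fun w => α (fun i => w (Fin.castAdd 4 i)) * β fun i => w (Fin.natAdd 2 i)) v
      = altSum (fun w => α ![w 0, w 1] * β fun j => w j.succ.succ) v := by
    congr 1
    funext w
    rw [α.apply_vec2]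
    congr 2
    funext i
    fin_cases i <;> rfl
  have h3 : ((2).factorial * (4).factorial : ℂ) * (wedge α β : CForm W 6) v = ((4).factorial : ℂ) *
      ∑ a : Fin 6, ∑ b : Fin 5, (-1 : ℂ) ^ (a : ℕ) * (-1) ^ (b : ℕ) *
        (α ![v a, v (a.succAbove b)] *
          β ![v (a.succAbove (b.succAbove 0)), v (a.succAbove (b.succAbove 1)), v (a.succAbove (b.succAbove 2)), v (a.succAbove (b.succAbove 3))]) := by
    refine (h0.trans (h2.trans h1)).trans ?_
    congr 1
    refine Finset.sum_congr rfl fun a _ => Finset.sum_congr rfl fun b _ => ?_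
    rw [β.apply_vec4 fun j => v (a.succAbove (b.succAbove j))]
  rw [Fin.sum_univ_six] at h3
  simp only [Fin.sum_univ_five] at h3
  have h4 : ((2).factorial * (4).factorial : ℂ) * (wedge α β : CForm W 6) v = ((4).factorial : ℂ) * (
    ((-1) ^ 0 * (-1) ^ 0 * (α ![v 0, v 1] * β ![v 2, v 3, v 4, v 5])
      + (-1) ^ 0 * (-1) ^ 1 * (α ![v 0, v 2] * β ![v 1, v 3, v 4, v 5])
      + (-1) ^ 0 * (-1) ^ 2 * (α ![v 0, v 3] * β ![v 1, v 2, v 4, v 5])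
      + (-1) ^ 0 * (-1) ^ 3 * (α ![v 0, v 4] * β ![v 1, v 2, v 3, v 5])
      + (-1) ^ 0 * (-1) ^ 4 * (α ![v 0, v 5] * β ![v 1, v 2, v 3, v 4]))
    + ((-1) ^ 1 * (-1) ^ 0 * (α ![v 1, v 0] * β ![v 2, v 3, v 4, v 5])
      + (-1) ^ 1 * (-1) ^ 1 * (α ![v 1, v 2] * β ![v 0, v 3, v 4, v 5])
      + (-1) ^ 1 * (-1) ^ 2 * (α ![v 1, v 3] * β ![v 0, v 2, v 4, v 5])
      + (-1) ^ 1 * (-1) ^ 3 * (α ![v 1, v 4] * β ![v 0, v 2, v 3, v 5])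
      + (-1) ^ 1 * (-1) ^ 4 * (α ![v 1, v 5] * β ![v 0, v 2, v 3, v 4]))
    + ((-1) ^ 2 * (-1) ^ 0 * (α ![v 2, v 0] * β ![v 1, v 3, v 4, v 5])
      + (-1) ^ 2 * (-1) ^ 1 * (α ![v 2, v 1] * β ![v 0, v 3, v 4, v 5])
      + (-1) ^ 2 * (-1) ^ 2 * (α ![v 2, v 3] * β ![v 0, v 1, v 4, v 5])
      + (-1) ^ 2 * (-1) ^ 3 * (α ![v 2, v 4] * β ![v 0, v 1, v 3, v 5])
      + (-1) ^ 2 * (-1) ^ 4 * (α ![v 2, v 5] * β ![v 0, v 1, v 3, v 4]))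
    + ((-1) ^ 3 * (-1) ^ 0 * (α ![v 3, v 0] * β ![v 1, v 2, v 4, v 5])
      + (-1) ^ 3 * (-1) ^ 1 * (α ![v 3, v 1] * β ![v 0, v 2, v 4, v 5])
      + (-1) ^ 3 * (-1) ^ 2 * (α ![v 3, v 2] * β ![v 0, v 1, v 4, v 5])
      + (-1) ^ 3 * (-1) ^ 3 * (α ![v 3, v 4] * β ![v 0, v 1, v 2, v 5])
      + (-1) ^ 3 * (-1) ^ 4 * (α ![v 3, v 5] * β ![v 0, v 1, v 2, v 4]))
    + ((-1) ^ 4 * (-1) ^ 0 * (α ![v 4, v 0] * β ![v 1, v 2, v 3, v 5])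
      + (-1) ^ 4 * (-1) ^ 1 * (α ![v 4, v 1] * β ![v 0, v 2, v 3, v 5])
      + (-1) ^ 4 * (-1) ^ 2 * (α ![v 4, v 2] * β ![v 0, v 1, v 3, v 5])
      + (-1) ^ 4 * (-1) ^ 3 * (α ![v 4, v 3] * β ![v 0, v 1, v 2, v 5])
      + (-1) ^ 4 * (-1) ^ 4 * (α ![v 4, v 5] * β ![v 0, v 1, v 2, v 3]))
    + ((-1) ^ 5 * (-1) ^ 0 * (α ![v 5, v 0] * β ![v 1, v 2, v 3, v 4])
      + (-1) ^ 5 * (-1) ^ 1 * (α ![v 5, v 1] * β ![v 0, v 2, v 3, v 4])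
      + (-1) ^ 5 * (-1) ^ 2 * (α ![v 5, v 2] * β ![v 0, v 1, v 3, v 4])
      + (-1) ^ 5 * (-1) ^ 3 * (α ![v 5, v 3] * β ![v 0, v 1, v 2, v 4])
      + (-1) ^ 5 * (-1) ^ 4 * (α ![v 5, v 4] * β ![v 0, v 1, v 2, v 3]))) := h3
  rw [α.swap (v 0) (v 1), α.swap (v 0) (v 2), α.swap (v 0) (v 3), α.swap (v 0) (v 4), α.swap (v 0) (v 5), α.swap (v 1) (v 2), α.swap (v 1) (v 3), α.swap (v 1) (v 4), α.swap (v 1) (v 5), α.swap (v 2) (v 3), α.swap (v 2) (v 4), α.swap (v 2) (v 5), α.swap (v 3) (v 4), α.swap (v 3) (v 5), α.swap (v 4) (v 5)] at h4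
  norm_num [Nat.factorial] at h4
  linear_combination (1 / 48) * h4

theorem wedge_two_six (α : CForm W 2) (β : CForm W 6) (v : Fin 8 → W) :
    (wedge α β : CForm W 8) v =
      α ![v 0, v 1] * β ![v 2, v 3, v 4, v 5, v 6, v 7]
      - α ![v 0, v 2] * β ![v 1, v 3, v 4, v 5, v 6, v 7]
      + α ![v 0, v 3] * β ![v 1, v 2, v 4, v 5, v 6, v 7]
      - α ![v 0, v 4] * β ![v 1, v 2, v 3, v 5, v 6, v 7]
      + α ![v 0, v 5] * β ![v 1, v 2, v 3, v 4, v 6, v 7]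
      - α ![v 0, v 6] * β ![v 1, v 2, v 3, v 4, v 5, v 7]
      + α ![v 0, v 7] * β ![v 1, v 2, v 3, v 4, v 5, v 6]
      + α ![v 1, v 2] * β ![v 0, v 3, v 4, v 5, v 6, v 7]
      - α ![v 1, v 3] * β ![v 0, v 2, v 4, v 5, v 6, v 7]
      + α ![v 1, v 4] * β ![v 0, v 2, v 3, v 5, v 6, v 7]
      - α ![v 1, v 5] * β ![v 0, v 2, v 3, v 4, v 6, v 7]
      + α ![v 1, v 6] * β ![v 0, v 2, v 3, v 4, v 5, v 7]
      - α ![v 1, v 7] * β ![v 0, v 2, v 3, v 4, v 5, v 6]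
      + α ![v 2, v 3] * β ![v 0, v 1, v 4, v 5, v 6, v 7]
      - α ![v 2, v 4] * β ![v 0, v 1, v 3, v 5, v 6, v 7]
      + α ![v 2, v 5] * β ![v 0, v 1, v 3, v 4, v 6, v 7]
      - α ![v 2, v 6] * β ![v 0, v 1, v 3, v 4, v 5, v 7]
      + α ![v 2, v 7] * β ![v 0, v 1, v 3, v 4, v 5, v 6]
      + α ![v 3, v 4] * β ![v 0, v 1, v 2, v 5, v 6, v 7]
      - α ![v 3, v 5] * β ![v 0, v 1, v 2, v 4, v 6, v 7]
      + α ![v 3, v 6] * β ![v 0, v 1, v 2, v 4, v 5, v 7]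
      - α ![v 3, v 7] * β ![v 0, v 1, v 2, v 4, v 5, v 6]
      + α ![v 4, v 5] * β ![v 0, v 1, v 2, v 3, v 6, v 7]
      - α ![v 4, v 6] * β ![v 0, v 1, v 2, v 3, v 5, v 7]
      + α ![v 4, v 7] * β ![v 0, v 1, v 2, v 3, v 5, v 6]
      + α ![v 5, v 6] * β ![v 0, v 1, v 2, v 3, v 4, v 7]
      - α ![v 5, v 7] * β ![v 0, v 1, v 2, v 3, v 4, v 6]
      + α ![v 6, v 7] * β ![v 0, v 1, v 2, v 3, v 4, v 5] := by
  have h0 := wedge_eq_altSum α β v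
  have h1 := altSum_two_mul α β v
  have h2 : altSum (fun w => α (fun i => w (Fin.castAdd 6 i)) * β fun i => w (Fin.natAdd 2 i)) v
      = altSum (fun w => α ![w 0, w 1] * β fun j => w j.succ.succ) v := by
    congr 1
    funext w
    rw [α.apply_vec2]
    congr 2
    funext i
    fin_cases i <;> rfl
  have h3 : ((2).factorial * (6).factorial : ℂ) * (wedge α β : CForm W 8) v = ((6).factorial : ℂ) *
      ∑ a : Fin 8, ∑ b : Fin 7, (-1 : ℂ) ^ (a : ℕ) * (-1) ^ (b : ℕ) *
        (α ![v a, v (a.succAbove b)] *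
          β ![v (a.succAbove (b.succAbove 0)), v (a.succAbove (b.succAbove 1)), v (a.succAbove (b.succAbove 2)), v (a.succAbove (b.succAbove 3)), v (a.succAbove (b.succAbove 4)), v (a.succAbove (b.succAbove 5))]) := by
    refine (h0.trans (h2.trans h1)).trans ?_
    congr 1
    refine Finset.sum_congr rfl fun a _ => Finset.sum_congr rfl fun b _ => ?_
    rw [β.apply_vec6 fun j => v (a.succAbove (b.succAbove j))]
  rw [Fin.sum_univ_eight] at h3
  simp only [Fin.sum_univ_seven] at h3
  have h4 : ((2).factorial * (6).factorial : ℂ) * (wedge α β : CForm W 8) v = ((6).factorial : ℂ) * (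
    ((-1) ^ 0 * (-1) ^ 0 * (α ![v 0, v 1] * β ![v 2, v 3, v 4, v 5, v 6, v 7])
      + (-1) ^ 0 * (-1) ^ 1 * (α ![v 0, v 2] * β ![v 1, v 3, v 4, v 5, v 6, v 7])
      + (-1) ^ 0 * (-1) ^ 2 * (α ![v 0, v 3] * β ![v 1, v 2, v 4, v 5, v 6, v 7])
      + (-1) ^ 0 * (-1) ^ 3 * (α ![v 0, v 4] * β ![v 1, v 2, v 3, v 5, v 6, v 7])
      + (-1) ^ 0 * (-1) ^ 4 * (α ![v 0, v 5] * β ![v 1, v 2, v 3, v 4, v 6, v 7])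
      + (-1) ^ 0 * (-1) ^ 5 * (α ![v 0, v 6] * β ![v 1, v 2, v 3, v 4, v 5, v 7])
      + (-1) ^ 0 * (-1) ^ 6 * (α ![v 0, v 7] * β ![v 1, v 2, v 3, v 4, v 5, v 6]))
    + ((-1) ^ 1 * (-1) ^ 0 * (α ![v 1, v 0] * β ![v 2, v 3, v 4, v 5, v 6, v 7])
      + (-1) ^ 1 * (-1) ^ 1 * (α ![v 1, v 2] * β ![v 0, v 3, v 4, v 5, v 6, v 7])
      + (-1) ^ 1 * (-1) ^ 2 * (α ![v 1, v 3] * β ![v 0, v 2, v 4, v 5, v 6, v 7])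
      + (-1) ^ 1 * (-1) ^ 3 * (α ![v 1, v 4] * β ![v 0, v 2, v 3, v 5, v 6, v 7])
      + (-1) ^ 1 * (-1) ^ 4 * (α ![v 1, v 5] * β ![v 0, v 2, v 3, v 4, v 6, v 7])
      + (-1) ^ 1 * (-1) ^ 5 * (α ![v 1, v 6] * β ![v 0, v 2, v 3, v 4, v 5, v 7])
      + (-1) ^ 1 * (-1) ^ 6 * (α ![v 1, v 7] * β ![v 0, v 2, v 3, v 4, v 5, v 6]))
    + ((-1) ^ 2 * (-1) ^ 0 * (α ![v 2, v 0] * β ![v 1, v 3, v 4, v 5, v 6, v 7])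
      + (-1) ^ 2 * (-1) ^ 1 * (α ![v 2, v 1] * β ![v 0, v 3, v 4, v 5, v 6, v 7])
      + (-1) ^ 2 * (-1) ^ 2 * (α ![v 2, v 3] * β ![v 0, v 1, v 4, v 5, v 6, v 7])
      + (-1) ^ 2 * (-1) ^ 3 * (α ![v 2, v 4] * β ![v 0, v 1, v 3, v 5, v 6, v 7])
      + (-1) ^ 2 * (-1) ^ 4 * (α ![v 2, v 5] * β ![v 0, v 1, v 3, v 4, v 6, v 7])
      + (-1) ^ 2 * (-1) ^ 5 * (α ![v 2, v 6] * β ![v 0, v 1, v 3, v 4, v 5, v 7])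
      + (-1) ^ 2 * (-1) ^ 6 * (α ![v 2, v 7] * β ![v 0, v 1, v 3, v 4, v 5, v 6]))
    + ((-1) ^ 3 * (-1) ^ 0 * (α ![v 3, v 0] * β ![v 1, v 2, v 4, v 5, v 6, v 7])
      + (-1) ^ 3 * (-1) ^ 1 * (α ![v 3, v 1] * β ![v 0, v 2, v 4, v 5, v 6, v 7])
      + (-1) ^ 3 * (-1) ^ 2 * (α ![v 3, v 2] * β ![v 0, v 1, v 4, v 5, v 6, v 7])
      + (-1) ^ 3 * (-1) ^ 3 * (α ![v 3, v 4] * β ![v 0, v 1, v 2, v 5, v 6, v 7])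
      + (-1) ^ 3 * (-1) ^ 4 * (α ![v 3, v 5] * β ![v 0, v 1, v 2, v 4, v 6, v 7])
      + (-1) ^ 3 * (-1) ^ 5 * (α ![v 3, v 6] * β ![v 0, v 1, v 2, v 4, v 5, v 7])
      + (-1) ^ 3 * (-1) ^ 6 * (α ![v 3, v 7] * β ![v 0, v 1, v 2, v 4, v 5, v 6]))
    + ((-1) ^ 4 * (-1) ^ 0 * (α ![v 4, v 0] * β ![v 1, v 2, v 3, v 5, v 6, v 7])
      + (-1) ^ 4 * (-1) ^ 1 * (α ![v 4, v 1] * β ![v 0, v 2, v 3, v 5, v 6, v 7])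
      + (-1) ^ 4 * (-1) ^ 2 * (α ![v 4, v 2] * β ![v 0, v 1, v 3, v 5, v 6, v 7])
      + (-1) ^ 4 * (-1) ^ 3 * (α ![v 4, v 3] * β ![v 0, v 1, v 2, v 5, v 6, v 7])
      + (-1) ^ 4 * (-1) ^ 4 * (α ![v 4, v 5] * β ![v 0, v 1, v 2, v 3, v 6, v 7])
      + (-1) ^ 4 * (-1) ^ 5 * (α ![v 4, v 6] * β ![v 0, v 1, v 2, v 3, v 5, v 7])
      + (-1) ^ 4 * (-1) ^ 6 * (α ![v 4, v 7] * β ![v 0, v 1, v 2, v 3, v 5, v 6]))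
    + ((-1) ^ 5 * (-1) ^ 0 * (α ![v 5, v 0] * β ![v 1, v 2, v 3, v 4, v 6, v 7])
      + (-1) ^ 5 * (-1) ^ 1 * (α ![v 5, v 1] * β ![v 0, v 2, v 3, v 4, v 6, v 7])
      + (-1) ^ 5 * (-1) ^ 2 * (α ![v 5, v 2] * β ![v 0, v 1, v 3, v 4, v 6, v 7])
      + (-1) ^ 5 * (-1) ^ 3 * (α ![v 5, v 3] * β ![v 0, v 1, v 2, v 4, v 6, v 7])
      + (-1) ^ 5 * (-1) ^ 4 * (α ![v 5, v 4] * β ![v 0, v 1, v 2, v 3, v 6, v 7])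
      + (-1) ^ 5 * (-1) ^ 5 * (α ![v 5, v 6] * β ![v 0, v 1, v 2, v 3, v 4, v 7])
      + (-1) ^ 5 * (-1) ^ 6 * (α ![v 5, v 7] * β ![v 0, v 1, v 2, v 3, v 4, v 6]))
    + ((-1) ^ 6 * (-1) ^ 0 * (α ![v 6, v 0] * β ![v 1, v 2, v 3, v 4, v 5, v 7])
      + (-1) ^ 6 * (-1) ^ 1 * (α ![v 6, v 1] * β ![v 0, v 2, v 3, v 4, v 5, v 7])
      + (-1) ^ 6 * (-1) ^ 2 * (α ![v 6, v 2] * β ![v 0, v 1, v 3, v 4, v 5, v 7])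
      + (-1) ^ 6 * (-1) ^ 3 * (α ![v 6, v 3] * β ![v 0, v 1, v 2, v 4, v 5, v 7])
      + (-1) ^ 6 * (-1) ^ 4 * (α ![v 6, v 4] * β ![v 0, v 1, v 2, v 3, v 5, v 7])
      + (-1) ^ 6 * (-1) ^ 5 * (α ![v 6, v 5] * β ![v 0, v 1, v 2, v 3, v 4, v 7])
      + (-1) ^ 6 * (-1) ^ 6 * (α ![v 6, v 7] * β ![v 0, v 1, v 2, v 3, v 4, v 5]))
    + ((-1) ^ 7 * (-1) ^ 0 * (α ![v 7, v 0] * β ![v 1, v 2, v 3, v 4, v 5, v 6])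
      + (-1) ^ 7 * (-1) ^ 1 * (α ![v 7, v 1] * β ![v 0, v 2, v 3, v 4, v 5, v 6])
      + (-1) ^ 7 * (-1) ^ 2 * (α ![v 7, v 2] * β ![v 0, v 1, v 3, v 4, v 5, v 6])
      + (-1) ^ 7 * (-1) ^ 3 * (α ![v 7, v 3] * β ![v 0, v 1, v 2, v 4, v 5, v 6])
      + (-1) ^ 7 * (-1) ^ 4 * (α ![v 7, v 4] * β ![v 0, v 1, v 2, v 3, v 5, v 6])
      + (-1) ^ 7 * (-1) ^ 5 * (α ![v 7, v 5] * β ![v 0, v 1, v 2, v 3, v 4, v 6])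
      + (-1) ^ 7 * (-1) ^ 6 * (α ![v 7, v 6] * β ![v 0, v 1, v 2, v 3, v 4, v 5]))) := h3
  rw [α.swap (v 0) (v 1), α.swap (v 0) (v 2), α.swap (v 0) (v 3), α.swap (v 0) (v 4), α.swap (v 0) (v 5), α.swap (v 0) (v 6), α.swap (v 0) (v 7), α.swap (v 1) (v 2), α.swap (v 1) (v 3), α.swap (v 1) (v 4), α.swap (v 1) (v 5), α.swap (v 1) (v 6), α.swap (v 1) (v 7), α.swap (v 2) (v 3), α.swap (v 2) (v 4), α.swap (v 2) (v 5), α.swap (v 2) (v 6), α.swap (v 2) (v 7), α.swap (v 3) (v 4), α.swap (v 3) (v 5), α.swap (v 3) (v 6), α.swap (v 3) (v 7), α.swap (v 4) (v 5), α.swap (v 4) (v 6), α.swap (v 4) (v 7), α.swap (v 5) (v 6), α.swap (v 5) (v 7), α.swap (v 6) (v 7)] at h4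
  norm_num [Nat.factorial] at h4
  linear_combination (1 / 1440) * h4

/-- Moving the two arguments of `α` to the front is a rotation by two places, the square of a
permutation and therefore even. -/
theorem wedge_four_two (β : CForm W 4) (α : CForm W 2) (v : Fin 6 → W) :
    (wedge β α : CForm W 6) v = (wedge α β : CForm W 6) v := by
  have h0 := wedge_eq_altSum α β v
  have h1 := wedge_eq_altSum β α v
  have h2 := altSum_comp_perm (fun w : Fin 6 → W => β (fun i => w (Fin.castAdd 2 i)) *
    α fun i => w (Fin.natAdd 4 i)) (finRotate 6 * finRotate 6) v
  have h3 : (fun w : Fin 6 → W => α (fun i => w (Fin.castAdd 4 i)) * β fun i => w (Fin.natAdd 2 i)) =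
      fun w => (fun w : Fin 6 → W => β (fun i => w (Fin.castAdd 2 i)) *
        α fun i => w (Fin.natAdd 4 i)) (w ∘ (finRotate 6 * finRotate 6 : Equiv.Perm (Fin 6))) := by
    funext w
    rw [mul_comm]
    congr 2
    · funext i; fin_cases i <;> rfl
    · funext i; fin_cases i <;> rfl
  rw [← h3] at h2
  rw [Equiv.Perm.sign_mul, Int.units_mul_self, Units.val_one, Int.cast_one, one_mul] at h2
  have h4 := h0.trans (h2.trans h1.symm)
  norm_num [Nat.factorial] at h4
  exact h4.symm

theorem wedge_six_two (β : CForm W 6) (α : CForm W 2) (v : Fin 8 → W) :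
    (wedge β α : CForm W 8) v = (wedge α β : CForm W 8) v := by
  have h0 := wedge_eq_altSum α β v
  have h1 := wedge_eq_altSum β α v
  have h2 := altSum_comp_perm (fun w : Fin 8 → W => β (fun i => w (Fin.castAdd 2 i)) *
    α fun i => w (Fin.natAdd 6 i)) (finRotate 8 * finRotate 8) v
  have h3 : (fun w : Fin 8 → W => α (fun i => w (Fin.castAdd 6 i)) * β fun i => w (Fin.natAdd 2 i)) =
      fun w => (fun w : Fin 8 → W => β (fun i => w (Fin.castAdd 2 i)) *
        α fun i => w (Fin.natAdd 6 i)) (w ∘ (finRotate 8 * finRotate 8 : Equiv.Perm (Fin 8))) := by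
    funext w
    rw [mul_comm]
    congr 2
    · funext i; fin_cases i <;> rfl
    · funext i; fin_cases i <;> rfl
  rw [← h3] at h2
  rw [Equiv.Perm.sign_mul, Int.units_mul_self, Units.val_one, Int.cast_one, one_mul] at h2
  have h4 := h0.trans (h2.trans h1.symm)
  norm_num [Nat.factorial] at h4
  exact h4.symm

theorem wedge_one_three (α : CForm W 1) (β : CForm W 3) (v : Fin 4 → W) :
    (wedge α β : CForm W 4) v =
      α ![v 0] * β ![v 1, v 2, v 3] - α ![v 1] * β ![v 0, v 2, v 3]
        + α ![v 2] * β ![v 0, v 1, v 3] - α ![v 3] * β ![v 0, v 1, v 2] := by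
  have h0 := wedge_eq_altSum α β v
  have h1 := altSum_one_mul α β v
  have h2 : altSum (fun w => α (fun i => w (Fin.castAdd 3 i)) * β fun i => w (Fin.natAdd 1 i)) v
      = altSum (fun w => α ![w 0] * β fun j => w j.succ) v := by
    congr 1
    funext w
    congr 2
    · funext i; fin_cases i; rfl
    · funext i; fin_cases i <;> rfl
  have h3 : ((1).factorial * (3).factorial : ℂ) * (wedge α β : CForm W 4) v = ((3).factorial : ℂ) *
      ∑ a : Fin 4, (-1 : ℂ) ^ (a : ℕ) *
        (α ![v a] * β ![v (a.succAbove 0), v (a.succAbove 1), v (a.succAbove 2)]) := by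
    refine (h0.trans (h2.trans h1)).trans ?_
    congr 1
    refine Finset.sum_congr rfl fun a _ => ?_
    congr 3
    funext i; fin_cases i <;> rfl
  rw [Fin.sum_univ_four] at h3
  have h4 : ((1).factorial * (3).factorial : ℂ) * (wedge α β : CForm W 4) v = ((3).factorial : ℂ) *
      ((-1) ^ 0 * (α ![v 0] * β ![v 1, v 2, v 3]) + (-1) ^ 1 * (α ![v 1] * β ![v 0, v 2, v 3])
        + (-1) ^ 2 * (α ![v 2] * β ![v 0, v 1, v 3])
        + (-1) ^ 3 * (α ![v 3] * β ![v 0, v 1, v 2])) := h3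
  norm_num [Nat.factorial] at h4
  linear_combination h4

end WedgeFormulas

/-! ### Powers of a 2-form and Pfaffians -/

section Pfaffian

variable {ι R : Type*} [CommRing R]

/-- The Pfaffian of the 4 by 4 block of `f` with rows `i, j, k, l`. -/
def pf4 (f : ι → ι → R) (i j k l : ι) : R := f i j * f k l - f i k * f j l + f i l * f j k

/-- The Pfaffian of the 6 by 6 block of `f` with rows `i, j, k, l, m, n`. -/
def pf6 (f : ι → ι → R) (i j k l m n : ι) : R :=
  f i j * pf4 f k l m n - f i k * pf4 f j l m n + f i l * pf4 f j k m n - f i m * pf4 f j k l n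
    + f i n * pf4 f j k l m

/-- The Pfaffian of the 8 by 8 block of `f` with rows `i, j, k, l, m, n, p, q`. -/
def pf8 (f : ι → ι → R) (i j k l m n p q : ι) : R :=
  f i j * pf6 f k l m n p q - f i k * pf6 f j l m n p q + f i l * pf6 f j k m n p q
    - f i m * pf6 f j k l n p q + f i n * pf6 f j k l m p q - f i p * pf6 f j k l m n q
    + f i q * pf6 f j k l m n p

variable {W : Type*} [AddCommGroup W] [Module ℝ W] (F : CForm W 2)

/-- A perfect matching contributes once for each ordering of its pairs: the factor is 2! here, and
3! and 4! for the next two powers. -/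
theorem wedgeSq_apply (a b c d : W) :
    wedgeSq F ![a, b, c, d] = 2 * pf4 (fun u v => F ![u, v]) a b c d := by
  rw [wedgeSq, wedge_two_two]
  simp only [pf4, Matrix.cons_val]
  ring

theorem wedgeCube_apply (a b c d x y : W) :
    wedgeCube F ![a, b, c, d, x, y] = 6 * pf6 (fun u v => F ![u, v]) a b c d x y := by
  rw [wedgeCube, wedge_four_two, wedge_two_four]
  simp only [Matrix.cons_val, wedgeSq_apply, pf6, pf4]
  ring

theorem wedgeFourth_apply (a b c d x y z w : W) :
    wedgeFourth F ![a, b, c, d, x, y, z, w] =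
      24 * pf8 (fun u v => F ![u, v]) a b c d x y z w := by
  rw [wedgeFourth, wedge_six_two, wedge_two_six]
  simp only [Matrix.cons_val, wedgeCube_apply, pf8, pf6, pf4]
  ring

end Pfaffian

/-! ### Forms with integer coefficients in a basis -/

section SparseForms

variable {W : Type*} [AddCommGroup W] [Module ℝ W] (e : Module.Basis (Fin 8) ℝ W)

theorem altMap_sum_apply {ι κ N : Type*} [AddCommMonoid N] [Module ℝ N] (s : Finset ι)
    (f : ι → W [⋀^κ]→ₗ[ℝ] N) (v : κ → W) : (∑ i ∈ s, f i) v = ∑ i ∈ s, f i v := by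
  classical
  induction s using Finset.induction_on with
  | empty => simp
  | insert i s hi ih => rw [Finset.sum_insert hi, Finset.sum_insert hi, AlternatingMap.add_apply, ih]

theorem coordWedge_apply {k : ℕ} (I : Fin k → Fin 8) (v : Fin k → W) :
    coordWedge e I v =
      ∑ σ : Equiv.Perm (Fin k), ((Equiv.Perm.sign σ : ℤ) : ℝ) * ∏ m, e.coord (I m) (v (σ m)) := by
  rw [coordWedge, MultilinearMap.alternatization_apply]
  refine Finset.sum_congr rfl fun σ _ => ?_
  rw [Units.smul_def, zsmul_eq_mul]
  rfl

theorem coordWedge_apply_basis {k : ℕ} (I J : Fin k → Fin 8) :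
    coordWedge e I (fun m => e (J m)) =
      ∑ σ : Equiv.Perm (Fin k), ((Equiv.Perm.sign σ : ℤ) : ℝ) * if J ∘ σ = I then 1 else 0 := by
  rw [coordWedge_apply]
  refine Finset.sum_congr rfl fun σ _ => ?_
  congr 1
  simp only [Module.Basis.coord_apply, Module.Basis.repr_self, Finsupp.single_apply]
  rw [Finset.prod_ite_zero]
  simp [funext_iff]

theorem strictMono_perm_eq_one {k : ℕ} {σ : Equiv.Perm (Fin k)} (h : StrictMono σ) : σ = 1 := by
  have h2 : (⇑σ) = ⇑(1 : Equiv.Perm (Fin k)) :=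
    (h.range_inj (strictMono_id (α := Fin k))).1 (by
      rw [σ.surjective.range_eq]; simp)
  exact DFunLike.coe_injective h2

/-- A permutation relating two increasing multi-indices is increasing, hence the identity. -/
theorem coordWedge_apply_strictMono {k : ℕ} {I J : Fin k → Fin 8} (hI : StrictMono I)
    (hJ : StrictMono J) :
    coordWedge e I (fun m => e (J m)) = if I = J then 1 else 0 := by
  rw [coordWedge_apply_basis, Finset.sum_eq_single 1]
  · simp [eq_comm]
  · intro σ _ hσ
    rw [if_neg, mul_zero]
    intro h
    refine hσ (strictMono_perm_eq_one fun a b hab => ?_)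
    have := hI hab
    rw [← h] at this
    exact hJ.lt_iff_lt.1 this
  · simp

theorem complexify_apply {k : ℕ} (α : W [⋀^Fin k]→ₗ[ℝ] ℝ) (v : Fin k → W) :
    complexify α v = (α v : ℂ) := rfl

/-- For each `σ` exactly one multi-index contributes, namely `I ∘ σ⁻¹`, and its sign cancels against
that of `β`. The `k!` equal terms cancel the normalization. -/
theorem formInner_coordWedge {k : ℕ} (I : Fin k → Fin 8) (β : CForm W k) :
    formInner e (complexify (coordWedge e I)) β = β fun m => e (I m) := by
  have hβ : ∀ σ : Equiv.Perm (Fin k),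
      ((Equiv.Perm.sign σ : ℤ) : ℂ) * (β fun m => e (I (σ⁻¹ m))) = β fun m => e (I m) := by
    intro σ
    have := β.map_perm (fun m => e (I m)) σ⁻¹
    rw [Function.comp_def] at this
    rw [this, Equiv.Perm.sign_inv]
    rcases Int.units_eq_one_or (Equiv.Perm.sign σ) with h | h <;> simp [h]
  have h : ∀ σ : Equiv.Perm (Fin k), (∑ i : Fin k → Fin 8,
      (((Equiv.Perm.sign σ : ℤ) : ℂ) * if i ∘ σ = I then 1 else 0) * β fun m => e (i m)) =
      β fun m => e (I m) := by
    intro σ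
    rw [Finset.sum_eq_single (I ∘ ⇑σ⁻¹)]
    · rw [if_pos (by funext m; simp), mul_one]
      exact hβ σ
    · intro i _ hi
      rw [if_neg, mul_zero, zero_mul]
      rintro rfl
      exact hi (by funext m; simp)
    · simp
  simp only [formInner, complexify_apply, coordWedge_apply_basis, Complex.conj_ofReal]
  push_cast
  simp only [Finset.sum_mul]
  rw [Finset.sum_comm]
  have h' : ∀ σ : Equiv.Perm (Fin k), (∑ i : Fin k → Fin 8,
      (((Equiv.Perm.sign σ : ℤ) : ℂ) * ((if i ∘ σ = I then 1 else 0 : ℝ) : ℂ)) * β fun m => e (i m)) =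
      β fun m => e (I m) := by
    intro σ
    rw [← h σ]
    refine Finset.sum_congr rfl fun i _ => ?_
    split_ifs <;> simp
  simp only [h', Finset.sum_const, Finset.card_univ, Fintype.card_perm, Fintype.card_fin,
    nsmul_eq_mul]
  rw [inv_mul_cancel_left₀]
  exact_mod_cast k.factorial_ne_zero

/-- The form `∑ c e^{i₁} ∧ ⋯ ∧ e^{i_k}` given by the list of its coefficients and indices. -/
noncomputable def sparseForm {k : ℕ} (l : List (ℤ × (Fin k → Fin 8))) : CForm W k :=
  (l.map fun t => (t.1 : ℂ) • complexify (coordWedge e t.2)).sum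

/-- The coefficient of `e^{J₁} ∧ ⋯ ∧ e^{J_k}` in a list of coefficients and indices. -/
def coeffAt {k : ℕ} (l : List (ℤ × (Fin k → Fin 8))) (J : Fin k → Fin 8) : ℤ :=
  (l.map fun t => if t.2 = J then t.1 else 0).sum

theorem formInner_add_left {k : ℕ} (α β γ : CForm W k) :
    formInner e (α + β) γ = formInner e α γ + formInner e β γ :=
  (formInnerCore e k).add_left α β γ

theorem formInner_smul_left {k : ℕ} (c : ℂ) (α γ : CForm W k) :
    formInner e (c • α) γ = (starRingEnd ℂ) c * formInner e α γ :=
  (formInnerCore e k).smul_left α γ c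

theorem formInner_conj {k : ℕ} (α β : CForm W k) :
    (starRingEnd ℂ) (formInner e β α) = formInner e α β :=
  (formInnerCore e k).conj_inner_symm α β

theorem formInner_zero_left {k : ℕ} (γ : CForm W k) : formInner e 0 γ = 0 := by
  simp [formInner]

theorem formInner_sparseForm {k : ℕ} (l : List (ℤ × (Fin k → Fin 8))) (β : CForm W k) :
    formInner e (sparseForm e l) β = (l.map fun t => (t.1 : ℂ) * β fun m => e (t.2 m)).sum := by
  induction l with
  | nil => simp [sparseForm, formInner_zero_left]
  | cons t l ih =>
    simp only [sparseForm, List.map_cons, List.sum_cons] at ih ⊢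
    rw [formInner_add_left, ih, formInner_smul_left, formInner_coordWedge]
    simp

theorem sparseForm_apply {k : ℕ} {l : List (ℤ × (Fin k → Fin 8))}
    (hl : ∀ t ∈ l, StrictMono t.2) {J : Fin k → Fin 8} (hJ : StrictMono J) :
    sparseForm e l (fun m => e (J m)) = (coeffAt l J : ℂ) := by
  induction l with
  | nil => simp [sparseForm, coeffAt]
  | cons t l ih =>
    have ih := ih fun t ht => hl t (List.mem_cons_of_mem _ ht)
    simp only [sparseForm, coeffAt, List.map_cons, List.sum_cons, AlternatingMap.add_apply,
      AlternatingMap.smul_apply, complexify_apply] at ih ⊢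
    rw [ih, coordWedge_apply_strictMono e (hl t (by simp)) hJ]
    split_ifs <;> simp

theorem exists_perm_strictMono {k : ℕ} {i : Fin k → Fin 8} (hi : Function.Injective i) :
    ∃ σ : Equiv.Perm (Fin k), StrictMono (i ∘ σ) :=
  ⟨Tuple.sort i, (Tuple.monotone_sort i).strictMono_of_injective (hi.comp (Equiv.injective _))⟩

theorem CForm.ext_strictMono {k : ℕ} {α β : CForm W k}
    (h : ∀ J : Fin k → Fin 8, StrictMono J → α (fun m => e (J m)) = β fun m => e (J m)) :
    α = β := by
  refine Module.Basis.ext_alternating e fun i hi => ?_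
  obtain ⟨σ, hσ⟩ := exists_perm_strictMono hi
  have h1 := h _ hσ
  have h2 := α.map_perm (fun m => e (i m)) σ
  have h3 := β.map_perm (fun m => e (i m)) σ
  simp only [Function.comp_def] at h1 h2 h3
  rw [h2, h3] at h1
  simpa using h1

end SparseForms

/-! ### The Hodge star on basis vectors -/

section Hodge

variable {W : Type*} [AddCommGroup W] [Module ℝ W] (e : Module.Basis (Fin 8) ℝ W)

/-- In the sum defining the star only the rearrangements of the first `k` values of `p` survive.
They all give the same term, so their number `k!` cancels. -/
theorem hodge_apply_perm {k l : ℕ} (h : k + l = 8) (α : CForm W k) (p : Equiv.Perm (Fin 8)) :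
    hodge e h α (fun m => e (p (Fin.cast h (Fin.natAdd k m)))) =
      ((Equiv.Perm.sign p : ℤ) : ℂ) * α fun m => e (p (Fin.cast h (Fin.castAdd l m))) := by
  have hdet : ∀ q : Equiv.Perm (Fin 8), e.det (fun m => e (q m)) = ((Equiv.Perm.sign q : ℤ) : ℝ) := by
    intro q
    have := e.det.map_perm e q
    rw [Function.comp_def] at this
    rw [this, e.det_self, Units.smul_def, zsmul_eq_mul, mul_one]
  set I : Fin k → Fin 8 := fun m => p (Fin.cast h (Fin.castAdd l m)) with hI
  set J : Fin l → Fin 8 := fun m => p (Fin.cast h (Fin.natAdd k m)) with hJ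
  have hIinj : Function.Injective I := fun a b hab => by
    simpa [Fin.ext_iff] using p.injective hab
  change ((k.factorial : ℂ)⁻¹ * ∑ i : Fin k → Fin 8, (α fun m => e (i m)) *
    (e.det fun m => Fin.append (fun m => e (i m)) (fun m => e (J m)) (Fin.cast h.symm m) : ℝ)) = _
  have hterm : ∀ τ : Equiv.Perm (Fin k), (α fun m => e (I (τ m))) *
      ((e.det fun m => Fin.append (fun m => e (I (τ m))) (fun m => e (J m)) (Fin.cast h.symm m) : ℝ) : ℂ)
      = ((Equiv.Perm.sign p : ℤ) : ℂ) * α fun m => e (I m) := by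
    intro τ
    let s : Fin k ⊕ Fin l ≃ Fin 8 := finSumFinEquiv.trans (finCongr h)
    -- `ρ` acts by `τ` on the first block and fixes the second, so the determinant and `α` both pick
    -- up the sign of `τ`.
    let ρ : Equiv.Perm (Fin 8) := s.permCongr (Equiv.Perm.sumCongr τ 1)
    have hρ : (fun m => Fin.append (fun m => e (I (τ m))) (fun m => e (J m)) (Fin.cast h.symm m)) =
        fun m => e ((p * ρ) m) := by
      funext m
      obtain ⟨x, rfl⟩ := s.surjective m
      rcases x with x | x <;>
        simp [s, ρ, Equiv.permCongr_apply, hI, hJ]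
    rw [hρ, hdet, Equiv.Perm.sign_mul, Equiv.Perm.sign_permCongr, Equiv.Perm.sign_sumCongr]
    have := α.map_perm (fun m => e (I m)) τ
    rw [Function.comp_def] at this
    rw [this]
    rcases Int.units_eq_one_or (Equiv.Perm.sign τ) with h | h <;> simp [h, mul_comm]
  have hsum : ∑ i : Fin k → Fin 8, (α fun m => e (i m)) *
      ((e.det fun m => Fin.append (fun m => e (i m)) (fun m => e (J m)) (Fin.cast h.symm m) : ℝ) : ℂ) =
      ∑ τ : Equiv.Perm (Fin k), (α fun m => e (I (τ m))) *
      ((e.det fun m => Fin.append (fun m => e (I (τ m))) (fun m => e (J m)) (Fin.cast h.symm m) : ℝ) : ℂ) := by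
    symm
    refine Finset.sum_of_injOn (fun τ : Equiv.Perm (Fin k) => fun m => I (τ m)) ?_ (by simp) ?_
      (fun _ _ => rfl)
    · intro τ _ τ' _ hττ
      exact Equiv.ext fun m => hIinj (congrFun hττ m)
    -- A repeated index kills `α`, and an index in common with `J` kills the determinant. What
    -- remains takes distinct values among those of `I`, hence is a rearrangement of `I`.
    · intro i _ hi
      by_contra hne
      have h1 : (α fun m => e (i m)) ≠ 0 := left_ne_zero_of_mul hne
      have h2 := right_ne_zero_of_mul hne
      have hinj : Function.Injective i := by
        by_contra hn
        refine h1 (α.map_eq_zero_of_not_injective _ fun hn' => hn fun a b hab => hn' ?_)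
        simp only [hab]
      have hinj2 : ∀ a b, i a ≠ J b := by
        intro a b hab
        refine h2 ?_
        rw [Complex.ofReal_eq_zero]
        refine e.det.map_eq_zero_of_eq (i := Fin.cast h (Fin.castAdd l a))
          (j := Fin.cast h (Fin.natAdd k b)) _ (by simp [hab]) ?_
        intro hc
        have := congrArg Fin.val hc
        simp at this
        omega
      have hex : ∀ a, ∃ b, I b = i a := by
        intro a
        obtain ⟨m, hm⟩ := p.surjective (i a)
        obtain ⟨m, rfl⟩ : ∃ m', m = Fin.cast h m' := ⟨Fin.cast h.symm m, by simp⟩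
        induction m using Fin.addCases with
        | left b => exact ⟨b, hm⟩
        | right b => exact absurd hm.symm (hinj2 a b)
      choose t ht using hex
      have htinj : Function.Injective t := fun a b hab => hinj (by rw [← ht, ← ht, hab])
      refine hi ⟨Equiv.ofBijective t (Finite.injective_iff_bijective.1 htinj), by simp, ?_⟩
      funext m
      exact ht m
  rw [hsum]
  simp only [hterm, Finset.sum_const, Finset.card_univ, Fintype.card_perm, Fintype.card_fin,
    nsmul_eq_mul]
  rw [inv_mul_cancel_left₀]
  exact_mod_cast k.factorial_ne_zero

end Hodge


/-! ### The Hodge star between degrees 2 and 6 -/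

section HodgeFormulas

variable {W : Type*} [AddCommGroup W] [Module ℝ W] (e : Module.Basis (Fin 8) ℝ W)

theorem insertPerm_insertPerm (a : Fin 8) (b : Fin 7) (m : Fin 6) :
    insertPerm a (insertPerm b 1) m.succ.succ = a.succAbove (b.succAbove m) := by
  simp [insertPerm_succ]

theorem insertPerm_insertPerm_one (a : Fin 8) (b : Fin 7) :
    insertPerm a (insertPerm b 1) 1 = a.succAbove b := by
  have := insertPerm_succ a (insertPerm b 1) 0
  rwa [insertPerm_zero] at this

/-- The permutation that lists `a`, then `a.succAbove b`, then the other indices in increasing order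
has sign `(-1)^(a+b)`. -/
theorem hodge_two_six (α : CForm W 2) (a : Fin 8) (b : Fin 7) :
    hodge e (k := 2) (l := 6) rfl α (fun m => e (a.succAbove (b.succAbove m))) =
      (-1) ^ (a : ℕ) * (-1) ^ (b : ℕ) * α ![e a, e (a.succAbove b)] := by
  have h := hodge_apply_perm e (k := 2) (l := 6) rfl α (insertPerm a (insertPerm b 1))
  have h1 : (fun m : Fin 6 => e (insertPerm a (insertPerm b 1) (Fin.cast rfl (Fin.natAdd 2 m)))) =
      fun m => e (a.succAbove (b.succAbove m)) := by
    funext m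
    rw [← insertPerm_insertPerm]
    congr 2
    ext
    simp
    ring
  have h2 : (fun m : Fin 2 => e (insertPerm a (insertPerm b 1) (Fin.cast rfl (Fin.castAdd 6 m)))) =
      ![e a, e (a.succAbove b)] := by
    funext m
    fin_cases m
    · exact congrArg e (insertPerm_zero _ _)
    · exact congrArg e (insertPerm_insertPerm_one _ _)
  rw [h1, h2, sign_insertPerm, sign_insertPerm] at h
  rw [h]
  simp

theorem hodge_six_two (α : CForm W 6) (a : Fin 8) (b : Fin 7) :
    hodge e (k := 6) (l := 2) rfl α ![e a, e (a.succAbove b)] =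
      (-1) ^ (a : ℕ) * (-1) ^ (b : ℕ) * α (fun m => e (a.succAbove (b.succAbove m))) := by
  -- The rotation by two places moves the chosen pair from the front to the end; it is even, so the
  -- sign is that of `hodge_two_six`.
  have h := hodge_apply_perm e (k := 6) (l := 2) rfl α
    (insertPerm a (insertPerm b 1) * (finRotate 8 * finRotate 8))
  have h1 : (fun m : Fin 6 => e ((insertPerm a (insertPerm b 1) * (finRotate 8 * finRotate 8))
      (Fin.cast rfl (Fin.castAdd 2 m)))) = fun m => e (a.succAbove (b.succAbove m)) := by
    funext m
    rw [← insertPerm_insertPerm]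
    rw [Equiv.Perm.mul_apply]
    congr 2
    fin_cases m <;> rfl
  have h2 : (fun m : Fin 2 => e ((insertPerm a (insertPerm b 1) * (finRotate 8 * finRotate 8))
      (Fin.cast rfl (Fin.natAdd 6 m)))) = ![e a, e (a.succAbove b)] := by
    funext m
    rw [Equiv.Perm.mul_apply]
    fin_cases m
    · exact congrArg e (insertPerm_zero _ _)
    · exact congrArg e (insertPerm_insertPerm_one _ _)
  rw [h1, h2, Equiv.Perm.sign_mul, sign_insertPerm, sign_insertPerm, Equiv.Perm.sign_mul,
    Int.units_mul_self] at h
  rw [h]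
  simp

theorem hodge_eight_zero (α : CForm W 8) :
    hodge e (k := 8) (l := 0) rfl α ![] = α e := by
  have h := hodge_apply_perm e (k := 8) (l := 0) rfl α 1
  have h1 : (fun m : Fin 0 => e ((1 : Equiv.Perm (Fin 8)) (Fin.cast rfl (Fin.natAdd 8 m)))) = ![] :=
    Subsingleton.elim _ _
  rw [h1] at h
  simpa using h

theorem exists_eq_succAbove_succAbove {J : Fin 6 → Fin 8} (hJ : StrictMono J) :
    ∃ (a : Fin 8) (b : Fin 7), J = fun m => a.succAbove (b.succAbove m) := by
  have step : ∀ {n : ℕ} {J : Fin 6 → Fin (n + 1)}, 6 < n + 1 → StrictMono J →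
      ∃ (a : Fin (n + 1)) (J' : Fin 6 → Fin n), StrictMono J' ∧ J = fun m => a.succAbove (J' m) := by
    intro n J hn hJ
    obtain ⟨a, ha⟩ : ∃ a, ∀ m, J m ≠ a := by
      by_contra! hc
      have := Fintype.card_le_of_surjective J hc
      simp at this
      omega
    have hx : ∀ m, ∃ m', a.succAbove m' = J m := fun m => Fin.exists_succAbove_eq (ha m)
    choose J' hJ' using hx
    refine ⟨a, J', fun x y hxy => ?_, funext fun m => (hJ' m).symm⟩
    have := hJ hxy
    rw [← hJ', ← hJ'] at this
    exact (Fin.strictMono_succAbove a).lt_iff_lt.1 this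
  obtain ⟨a, J₁, hJ₁, rfl⟩ := step (by norm_num) hJ
  obtain ⟨b, J₂, hJ₂, rfl⟩ := step (by norm_num) hJ₁
  have : J₂ = id := (hJ₂.range_inj strictMono_id).1 (by
    rw [(Finite.injective_iff_surjective.1 hJ₂.injective).range_eq]; simp)
  exact ⟨a, b, by rw [this]; rfl⟩

theorem CForm.ext_six {α β : CForm W 6} (h : ∀ (a : Fin 8) (b : Fin 7),
    (α fun m => e (a.succAbove (b.succAbove m))) = β fun m => e (a.succAbove (b.succAbove m))) :
    α = β := by
  refine CForm.ext_strictMono e fun J hJ => ?_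
  obtain ⟨a, b, rfl⟩ := exists_eq_succAbove_succAbove hJ
  exact h a b

end HodgeFormulas

/-! ### Orthogonal projections and their norms -/

section Projection

variable {W : Type*} [AddCommGroup W] [Module ℝ W] (e : Module.Basis (Fin 8) ℝ W)

/-- The sum lies in `S`, and its difference from `α` is orthogonal to every `w j`, hence to `S`. A
common squared length `N` is allowed so that the bases can keep integer coefficients. -/
theorem formProj_eq_sum {ι : Type*} [Fintype ι] [DecidableEq ι] {k : ℕ} {S : Submodule ℂ (CForm W k)}
    {w : ι → CForm W k} {N : ℝ} (hN : N ≠ 0)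
    (hw : ∀ i j, formInner e (w i) (w j) = if i = j then (N : ℂ) else 0)
    (hmem : ∀ i, w i ∈ S) (hS : S ≤ Submodule.span ℂ (Set.range w)) (α : CForm W k) :
    formProj e S α = ∑ i, (formInner e (w i) α / N) • w i := by
  let _ : NormedAddCommGroup (CForm W k) := (formInnerCore e k).toNormedAddCommGroup
  let _ : InnerProductSpace ℂ (CForm W k) := InnerProductSpace.ofCore (formInnerCore e k).toCore
  have : FiniteDimensional ℂ (CForm W k) := finiteDimensional_cForm e k
  have hi : ∀ α β : CForm W k, inner ℂ α β = formInner e α β := fun _ _ => rfl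
  change S.starProjection α = _
  refine (Submodule.eq_starProjection_of_mem_of_inner_eq_zero ?_ ?_)
  · exact Submodule.sum_mem _ fun i _ => Submodule.smul_mem _ _ (hmem i)
  · intro s hs
    refine Submodule.span_induction ?_ ?_ ?_ ?_ (hS hs)
    · rintro _ ⟨j, rfl⟩
      rw [inner_sub_left, sum_inner]
      simp only [inner_smul_left]
      simp only [hi, hw, mul_ite, mul_zero, Finset.sum_ite_eq', Finset.mem_univ, if_true]
      rw [map_div₀, formInner_conj, Complex.conj_ofReal, div_mul_cancel₀ _ (by exact_mod_cast hN),
        sub_self]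
    · simp
    · intro x y _ _ hx hy
      rw [inner_add_right, hx, hy, add_zero]
    · intro c x _ hx
      rw [inner_smul_right, hx, mul_zero]

theorem formNormSq_formProj {ι : Type*} [Fintype ι] [DecidableEq ι] {k : ℕ}
    {S : Submodule ℂ (CForm W k)} {w : ι → CForm W k} {N : ℝ} (hN : N ≠ 0)
    (hw : ∀ i j, formInner e (w i) (w j) = if i = j then (N : ℂ) else 0)
    (hmem : ∀ i, w i ∈ S) (hS : S ≤ Submodule.span ℂ (Set.range w)) (α : CForm W k) :
    formNormSq e (formProj e S α) = ∑ i, ‖formInner e (w i) α‖ ^ 2 / N := by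
  let _ : NormedAddCommGroup (CForm W k) := (formInnerCore e k).toNormedAddCommGroup
  let _ : InnerProductSpace ℂ (CForm W k) := InnerProductSpace.ofCore (formInnerCore e k).toCore
  have hi : ∀ α β : CForm W k, inner ℂ α β = formInner e α β := fun _ _ => rfl
  rw [formProj_eq_sum e hN hw hmem hS, formNormSq, ← hi, sum_inner, Complex.re_sum]
  refine Finset.sum_congr rfl fun i _ => ?_
  rw [inner_sum]
  simp only [inner_smul_left, inner_smul_right]
  simp only [hi, hw, mul_ite, mul_zero, Finset.sum_ite_eq, Finset.mem_univ, if_true]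
  have hN' : (N : ℂ) ≠ 0 := by exact_mod_cast hN
  rw [map_div₀, Complex.conj_ofReal, div_mul_cancel₀ _ hN', div_eq_mul_inv _ (N : ℂ), mul_right_comm,
    Complex.mul_conj', ← Complex.ofReal_inv, ← Complex.ofReal_pow, ← Complex.ofReal_mul,
    Complex.ofReal_re, div_eq_mul_inv]

theorem formNormSq_eq_zero {k : ℕ} {α : CForm W k} : formNormSq e α = 0 ↔ α = 0 := by
  let _ : NormedAddCommGroup (CForm W k) := (formInnerCore e k).toNormedAddCommGroup
  let _ : InnerProductSpace ℂ (CForm W k) := InnerProductSpace.ofCore (formInnerCore e k).toCore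
  have : formNormSq e α = ‖α‖ ^ 2 := (inner_self_eq_norm_sq (𝕜 := ℂ) α)
  rw [this]
  simp

theorem formNormSq_nonneg {k : ℕ} (α : CForm W k) : 0 ≤ formNormSq e α :=
  (formInnerCore e k).re_inner_nonneg α

end Projection

/-! ### Integer tables for the Cayley form and the rank 7 components -/

section Tables

/-- The coefficients of the Cayley form. -/
def cayleyList : List (ℤ × (Fin 4 → Fin 8)) :=
    [(1, ![0, 1, 2, 3]), (1, ![0, 1, 4, 5]), (1, ![0, 1, 6, 7]), (1, ![0, 2, 4, 6]), (-1, ![0, 2,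
    5, 7]), (-1, ![0, 3, 4, 7]), (-1, ![0, 3, 5, 6]), (1, ![4, 5, 6, 7]), (1, ![2, 3, 6, 7]), (1,
    ![2, 3, 4, 5]), (1, ![1, 3, 5, 7]), (-1, ![1, 3, 4, 6]), (-1, ![1, 2, 5, 6]), (-1, ![1, 2, 4,
    7])]

/-- The coefficients of an orthogonal basis of `Λ²₇`. -/
def etaList : Fin 7 → List (ℤ × (Fin 2 → Fin 8)) :=
  ![[(1, ![0, 1]), (1, ![2, 3]), (1, ![4, 5]), (1, ![6, 7])],
    [(1, ![0, 2]), (-1, ![1, 3]), (1, ![4, 6]), (-1, ![5, 7])],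
    [(1, ![0, 3]), (1, ![1, 2]), (-1, ![4, 7]), (-1, ![5, 6])],
    [(1, ![0, 4]), (-1, ![1, 5]), (-1, ![2, 6]), (1, ![3, 7])],
    [(1, ![0, 5]), (1, ![1, 4]), (1, ![2, 7]), (1, ![3, 6])],
    [(1, ![0, 6]), (-1, ![1, 7]), (1, ![2, 4]), (-1, ![3, 5])],
    [(1, ![0, 7]), (1, ![1, 6]), (-1, ![2, 5]), (-1, ![3, 4])]]

/-- The coefficients of an orthogonal basis of `Λ⁴₇`. -/
def omegaList : Fin 7 → List (ℤ × (Fin 4 → Fin 8)) :=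
  ![[(-1, ![0, 2, 4, 7]), (-1, ![0, 2, 5, 6]), (-1, ![0, 3, 4, 6]), (1, ![0, 3, 5, 7]), (-1, ![1,
    2, 4, 6]), (1, ![1, 2, 5, 7]), (1, ![1, 3, 4, 7]), (1, ![1, 3, 5, 6])],
    [(1, ![0, 1, 4, 7]), (1, ![0, 1, 5, 6]), (1, ![0, 3, 4, 5]), (1, ![0, 3, 6, 7]), (1, ![1, 2, 4,
    5]), (1, ![1, 2, 6, 7]), (1, ![2, 3, 4, 7]), (1, ![2, 3, 5, 6])],
    [(1, ![0, 1, 4, 6]), (-1, ![0, 1, 5, 7]), (-1, ![0, 2, 4, 5]), (-1, ![0, 2, 6, 7]), (1, ![1, 3,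
    4, 5]), (1, ![1, 3, 6, 7]), (1, ![2, 3, 4, 6]), (-1, ![2, 3, 5, 7])],
    [(-1, ![0, 1, 2, 7]), (-1, ![0, 1, 3, 6]), (1, ![0, 2, 3, 5]), (1, ![0, 5, 6, 7]), (1, ![1, 2,
    3, 4]), (1, ![1, 4, 6, 7]), (-1, ![2, 4, 5, 7]), (-1, ![3, 4, 5, 6])],
    [(-1, ![0, 1, 2, 6]), (1, ![0, 1, 3, 7]), (-1, ![0, 2, 3, 4]), (-1, ![0, 4, 6, 7]), (1, ![1, 2,
    3, 5]), (1, ![1, 5, 6, 7]), (-1, ![2, 4, 5, 6]), (1, ![3, 4, 5, 7])],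
    [(1, ![0, 1, 2, 5]), (1, ![0, 1, 3, 4]), (1, ![0, 2, 3, 7]), (1, ![0, 4, 5, 7]), (1, ![1, 2, 3,
    6]), (1, ![1, 4, 5, 6]), (1, ![2, 5, 6, 7]), (1, ![3, 4, 6, 7])],
    [(1, ![0, 1, 2, 4]), (-1, ![0, 1, 3, 5]), (-1, ![0, 2, 3, 6]), (-1, ![0, 4, 5, 6]), (1, ![1, 2,
    3, 7]), (1, ![1, 4, 5, 7]), (1, ![2, 4, 6, 7]), (-1, ![3, 5, 6, 7])]]

theorem cayleyList_strictMono : ∀ t ∈ cayleyList, StrictMono t.2 := by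
  unfold StrictMono; decide

theorem etaList_strictMono (j : Fin 7) : ∀ t ∈ etaList j, StrictMono t.2 := by
  unfold StrictMono; revert j; decide

theorem omegaList_strictMono (j : Fin 7) : ∀ t ∈ omegaList j, StrictMono t.2 := by
  unfold StrictMono; revert j; decide

variable {W : Type*} [AddCommGroup W] [Module ℝ W] (e : Module.Basis (Fin 8) ℝ W)

theorem complexify_cayleyForm : complexify (cayleyForm e) = sparseForm e cayleyList := by
  ext v
  simp only [complexify_apply, cayleyForm, sparseForm, cayleyList, List.map_cons, List.map_nil,
    List.sum_cons, List.sum_nil, AlternatingMap.add_apply, AlternatingMap.sub_apply,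
    AlternatingMap.smul_apply, AlternatingMap.zero_apply, smul_eq_mul]
  push_cast
  ring

/-- This turns inner products of tabulated forms into integers that can be evaluated. The values 4
and 8 below count the terms of each `η_j` and `ω_j`, all with coefficient ±1; distinct members of
either family have no term in common. -/
theorem formInner_sparseForm_sparseForm {k : ℕ} {l l' : List (ℤ × (Fin k → Fin 8))}
    (hl : ∀ t ∈ l, StrictMono t.2) (hl' : ∀ t ∈ l', StrictMono t.2) :
    formInner e (sparseForm e l) (sparseForm e l') =
      ((l.map fun t => t.1 * coeffAt l' t.2).sum : ℤ) := by
  rw [formInner_sparseForm]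
  induction l with
  | nil => simp
  | cons t l ih =>
    have ih := ih fun t ht => hl t (List.mem_cons_of_mem _ ht)
    simp only [List.map_cons, List.sum_cons] at ih ⊢
    rw [ih, sparseForm_apply e hl' (hl t (by simp))]
    push_cast
    ring

theorem formInner_eta (i j : Fin 7) :
    formInner e (sparseForm e (etaList i)) (sparseForm e (etaList j)) =
      if i = j then ((4 : ℝ) : ℂ) else 0 := by
  rw [formInner_sparseForm_sparseForm e (etaList_strictMono i) (etaList_strictMono j)]
  have h : ∀ i j : Fin 7, ((etaList i).map fun t => t.1 * coeffAt (etaList j) t.2).sum =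
      if i = j then 4 else 0 := by decide
  rw [h]
  split_ifs <;> simp

set_option maxRecDepth 10000 in
theorem formInner_omega (i j : Fin 7) :
    formInner e (sparseForm e (omegaList i)) (sparseForm e (omegaList j)) =
      if i = j then ((8 : ℝ) : ℂ) else 0 := by
  rw [formInner_sparseForm_sparseForm e (omegaList_strictMono i) (omegaList_strictMono j)]
  have h : ∀ i j : Fin 7, ((omegaList i).map fun t => t.1 * coeffAt (omegaList j) t.2).sum =
      if i = j then 8 else 0 := by decide +kernel
  rw [h]
  split_ifs <;> simp

/-- The coefficient of `e^p ∧ e^q ∧ e^r ∧ e^s` in the Cayley form. -/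
def cayleyCoeff (p q r s : Fin 8) : ℤ := coeffAt cayleyList ![p, q, r, s]

theorem strictMono_vec4 {p q r s : Fin 8} (hpq : p < q) (hqr : q < r) (hrs : r < s) :
    StrictMono ![p, q, r, s] := by
  rw [Fin.strictMono_iff_lt_succ]
  intro i
  fin_cases i <;> assumption

theorem cayley_apply {p q r s : Fin 8} (hpq : p < q) (hqr : q < r) (hrs : r < s) :
    complexify (cayleyForm e) ![e p, e q, e r, e s] = cayleyCoeff p q r s := by
  rw [complexify_cayleyForm]
  have := sparseForm_apply e cayleyList_strictMono (strictMono_vec4 hpq hqr hrs)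
  rw [cayleyCoeff, ← this]
  congr 1
  ext i
  fin_cases i <;> rfl

end Tables

/-! ### The component of rank 7 in the 2-forms -/

section LambdaTwoSeven

variable {W : Type*} [AddCommGroup W] [Module ℝ W] (e : Module.Basis (Fin 8) ℝ W)

/-- Six increasing indices depend only on the unordered pair omitted, so the smaller one may be
removed first. Then the omitted pair is increasing, as the coefficient tables require. -/
theorem succAbove_succAbove_swap (a : Fin 8) (b : Fin 7) : ∃ (a' : Fin 8) (b' : Fin 7),
    a' ≤ b'.castSucc ∧ ∀ m : Fin 6, a.succAbove (b.succAbove m) = a'.succAbove (b'.succAbove m) := by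
  revert a b
  decide +kernel

theorem CForm.ext_six_of_le {α β : CForm W 6} (h : ∀ (a : Fin 8) (b : Fin 7), a ≤ b.castSucc →
    (α fun m => e (a.succAbove (b.succAbove m))) = β fun m => e (a.succAbove (b.succAbove m))) :
    α = β := by
  refine CForm.ext_six e fun a b => ?_
  obtain ⟨a', b', hab, h'⟩ := succAbove_succAbove_swap a b
  simp only [h']
  exact h a' b' hab

theorem strictMono_vec2 {p q : Fin 8} (hpq : p < q) : StrictMono ![p, q] := by
  rw [Fin.strictMono_iff_lt_succ]
  intro i
  fin_cases i
  assumption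

theorem eta_apply (j : Fin 7) {p q : Fin 8} (hpq : p < q) :
    sparseForm e (etaList j) ![e p, e q] = coeffAt (etaList j) ![p, q] := by
  rw [← sparseForm_apply e (etaList_strictMono j) (strictMono_vec2 hpq)]
  congr 1
  ext i
  fin_cases i <;> rfl

/-- `∑ c x_{pq}` for a list of coefficients `c` and pairs `(p, q)`. -/
noncomputable def pairSum (x : Fin 8 → Fin 8 → ℂ) (l : List (ℤ × Fin 8 × Fin 8)) : ℂ :=
  (l.map fun t => (t.1 : ℂ) * x t.2.1 t.2.2).sum

/-- The coefficient of a pair in a list of coefficients and pairs. -/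
def pairCoeff (l : List (ℤ × Fin 8 × Fin 8)) (P : Fin 8 × Fin 8) : ℤ :=
  (l.map fun t => if t.2 = P then t.1 else 0).sum

/-- Collecting coefficients pair by pair reduces an identity linear in `α` to a comparison of
integers. -/
theorem pairSum_eq_sum (x : Fin 8 → Fin 8 → ℂ) (l : List (ℤ × Fin 8 × Fin 8)) :
    pairSum x l = ∑ P, (pairCoeff l P : ℂ) * x P.1 P.2 := by
  induction l with
  | nil => simp [pairSum, pairCoeff]
  | cons t l ih =>
    simp only [pairSum, pairCoeff, List.map_cons, List.sum_cons] at ih ⊢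
    rw [ih]
    push_cast
    simp only [add_mul, Finset.sum_add_distrib]
    congr 1
    rw [Finset.sum_eq_single t.2] <;> simp +contextual [eq_comm]

/-- The coefficients of `α ∧ Φ` at `(e_{s 0}, …, e_{s 5})` in terms of those of `α`. -/
def wedgeCayleyList (s : Fin 6 → Fin 8) : List (ℤ × Fin 8 × Fin 8) :=
   [(cayleyCoeff (s 2) (s 3) (s 4) (s 5), s 0, s 1),
    (-cayleyCoeff (s 1) (s 3) (s 4) (s 5), s 0, s 2),
    (cayleyCoeff (s 1) (s 2) (s 4) (s 5), s 0, s 3),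
    (-cayleyCoeff (s 1) (s 2) (s 3) (s 5), s 0, s 4),
    (cayleyCoeff (s 1) (s 2) (s 3) (s 4), s 0, s 5),
    (cayleyCoeff (s 0) (s 3) (s 4) (s 5), s 1, s 2),
    (-cayleyCoeff (s 0) (s 2) (s 4) (s 5), s 1, s 3),
    (cayleyCoeff (s 0) (s 2) (s 3) (s 5), s 1, s 4),
    (-cayleyCoeff (s 0) (s 2) (s 3) (s 4), s 1, s 5),
    (cayleyCoeff (s 0) (s 1) (s 4) (s 5), s 2, s 3),
    (-cayleyCoeff (s 0) (s 1) (s 3) (s 5), s 2, s 4),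
    (cayleyCoeff (s 0) (s 1) (s 3) (s 4), s 2, s 5),
    (cayleyCoeff (s 0) (s 1) (s 2) (s 5), s 3, s 4),
    (-cayleyCoeff (s 0) (s 1) (s 2) (s 4), s 3, s 5),
    (cayleyCoeff (s 0) (s 1) (s 2) (s 3), s 4, s 5)]

/-- The coefficients of `∑ ⟨η_j, α⟩ η_j` at `(e_p, e_q)` in terms of those of `α`. -/
def etaPairList (p q : Fin 8) : List (ℤ × Fin 8 × Fin 8) :=
  (List.finRange 7).flatMap fun j => (etaList j).map fun t =>
    (t.1 * coeffAt (etaList j) ![p, q], t.2 0, t.2 1)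

theorem wedge_cayley_apply (α : CForm W 2) {s : Fin 6 → Fin 8} (hs : StrictMono s) :
    wedge α (complexify (cayleyForm e)) (fun m => e (s m)) =
      pairSum (fun p q => α ![e p, e q]) (wedgeCayleyList s) := by
  have hc : ∀ {i j k l : Fin 6}, i < j → j < k → k < l → _ := fun {i j k l} hij hjk hkl =>
    cayley_apply e (hs hij) (hs hjk) (hs hkl)
  rw [wedge_two_four]
  simp (disch := decide) only [hc, pairSum, wedgeCayleyList, List.map_cons, List.map_nil,
    List.sum_cons, List.sum_nil]
  push_cast
  ring

theorem pairSum_etaPairList (α : CForm W 2) (p q : Fin 8) :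
    pairSum (fun p q => α ![e p, e q]) (etaPairList p q) =
      ∑ j, formInner e (sparseForm e (etaList j)) α * coeffAt (etaList j) ![p, q] := by
  have h : ∀ t : Fin 2 → Fin 8, (α fun m => e (t m)) = α ![e (t 0), e (t 1)] :=
    fun t => α.apply_vec2 _
  rw [Fin.sum_univ_def, pairSum, etaPairList, List.map_flatMap, List.flatMap, List.sum_flatten,
    List.map_map]
  congr 1
  refine List.map_congr_left fun j _ => ?_
  rw [formInner_sparseForm, Function.comp_apply, List.map_map, ← List.sum_map_mul_right]
  congr 1
  refine List.map_congr_left fun t _ => ?_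
  simp only [h, Function.comp_apply]
  push_cast
  ring

/-- The integer content of `hodge_add_wedge_cayley`: the coefficients of `α(e_P)` on its two sides,
with the sign of the Hodge star, settled by a finite check. -/
theorem pairCoeff_wedgeCayleyList (a : Fin 8) (b : Fin 7) (hab : a ≤ b.castSucc) (P : Fin 8 × Fin 8) :
    pairCoeff (wedgeCayleyList fun m => a.succAbove (b.succAbove m)) P
      + (-1) ^ (a : ℕ) * (-1) ^ (b : ℕ) * (if (a, a.succAbove b) = P then 1 else 0) =
    (-1) ^ (a : ℕ) * (-1) ^ (b : ℕ) * pairCoeff (etaPairList a (a.succAbove b)) P := by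
  revert a b P
  decide +kernel

/-- The map `α ↦ α ∧ Φ` equals `3 *` on `Λ²₇` and `-*` on its orthogonal complement, so adding `*α`
gives `4 * π²₇ α`. The factor 4 cancels against the squared length of the `η_j`. -/
theorem hodge_add_wedge_cayley (α : CForm W 2) :
    wedge α (complexify (cayleyForm e)) + hodge e (k := 2) (l := 6) rfl α =
      ∑ j, formInner e (sparseForm e (etaList j)) α •
        hodge e (k := 2) (l := 6) rfl (sparseForm e (etaList j)) := by
  refine CForm.ext_six_of_le e fun a b hab => ?_
  have hlt : a < a.succAbove b := by
    rw [Fin.succAbove_of_le_castSucc _ _ hab]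
    exact Fin.lt_of_le_of_lt hab (Fin.castSucc_lt_succ)
  have hs : StrictMono (fun m : Fin 6 => a.succAbove (b.succAbove m)) :=
    (Fin.strictMono_succAbove a).comp (Fin.strictMono_succAbove b)
  have h1 : wedge α (complexify (cayleyForm e)) (fun m => e (a.succAbove (b.succAbove m))) = _ :=
    wedge_cayley_apply e α hs
  have h2 := pairSum_etaPairList e α a (a.succAbove b)
  rw [AlternatingMap.add_apply, h1, hodge_two_six, altMap_sum_apply]
  simp only [AlternatingMap.smul_apply, smul_eq_mul, hodge_two_six, eta_apply e _ hlt]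
  have h3 : ∑ j, formInner e (sparseForm e (etaList j)) α *
      ((-1) ^ (a : ℕ) * (-1) ^ (b : ℕ) * (coeffAt (etaList j) ![a, a.succAbove b] : ℂ)) =
      (-1) ^ (a : ℕ) * (-1) ^ (b : ℕ) * pairSum (fun p q => α ![e p, e q])
        (etaPairList a (a.succAbove b)) := by
    rw [h2, Finset.mul_sum]
    exact Finset.sum_congr rfl fun j _ => by ring
  rw [h3, pairSum_eq_sum, pairSum_eq_sum, Finset.mul_sum]
  have h4 : (-1) ^ (a : ℕ) * (-1) ^ (b : ℕ) * α ![e a, e (a.succAbove b)] =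
      ∑ P : Fin 8 × Fin 8, ((-1) ^ (a : ℕ) * (-1) ^ (b : ℕ) *
        (if (a, a.succAbove b) = P then 1 else 0)) * α ![e P.1, e P.2] := by
    rw [Finset.sum_eq_single (a, a.succAbove b)] <;> simp +contextual [eq_comm]
  rw [h4, ← Finset.sum_add_distrib]
  refine Finset.sum_congr rfl fun P _ => ?_
  have h5 := congrArg (Int.cast : ℤ → ℂ) (pairCoeff_wedgeCayleyList a b hab P)
  push_cast at h5
  linear_combination α ![e P.1, e P.2] * h5

theorem eta_mem_Lambda27 (j : Fin 7) : sparseForm e (etaList j) ∈ Lambda27 e (cayleyForm e) := by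
  -- By orthogonality the right side is `4 * η_j`, and subtracting `* η_j` leaves the eigenvalue 3.
  have h := hodge_add_wedge_cayley e (sparseForm e (etaList j))
  simp only [formInner_eta, ite_smul, zero_smul, Finset.sum_ite_eq', Finset.mem_univ, if_true] at h
  change wedge _ _ = (3 : ℕ) • _
  rw [eq_sub_of_add_eq h]
  ext v
  simp
  ring

theorem Lambda27_le_span : Lambda27 e (cayleyForm e) ≤
    Submodule.span ℂ (Set.range fun j => sparseForm e (etaList j)) := by
  intro α hα
  change wedge _ _ = (3 : ℕ) • _ at hα
  -- The eigenvalue equation makes the left side of `hodge_add_wedge_cayley` equal to `4 * α`.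
  -- Evaluating at the complementary indices then removes the star, up to a sign whose square is 1
  -- (`hs`).
  have h : (4 : ℕ) • hodge e (k := 2) (l := 6) rfl α =
      ∑ j, formInner e (sparseForm e (etaList j)) α •
        hodge e (k := 2) (l := 6) rfl (sparseForm e (etaList j)) := by
    rw [← hodge_add_wedge_cayley e α, hα]
    exact succ_nsmul _ 3
  have h2 : α = ∑ j, (formInner e (sparseForm e (etaList j)) α / 4) • sparseForm e (etaList j) := by
    refine CForm.ext_strictMono e fun J hJ => ?_
    have hpq : J 0 < J 1 := hJ (by decide)
    obtain ⟨b, hb⟩ := Fin.exists_succAbove_eq hpq.ne'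
    have hJ' : (fun m => e (J m)) = ![e (J 0), e ((J 0).succAbove b)] := by
      rw [hb]; ext i; fin_cases i <;> rfl
    have h' := congrArg (fun γ : CForm W 6 => γ fun m => e ((J 0).succAbove (b.succAbove m))) h
    simp only [altMap_sum_apply, AlternatingMap.smul_apply, hodge_two_six,
      smul_eq_mul, nsmul_eq_mul] at h'
    rw [hJ', altMap_sum_apply]
    simp only [AlternatingMap.smul_apply, smul_eq_mul]
    have hs : ((-1 : ℂ) ^ (J 0 : ℕ) * (-1) ^ (b : ℕ)) * ((-1) ^ (J 0 : ℕ) * (-1) ^ (b : ℕ)) = 1 := by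
      rw [← pow_add, ← pow_add, ← two_mul, pow_mul]
      simp
    have h3 : ∑ j, formInner e (sparseForm e (etaList j)) α * ((-1) ^ (J 0 : ℕ) * (-1) ^ (b : ℕ) *
        sparseForm e (etaList j) ![e (J 0), e ((J 0).succAbove b)]) = (-1) ^ (J 0 : ℕ) * (-1) ^ (b : ℕ) *
        (4 * ∑ j, formInner e (sparseForm e (etaList j)) α / 4 *
          sparseForm e (etaList j) ![e (J 0), e ((J 0).succAbove b)]) := by
      rw [Finset.mul_sum, Finset.mul_sum]
      exact Finset.sum_congr rfl fun j _ => by ring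
    rw [h3] at h'
    push_cast at h'
    linear_combination ((-1) ^ (J 0 : ℕ) * (-1) ^ (b : ℕ) / 4 : ℂ) * h' + (∑ j, formInner e (sparseForm e (etaList j)) α / 4 *
      sparseForm e (etaList j) ![e (J 0), e ((J 0).succAbove b)] -
      α ![e (J 0), e ((J 0).succAbove b)]) * hs
  rw [h2]
  exact Submodule.sum_mem _ fun j _ => Submodule.smul_mem _ _ (Submodule.subset_span ⟨j, rfl⟩)

end LambdaTwoSeven

/-! ### The component of rank 7 in the 4-forms -/

section LambdaFourSeven

variable {W : Type*} [AddCommGroup W] [Module ℝ W] (e : Module.Basis (Fin 8) ℝ W)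

/-- The value of the Cayley form at `(e_j, e_q, e_r, e_s)`, `q < r < s`. -/
def cayleyInsert (j q r s : Fin 8) : ℤ :=
  if j < q then cayleyCoeff j q r s else if j = q then 0
  else if j < r then -cayleyCoeff q j r s else if j = r then 0
  else if j < s then cayleyCoeff q r j s else if j = s then 0
  else -cayleyCoeff q r s j

theorem CForm.swap01 (β : CForm W 4) (a b c d : W) : β ![b, a, c, d] = -β ![a, b, c, d] := by
  rw [← β.map_swap ![a, b, c, d] (i := 0) (j := 1) (by decide)]
  congr 1
  ext i
  fin_cases i <;> rfl

theorem CForm.swap12 (β : CForm W 4) (a b c d : W) : β ![a, c, b, d] = -β ![a, b, c, d] := by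
  rw [← β.map_swap ![a, b, c, d] (i := 1) (j := 2) (by decide)]
  congr 1
  ext i
  fin_cases i <;> rfl

theorem CForm.swap23 (β : CForm W 4) (a b c d : W) : β ![a, b, d, c] = -β ![a, b, c, d] := by
  rw [← β.map_swap ![a, b, c, d] (i := 2) (j := 3) (by decide)]
  congr 1
  ext i
  fin_cases i <;> rfl

theorem cayley_apply_insert (j : Fin 8) {q r s : Fin 8} (hqr : q < r) (hrs : r < s) :
    complexify (cayleyForm e) ![e j, e q, e r, e s] = cayleyInsert j q r s := by
  unfold cayleyInsert
  split_ifs with h1 h2 h3 h4 h5 h6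
  · exact cayley_apply e h1 hqr hrs
  · subst h2
    rw [AlternatingMap.map_eq_zero_of_eq (i := 0) (j := 1) _ _ (by rfl) (by decide)]
    simp
  · rw [CForm.swap01, cayley_apply e (lt_of_le_of_ne (not_lt.1 h1) (Ne.symm h2)) h3 hrs]
    simp
  · subst h4
    rw [AlternatingMap.map_eq_zero_of_eq (i := 0) (j := 2) _ _ (by rfl) (by decide)]
    simp
  · rw [CForm.swap01, CForm.swap12, cayley_apply e hqr (lt_of_le_of_ne (not_lt.1 h3) (Ne.symm h4)) h5]
    simp
  · subst h6
    rw [AlternatingMap.map_eq_zero_of_eq (i := 0) (j := 3) _ _ (by rfl) (by decide)]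
    simp
  · rw [CForm.swap01, CForm.swap12, CForm.swap23,
      cayley_apply e hqr hrs (lt_of_le_of_ne (not_lt.1 h5) (Ne.symm h6))]
    simp

/-- `a^♭ ∧ i(b)Φ - b^♭ ∧ i(a)Φ`. -/
noncomputable def flatWedge (a b : W) : CForm W 4 :=
  (wedge (flat e a) (interiorProd b (complexify (cayleyForm e))) : CForm W 4)
    - (wedge (flat e b) (interiorProd a (complexify (cayleyForm e))) : CForm W 4)

theorem flat_apply (u : W) (p : Fin 8) : flat e u ![e p] = (e.repr u p : ℂ) := by
  have h1 : ∀ j p : Fin 8, coordWedge e ![j] ![e p] = if j = p then 1 else 0 := by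
    intro j p
    have h := coordWedge_apply_strictMono e (I := ![j]) (J := ![p]) (Subsingleton.strictMono _)
      (Subsingleton.strictMono _)
    have h2 : (fun m => e (![p] m)) = ![e p] := by ext i; fin_cases i; rfl
    rw [h2] at h
    rw [h]
    simp
  rw [flat, complexify_apply, altMap_sum_apply]
  simp [h1]

theorem interiorProd_apply (u v w x : W) (Φ : CForm W 4) :
    interiorProd u Φ ![v, w, x] = Φ ![u, v, w, x] := rfl

theorem flatWedge_apply (a b : W) (p q r s : Fin 8) :
    flatWedge e a b ![e p, e q, e r, e s] =
      ((e.repr a p : ℂ) * complexify (cayleyForm e) ![b, e q, e r, e s]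
        - (e.repr a q : ℂ) * complexify (cayleyForm e) ![b, e p, e r, e s]
        + (e.repr a r : ℂ) * complexify (cayleyForm e) ![b, e p, e q, e s]
        - (e.repr a s : ℂ) * complexify (cayleyForm e) ![b, e p, e q, e r])
      - ((e.repr b p : ℂ) * complexify (cayleyForm e) ![a, e q, e r, e s]
        - (e.repr b q : ℂ) * complexify (cayleyForm e) ![a, e p, e r, e s]
        + (e.repr b r : ℂ) * complexify (cayleyForm e) ![a, e p, e q, e s]
        - (e.repr b s : ℂ) * complexify (cayleyForm e) ![a, e p, e q, e r]) := by
  rw [flatWedge, AlternatingMap.sub_apply, wedge_one_three, wedge_one_three]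
  simp only [Matrix.cons_val, flat_apply, interiorProd_apply]

theorem cayley_apply_left (b v w x : W) :
    complexify (cayleyForm e) ![b, v, w, x] =
      ∑ j, (e.repr b j : ℂ) * complexify (cayleyForm e) ![e j, v, w, x] := by
  have h := map_sum (complexify (cayleyForm e)).curryLeft (fun j => e.repr b j • e j) Finset.univ
  rw [e.sum_repr] at h
  have h' := congrArg (fun γ : CForm W 3 => γ ![v, w, x]) h
  simp only [altMap_sum_apply, map_smul] at h'
  exact h'

/-- Bilinearity in `(a, b)`, checked on coefficients; it reduces the spanning set to pairs of basis
vectors. -/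
theorem flatWedge_eq_sum (a b : W) :
    flatWedge e a b = ∑ i, ∑ j, ((e.repr a i : ℂ) * (e.repr b j : ℂ)) • flatWedge e (e i) (e j) := by
  have hδ : ∀ (u : W) (p : Fin 8), (e.repr u p : ℂ) = ∑ i, (e.repr u i : ℂ) * (e.repr (e i) p : ℂ) := by
    intro u p
    rw [Finset.sum_eq_single p] <;> simp +contextual [e.repr_self]
  have hl : ∀ (u v : W) (p : Fin 8) (x y z : W),
      (e.repr u p : ℂ) * complexify (cayleyForm e) ![v, x, y, z] =
        ∑ i, ∑ j, (e.repr u i : ℂ) * (e.repr v j : ℂ) *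
          ((e.repr (e i) p : ℂ) * complexify (cayleyForm e) ![e j, x, y, z]) := by
    intro u v p x y z
    rw [hδ u p, cayley_apply_left e v, Finset.sum_mul_sum]
    exact Finset.sum_congr rfl fun i _ => Finset.sum_congr rfl fun j _ => by ring
  have hr : ∀ (u v : W) (p : Fin 8) (x y z : W),
      (e.repr v p : ℂ) * complexify (cayleyForm e) ![u, x, y, z] =
        ∑ i, ∑ j, (e.repr u i : ℂ) * (e.repr v j : ℂ) *
          ((e.repr (e j) p : ℂ) * complexify (cayleyForm e) ![e i, x, y, z]) := by
    intro u v p x y z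
    rw [hl v u, Finset.sum_comm]
    exact Finset.sum_congr rfl fun i _ => Finset.sum_congr rfl fun j _ => by ring
  refine CForm.ext_strictMono e fun J _ => ?_
  have hJ : (fun m => e (J m)) = ![e (J 0), e (J 1), e (J 2), e (J 3)] := by
    ext i; fin_cases i <;> rfl
  rw [hJ]
  simp only [altMap_sum_apply, AlternatingMap.smul_apply, smul_eq_mul]
  simp only [flatWedge_apply]
  rw [hl a b (J 0), hl a b (J 1), hl a b (J 2), hl a b (J 3), hr a b (J 0), hr a b (J 1),
    hr a b (J 2), hr a b (J 3)]
  simp only [← Finset.sum_add_distrib, ← Finset.sum_sub_distrib]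
  exact Finset.sum_congr rfl fun i _ => Finset.sum_congr rfl fun j _ => by ring

/-- The coefficients of `e_i^♭ ∧ i(e_j)Φ - e_j^♭ ∧ i(e_i)Φ`. -/
def flatWedgeCoeff (i j p q r s : Fin 8) : ℤ :=
  ((if i = p then cayleyInsert j q r s else 0) - (if i = q then cayleyInsert j p r s else 0)
    + (if i = r then cayleyInsert j p q s else 0) - (if i = s then cayleyInsert j p q r else 0))
  - ((if j = p then cayleyInsert i q r s else 0) - (if j = q then cayleyInsert i p r s else 0)
    + (if j = r then cayleyInsert i p q s else 0) - (if j = s then cayleyInsert i p q r else 0))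

theorem flatWedge_apply_basis (i j : Fin 8) {p q r s : Fin 8} (hpq : p < q) (hqr : q < r)
    (hrs : r < s) : flatWedge e (e i) (e j) ![e p, e q, e r, e s] = flatWedgeCoeff i j p q r s := by
  rw [flatWedge_apply]
  rw [cayley_apply_insert e _ hqr hrs, cayley_apply_insert e _ (hpq.trans hqr) hrs,
    cayley_apply_insert e _ hpq (hqr.trans hrs), cayley_apply_insert e _ hpq hqr,
    cayley_apply_insert e _ hqr hrs, cayley_apply_insert e _ (hpq.trans hqr) hrs,
    cayley_apply_insert e _ hpq (hqr.trans hrs), cayley_apply_insert e _ hpq hqr]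
  simp only [e.repr_self, Finsupp.single_apply, flatWedgeCoeff]
  push_cast
  simp only [apply_ite (Complex.ofReal), Complex.ofReal_one, Complex.ofReal_zero, ite_mul, one_mul,
    zero_mul]

/-- The map `a ∧ b ↦ a^♭ ∧ i(b)Φ - b^♭ ∧ i(a)Φ` factors through the projection `Λ² → Λ²₇`, followed
by an isomorphism that matches `η_k` with a multiple of `ω_k`. Its matrix is verified entry by
entry. -/
theorem flatWedgeCoeff_eq : ∀ i j : Fin 8, i < j → ∀ p q : Fin 8, p < q → ∀ r : Fin 8, q < r →
    ∀ s : Fin 8, r < s → flatWedgeCoeff i j p q r s =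
      ((List.finRange 7).map fun k =>
        coeffAt (etaList k) ![i, j] * coeffAt (omegaList k) ![p, q, r, s]).sum := by
  decide +kernel

theorem omega_apply (k : Fin 7) {p q r s : Fin 8} (hpq : p < q) (hqr : q < r) (hrs : r < s) :
    sparseForm e (omegaList k) ![e p, e q, e r, e s] = coeffAt (omegaList k) ![p, q, r, s] := by
  rw [← sparseForm_apply e (omegaList_strictMono k) (strictMono_vec4 hpq hqr hrs)]
  congr 1
  ext i
  fin_cases i <;> rfl

theorem flatWedge_basis {i j : Fin 8} (hij : i < j) : flatWedge e (e i) (e j) =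
    ∑ k, (coeffAt (etaList k) ![i, j] : ℂ) • sparseForm e (omegaList k) := by
  refine CForm.ext_strictMono e fun J hJ => ?_
  have h01 : J 0 < J 1 := hJ (by decide)
  have h12 : J 1 < J 2 := hJ (by decide)
  have h23 : J 2 < J 3 := hJ (by decide)
  have hJ' : (fun m => e (J m)) = ![e (J 0), e (J 1), e (J 2), e (J 3)] := by
    ext i; fin_cases i <;> rfl
  rw [hJ', flatWedge_apply_basis e i j h01 h12 h23, altMap_sum_apply,
    flatWedgeCoeff_eq i j hij _ _ h01 _ h12 _ h23, ← Fin.sum_univ_def]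
  simp only [AlternatingMap.smul_apply, smul_eq_mul, omega_apply e _ h01 h12 h23]
  push_cast
  rfl

theorem Lambda47_le_span : Lambda47 e (cayleyForm e) ≤
    Submodule.span ℂ (Set.range fun k => sparseForm e (omegaList k)) := by
  have hb : ∀ i j, i < j → flatWedge e (e i) (e j) ∈
      Submodule.span ℂ (Set.range fun k => sparseForm e (omegaList k)) := by
    intro i j hij
    rw [flatWedge_basis e hij]
    exact Submodule.sum_mem _ fun k _ => Submodule.smul_mem _ _ (Submodule.subset_span ⟨k, rfl⟩)
  refine Submodule.span_le.2 ?_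
  rintro _ ⟨⟨a, b⟩, rfl⟩
  change flatWedge e a b ∈ _
  rw [flatWedge_eq_sum]
  refine Submodule.sum_mem _ fun i _ => Submodule.sum_mem _ fun j _ => Submodule.smul_mem _ _ ?_
  rcases lt_trichotomy i j with h | rfl | h
  · exact hb i j h
  · rw [flatWedge, sub_self]
    exact Submodule.zero_mem _
  · rw [← neg_mem_iff]
    have : -flatWedge e (e i) (e j) = flatWedge e (e j) (e i) := by rw [flatWedge, flatWedge, neg_sub]
    rw [this]
    exact hb j i h

theorem omega_mem_Lambda47 (k : Fin 7) : sparseForm e (omegaList k) ∈ Lambda47 e (cayleyForm e) := by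
  have h := flatWedge_basis e (Fin.succ_pos k)
  -- Among the `η`, only `η_k` contains `e^0 ∧ e^{k+1}`, with coefficient 1. Hence the pair `(e_0,
  -- e_{k+1})` produces exactly `ω_k`.
  have hc : ∀ k k' : Fin 7, coeffAt (etaList k') ![0, k.succ] = if k' = k then 1 else 0 := by
    decide +kernel
  simp only [hc, Int.cast_ite, Int.cast_one, Int.cast_zero, ite_smul, one_smul, zero_smul,
    Finset.sum_ite_eq', Finset.mem_univ, if_true] at h
  rw [← h]
  exact Submodule.subset_span ⟨(e 0, e k.succ), rfl⟩

end LambdaFourSeven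

/-! ### Skew-symmetric determinants as squares of Pfaffians -/

section Determinant

/-- The Schur complement of the leading 2 by 2 block, whose determinant is `a²`. Multiplied by `a`,
the complement has the 4 by 4 Pfaffians through rows 0 and 1 as entries, which accounts for `a ^ n`.
-/
theorem det_eq_of_skew {n : ℕ} (M : Matrix (Fin (2 + n)) (Fin (2 + n)) ℝ)
    (hM : ∀ i j, M j i = -M i j) (a : ℝ) (ha : a ≠ 0)
    (h01 : M (Fin.castAdd n 0) (Fin.castAdd n 1) = a) :
    a ^ n * M.det = a ^ 2 * (Matrix.of fun i j : Fin n => pf4 M (Fin.castAdd n 0) (Fin.castAdd n 1)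
      (Fin.natAdd 2 i) (Fin.natAdd 2 j)).det := by
  have hdiag : ∀ i, M i i = 0 := fun i => by linarith [hM i i]
  let A : Matrix (Fin 2) (Fin 2) ℝ := M.submatrix (Fin.castAdd n) (Fin.castAdd n)
  let B : Matrix (Fin 2) (Fin n) ℝ := M.submatrix (Fin.castAdd n) (Fin.natAdd 2)
  let C : Matrix (Fin n) (Fin 2) ℝ := M.submatrix (Fin.natAdd 2) (Fin.castAdd n)
  let D : Matrix (Fin n) (Fin n) ℝ := M.submatrix (Fin.natAdd 2) (Fin.natAdd 2)
  have hA : A = !![0, a; -a, 0] := by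
    ext i j
    fin_cases i <;> fin_cases j <;> simp [A, hdiag, h01, hM (Fin.castAdd n 0) (Fin.castAdd n 1)]
  have hblock : M.submatrix finSumFinEquiv finSumFinEquiv = Matrix.fromBlocks A B C D := by
    ext (i | i) (j | j) <;> simp [A, B, C, D]
  let A' : Matrix (Fin 2) (Fin 2) ℝ := !![0, -a⁻¹; a⁻¹, 0]
  let _ : Invertible A :=
    ⟨A', by rw [hA]; ext i j; fin_cases i <;> fin_cases j <;> simp [A', Matrix.mul_apply, ha],
      by rw [hA]; ext i j; fin_cases i <;> fin_cases j <;> simp [A', Matrix.mul_apply, ha]⟩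
  have hS : a • (D - C * ⅟A * B) = Matrix.of fun i j : Fin n => pf4 M (Fin.castAdd n 0)
      (Fin.castAdd n 1) (Fin.natAdd 2 i) (Fin.natAdd 2 j) := by
    change a • (D - C * A' * B) = _
    ext i j
    simp only [Matrix.smul_apply, Matrix.sub_apply, Matrix.mul_apply, Fin.sum_univ_two, A', B, C, D,
      Matrix.submatrix_apply, Matrix.of_apply, Matrix.cons_val, smul_eq_mul, pf4, h01,
      hM (Fin.castAdd n 0) (Fin.natAdd 2 i), hM (Fin.castAdd n 1) (Fin.natAdd 2 i)]
    field_simp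
    ring
  have hdet : A.det = a ^ 2 := by
    rw [hA, Matrix.det_fin_two_of]
    ring
  rw [← hS, Matrix.det_smul, Fintype.card_fin, ← Matrix.det_submatrix_equiv_self finSumFinEquiv M,
    hblock, Matrix.det_fromBlocks₁₁, hdet]
  ring

/-- Pfaffians of the scaled Schur complement are Pfaffians of the full matrix times a power of the
pivot, here and in `pf6_pf4`. This drives the induction on the size 2, 4, 6, 8. -/
theorem pf4_pf4 {ι : Type*} (f : ι → ι → ℝ) (i j k l m n : ι) :
    pf4 (pf4 f i j) k l m n = f i j * pf6 f i j k l m n := by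
  simp only [pf6, pf4]
  ring

theorem pf6_pf4 {ι : Type*} (f : ι → ι → ℝ) (i j k l m n p q : ι) :
    pf6 (pf4 f i j) k l m n p q = f i j ^ 2 * pf8 f i j k l m n p q := by
  rw [pf6]
  simp only [pf4_pf4]
  simp only [pf8, pf6, pf4]
  ring

theorem pf4_swap {ι : Type*} {f : ι → ι → ℝ} (hf : ∀ i j, f j i = -f i j) (i j k l : ι) :
    pf4 f i j l k = -pf4 f i j k l := by
  simp only [pf4, hf k l]
  ring

/-- An identity between continuous functions of a skew-symmetric matrix `M` holds if it does for
`M p q ≠ 0`. -/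
theorem skew_ext {n : Type*} [DecidableEq n] {f g : Matrix n n ℝ → ℝ} (hf : Continuous f)
    (hg : Continuous g) {p q : n} (hpq : p ≠ q)
    (h : ∀ M : Matrix n n ℝ, (∀ i j, M j i = -M i j) → M p q ≠ 0 → f M = g M)
    {M : Matrix n n ℝ} (hM : ∀ i j, M j i = -M i j) : f M = g M := by
  let U : Matrix n n ℝ := Matrix.single p q 1 - Matrix.single q p 1
  have hU : ∀ i j, U j i = -U i j := fun i j => by
    simp only [U, Matrix.sub_apply, Matrix.single_apply, and_comm]
    ring
  have hU1 : U p q = 1 := by simp [U, hpq]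
  -- This line of skew-symmetric matrices has `(p, q)` entry `t` and passes through `M`; the
  -- hypothesis covers the dense set `t ≠ 0`.
  have hc : Continuous fun t : ℝ => M + (t - M p q) • U := by fun_prop
  have := Continuous.ext_on (dense_compl_singleton (0 : ℝ)) (hf.comp hc) (hg.comp hc) fun t ht =>
    h (M + (t - M p q) • U) (fun i j => by simp [hM i j, hU i j]; ring) (by simpa [hU1] using ht)
  simpa using congrFun this (M p q)

theorem det_skew_two (M : Matrix (Fin 2) (Fin 2) ℝ) (hM : ∀ i j, M j i = -M i j) :
    M.det = M 0 1 ^ 2 := by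
  have hdiag : ∀ i, M i i = 0 := fun i => by linarith [hM i i]
  rw [Matrix.det_fin_two, hdiag, hM 0 1]
  ring

theorem det_skew_four (M : Matrix (Fin 4) (Fin 4) ℝ) (hM : ∀ i j, M j i = -M i j) :
    M.det = pf4 M 0 1 2 3 ^ 2 := by
  refine skew_ext (f := fun M => M.det) (g := fun M => pf4 M 0 1 2 3 ^ 2) continuous_id.matrix_det
    (by unfold pf4; fun_prop) (show (0 : Fin 4) ≠ 1 by decide) (fun M hM h0 => ?_) hM
  have h := det_eq_of_skew (n := 2) M hM (M 0 1) h0 rfl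
  have h2 := det_skew_two (Matrix.of fun i j => pf4 M 0 1 (Fin.natAdd 2 i) (Fin.natAdd 2 j))
    fun i j => pf4_swap hM ..
  exact (mul_left_cancel₀ (pow_ne_zero 2 h0) h).trans h2

theorem det_skew_six (M : Matrix (Fin 6) (Fin 6) ℝ) (hM : ∀ i j, M j i = -M i j) :
    M.det = pf6 M 0 1 2 3 4 5 ^ 2 := by
  refine skew_ext (f := fun M => M.det) (g := fun M => pf6 M 0 1 2 3 4 5 ^ 2) continuous_id.matrix_det
    (by unfold pf6 pf4; fun_prop) (show (0 : Fin 6) ≠ 1 by decide) (fun M hM h0 => ?_) hM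
  have h := det_eq_of_skew (n := 4) M hM (M 0 1) h0 rfl
  have h4 := det_skew_four (Matrix.of fun i j => pf4 M 0 1 (Fin.natAdd 2 i) (Fin.natAdd 2 j))
    fun i j => pf4_swap hM ..
  have key : pf4 (fun i j : Fin 4 => pf4 M 0 1 (Fin.natAdd 2 i) (Fin.natAdd 2 j)) 0 1 2 3 =
      M 0 1 * pf6 M 0 1 2 3 4 5 := by
    exact pf4_pf4 M 0 1 2 3 4 5
  refine mul_left_cancel₀ (pow_ne_zero 4 h0) (h.trans ((congrArg _ (h4.trans
    (congrArg (· ^ 2) key))).trans ?_))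
  ring

theorem det_skew_eight (M : Matrix (Fin 8) (Fin 8) ℝ) (hM : ∀ i j, M j i = -M i j) :
    M.det = pf8 M 0 1 2 3 4 5 6 7 ^ 2 := by
  refine skew_ext (f := fun M => M.det) (g := fun M => pf8 M 0 1 2 3 4 5 6 7 ^ 2) continuous_id.matrix_det
    (by unfold pf8 pf6 pf4; fun_prop) (show (0 : Fin 8) ≠ 1 by decide) (fun M hM h0 => ?_) hM
  have h := det_eq_of_skew (n := 6) M hM (M 0 1) h0 rfl
  have h6 := det_skew_six (Matrix.of fun i j => pf4 M 0 1 (Fin.natAdd 2 i) (Fin.natAdd 2 j))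
    fun i j => pf4_swap hM ..
  have key : pf6 (fun i j : Fin 6 => pf4 M 0 1 (Fin.natAdd 2 i) (Fin.natAdd 2 j)) 0 1 2 3 4 5 =
      M 0 1 ^ 2 * pf8 M 0 1 2 3 4 5 6 7 := by
    exact pf6_pf4 M 0 1 2 3 4 5 6 7
  refine mul_left_cancel₀ (pow_ne_zero 6 h0) (h.trans ((congrArg _ (h6.trans
    (congrArg (· ^ 2) key))).trans ?_))
  ring

theorem det_skew_odd {n : Type*} [Fintype n] [DecidableEq n] (M : Matrix n n ℝ)
    (hM : ∀ i j, M j i = -M i j) (hn : Odd (Fintype.card n)) : M.det = 0 := by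
  have h : M.transpose = -M := by
    ext i j
    exact hM i j
  have h' := M.det_transpose
  rw [h, Matrix.det_neg, hn.neg_one_pow] at h'
  linarith

/-- Multilinearity in the rows: each row is taken from `M` or from the identity, and the rows taken
from `M` select a principal minor. -/
theorem det_one_add_eq_sum {n : Type*} [Fintype n] [DecidableEq n] (M : Matrix n n ℝ) :
    (1 + M).det = ∑ s : Finset n, (M.submatrix (↑) (↑) : Matrix s s ℝ).det := by
  rw [add_comm]
  have h := Matrix.detRowAlternating.map_add_univ M.row (1 : Matrix n n ℝ).row
  exact h.trans (Finset.sum_congr rfl fun s _ => M.det_piecewise_one_eq_submatrix_det s)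

theorem det_submatrix_image {m n : Type*} [Fintype m] [DecidableEq m] [DecidableEq n]
    (M : Matrix n n ℝ) {J : m → n} (hJ : Function.Injective J) :
    (M.submatrix (↑) (↑) : Matrix (Finset.univ.image J) (Finset.univ.image J) ℝ).det =
      (M.submatrix J J).det := by
  have hb : Function.Bijective fun i : m =>
      (⟨J i, Finset.mem_image_of_mem J (Finset.mem_univ i)⟩ : Finset.univ.image J) := by
    refine ⟨fun i j h => hJ (congrArg Subtype.val h), fun ⟨x, hx⟩ => ?_⟩
    obtain ⟨i, -, rfl⟩ := Finset.mem_image.1 hx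
    exact ⟨i, rfl⟩
  rw [← Matrix.det_submatrix_equiv_self (Equiv.ofBijective _ hb)]
  rfl

end Determinant

/-! ### Expansion of `det (1 + M)` into squares of Pfaffians -/

section PrincipalMinors

/-- The pairs `p < q` of elements of `Fin 8`. -/
def pairTable : List (Fin 8 × Fin 8) :=
    [(0, 1), (0, 2), (0, 3), (0, 4), (0, 5), (0, 6), (0, 7), (1, 2), (1, 3), (1, 4), (1, 5),
     (1, 6), (1, 7), (2, 3), (2, 4), (2, 5), (2, 6), (2, 7), (3, 4), (3, 5), (3, 6), (3, 7),
     (4, 5), (4, 6), (4, 7), (5, 6), (5, 7), (6, 7)]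

/-- The increasing 4-tuples of elements of `Fin 8`. -/
def quadTable : List (Fin 4 → Fin 8) :=
    [![0, 1, 2, 3], ![0, 1, 2, 4], ![0, 1, 2, 5], ![0, 1, 2, 6], ![0, 1, 2, 7], ![0, 1, 3, 4],
     ![0, 1, 3, 5], ![0, 1, 3, 6], ![0, 1, 3, 7], ![0, 1, 4, 5], ![0, 1, 4, 6], ![0, 1, 4, 7],
     ![0, 1, 5, 6], ![0, 1, 5, 7], ![0, 1, 6, 7], ![0, 2, 3, 4], ![0, 2, 3, 5], ![0, 2, 3, 6],
     ![0, 2, 3, 7], ![0, 2, 4, 5], ![0, 2, 4, 6], ![0, 2, 4, 7], ![0, 2, 5, 6], ![0, 2, 5, 7],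
     ![0, 2, 6, 7], ![0, 3, 4, 5], ![0, 3, 4, 6], ![0, 3, 4, 7], ![0, 3, 5, 6], ![0, 3, 5, 7],
     ![0, 3, 6, 7], ![0, 4, 5, 6], ![0, 4, 5, 7], ![0, 4, 6, 7], ![0, 5, 6, 7], ![1, 2, 3, 4],
     ![1, 2, 3, 5], ![1, 2, 3, 6], ![1, 2, 3, 7], ![1, 2, 4, 5], ![1, 2, 4, 6], ![1, 2, 4, 7],
     ![1, 2, 5, 6], ![1, 2, 5, 7], ![1, 2, 6, 7], ![1, 3, 4, 5], ![1, 3, 4, 6], ![1, 3, 4, 7],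
     ![1, 3, 5, 6], ![1, 3, 5, 7], ![1, 3, 6, 7], ![1, 4, 5, 6], ![1, 4, 5, 7], ![1, 4, 6, 7],
     ![1, 5, 6, 7], ![2, 3, 4, 5], ![2, 3, 4, 6], ![2, 3, 4, 7], ![2, 3, 5, 6], ![2, 3, 5, 7],
     ![2, 3, 6, 7], ![2, 4, 5, 6], ![2, 4, 5, 7], ![2, 4, 6, 7], ![2, 5, 6, 7], ![3, 4, 5, 6],
     ![3, 4, 5, 7], ![3, 4, 6, 7], ![3, 5, 6, 7], ![4, 5, 6, 7]]

/-- The increasing 6-tuple that omits `p < q`. -/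
def complPair (p q : Fin 8) (m : Fin 6) : Fin 8 := p.succAbove ((Fin.predAbove 0 q).succAbove m)

/-- The subsets of `Fin 8` of even cardinality. -/
def evenSubsets : List (Finset (Fin 8)) :=
  ∅ :: Finset.univ :: (pairTable.map fun t => Finset.univ.image ![t.1, t.2]) ++
    (quadTable.map fun J => Finset.univ.image J) ++
    pairTable.map fun t => Finset.univ.image (complPair t.1 t.2)

theorem evenSubsets_nodup : evenSubsets.Nodup := by
  -- Encoding a subset by its binary number reduces distinctness to a comparison of naturals.
  have h : (evenSubsets.map fun s : Finset (Fin 8) => ∑ i ∈ s, 2 ^ (i : ℕ)).Nodup := by decide +kernel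
  exact h.of_map

theorem mem_evenSubsets (s : Finset (Fin 8)) : Even s.card → s ∈ evenSubsets := by
  revert s
  decide +kernel

theorem pairTable_injective (t : Fin 8 × Fin 8) (ht : t ∈ pairTable) :
    Function.Injective ![t.1, t.2] := by
  have h : ∀ t ∈ pairTable, ∀ i j, ![t.1, t.2] i = ![t.1, t.2] j → i = j := by decide +kernel
  exact h t ht

theorem quadTable_injective (J : Fin 4 → Fin 8) (hJ : J ∈ quadTable) : Function.Injective J := by
  have h : quadTable.all fun J => decide (∀ i j, J i = J j → i = j) := by decide +kernel
  have h' := List.all_eq_true.1 h J hJ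
  exact fun i j => of_decide_eq_true h' i j

theorem complPair_injective (p q : Fin 8) : Function.Injective (complPair p q) :=
  (Fin.succAbove_right_injective).comp Fin.succAbove_right_injective

/-- Principal minors of odd size vanish by skew symmetry, and those of even size are squares of
Pfaffians. The 6 by 6 ones are indexed by the omitted pair, to match the Hodge dual. -/
theorem det_one_add_skew (M : Matrix (Fin 8) (Fin 8) ℝ) (hM : ∀ i j, M j i = -M i j) :
    (1 + M).det = 1 + (pairTable.map fun t => M t.1 t.2 ^ 2).sum
      + (quadTable.map fun J => pf4 M (J 0) (J 1) (J 2) (J 3) ^ 2).sum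
      + (pairTable.map fun t => pf6 M (complPair t.1 t.2 0) (complPair t.1 t.2 1) (complPair t.1 t.2 2)
          (complPair t.1 t.2 3) (complPair t.1 t.2 4) (complPair t.1 t.2 5) ^ 2).sum
      + pf8 M 0 1 2 3 4 5 6 7 ^ 2 := by
  have hS : ∑ s : Finset (Fin 8), (M.submatrix (↑) (↑) : Matrix s s ℝ).det =
      (evenSubsets.map fun s : Finset (Fin 8) => (M.submatrix (↑) (↑) : Matrix s s ℝ).det).sum := by
    rw [← List.sum_toFinset _ evenSubsets_nodup]
    refine (Finset.sum_subset (Finset.subset_univ _) fun s _ hs => ?_).symm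
    refine det_skew_odd _ (fun i j => hM _ _) ?_
    rw [Fintype.card_coe, ← Nat.not_even_iff_odd]
    exact fun h => hs (List.mem_toFinset.2 (mem_evenSubsets s h))
  have h2 : ∀ t ∈ pairTable, (M.submatrix (↑) (↑) : Matrix (Finset.univ.image ![t.1, t.2])
      (Finset.univ.image ![t.1, t.2]) ℝ).det = M t.1 t.2 ^ 2 := fun t ht => by
    exact (det_submatrix_image M (pairTable_injective t ht)).trans
      (det_skew_two (M.submatrix ![t.1, t.2] ![t.1, t.2]) fun i j => hM _ _)
  have h4 : ∀ J ∈ quadTable, (M.submatrix (↑) (↑) : Matrix (Finset.univ.image J)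
      (Finset.univ.image J) ℝ).det = pf4 M (J 0) (J 1) (J 2) (J 3) ^ 2 := fun J hJ => by
    exact (det_submatrix_image M (quadTable_injective J hJ)).trans
      (det_skew_four (M.submatrix J J) fun i j => hM _ _)
  have h6 : ∀ t ∈ pairTable, (M.submatrix (↑) (↑) : Matrix (Finset.univ.image (complPair t.1 t.2))
      (Finset.univ.image (complPair t.1 t.2)) ℝ).det = pf6 M (complPair t.1 t.2 0)
        (complPair t.1 t.2 1) (complPair t.1 t.2 2) (complPair t.1 t.2 3) (complPair t.1 t.2 4)
        (complPair t.1 t.2 5) ^ 2 := fun t _ => by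
    exact (det_submatrix_image M (complPair_injective t.1 t.2)).trans (det_skew_six
      (M.submatrix (complPair t.1 t.2) (complPair t.1 t.2)) fun i j => hM _ _)
  have h8 : (M.submatrix (↑) (↑) : Matrix (Finset.univ : Finset (Fin 8))
      (Finset.univ : Finset (Fin 8)) ℝ).det = pf8 M 0 1 2 3 4 5 6 7 ^ 2 := by
    rw [← det_skew_eight M hM, ← Matrix.det_submatrix_equiv_self (Equiv.subtypeUnivEquiv
      (p := (· ∈ (Finset.univ : Finset (Fin 8)))) Finset.mem_univ) M]
    rfl
  rw [det_one_add_eq_sum, hS]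
  simp only [evenSubsets, List.map_append, List.map_cons, List.map_map, List.sum_append, List.sum_cons,
    Matrix.det_isEmpty, h8]
  rw [List.map_congr_left (f := _ ∘ fun t : Fin 8 × Fin 8 => Finset.univ.image ![t.1, t.2]) h2,
    List.map_congr_left (f := _ ∘ fun J : Fin 4 → Fin 8 => Finset.univ.image J) h4,
    List.map_congr_left (f := _ ∘ fun t : Fin 8 × Fin 8 => Finset.univ.image (complPair t.1 t.2)) h6]
  ring

end PrincipalMinors

/-! ### The polynomial identities behind the theorem -/

section CayleyIdentity

/-- `∑ c x_{pq}` for a list of coefficients `c` and index pairs `(p, q)`. -/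
noncomputable def listSum2 (l : List (ℤ × (Fin 2 → Fin 8))) (x : Fin 8 → Fin 8 → ℝ) : ℝ :=
  (l.map fun t => (t.1 : ℝ) * x (t.2 0) (t.2 1)).sum

/-- `∑ c Pf_{ijkl}(x)` for a list of coefficients `c` and index quadruples `(i, j, k, l)`. -/
noncomputable def listPf4 (l : List (ℤ × (Fin 4 → Fin 8))) (x : Fin 8 → Fin 8 → ℝ) : ℝ :=
  (l.map fun t => (t.1 : ℝ) * pf4 x (t.2 0) (t.2 1) (t.2 2) (t.2 3)).sum

/-- The Hodge star of the 6-form with coefficients the 6 by 6 sub-Pfaffians of `x`. -/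
noncomputable def dualPf6 (x : Fin 8 → Fin 8 → ℝ) (p q : Fin 8) : ℝ :=
  (-1) ^ (p : ℕ) * (-1) ^ (Fin.predAbove 0 q : ℕ) *
    pf6 x (complPair p q 0) (complPair p q 1) (complPair p q 2) (complPair p q 3) (complPair p q 4)
      (complPair p q 5)

/-- The degree 2 part, which says `4 |π²₇ α|² = |α|² + ⟨α ∧ α, Φ⟩` for real `α`. Only entries above
the diagonal occur, so skew symmetry is not needed; the same holds for the next two polynomial
identities. -/
theorem sum_listSum2_eta_sq (x : Fin 8 → Fin 8 → ℝ) :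
    ∑ j, listSum2 (etaList j) x ^ 2 =
      (pairTable.map fun t => x t.1 t.2 ^ 2).sum + 2 * listPf4 cayleyList x := by
  simp only [Fin.sum_univ_seven, listSum2, listPf4, etaList, cayleyList, pairTable, Matrix.cons_val,
    List.map_cons, List.map_nil, List.sum_cons, List.sum_nil, pf4]
  push_cast
  ring

theorem dualPf6_sq (x : Fin 8 → Fin 8 → ℝ) (p q : Fin 8) :
    dualPf6 x p q ^ 2 = pf6 x (complPair p q 0) (complPair p q 1) (complPair p q 2)
      (complPair p q 3) (complPair p q 4) (complPair p q 5) ^ 2 := by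
  rw [dualPf6, mul_pow, mul_pow, ← pow_mul, ← pow_mul, mul_comm _ 2, mul_comm _ 2, pow_mul, pow_mul]
  simp

theorem dualPf6_values (x : Fin 8 → Fin 8 → ℝ) :
    dualPf6 x 0 1 = pf6 x 2 3 4 5 6 7 ∧ dualPf6 x 0 2 = -pf6 x 1 3 4 5 6 7 ∧
    dualPf6 x 0 3 = pf6 x 1 2 4 5 6 7 ∧ dualPf6 x 0 4 = -pf6 x 1 2 3 5 6 7 ∧
    dualPf6 x 0 5 = pf6 x 1 2 3 4 6 7 ∧ dualPf6 x 0 6 = -pf6 x 1 2 3 4 5 7 ∧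
    dualPf6 x 0 7 = pf6 x 1 2 3 4 5 6 ∧ dualPf6 x 1 2 = pf6 x 0 3 4 5 6 7 ∧
    dualPf6 x 1 3 = -pf6 x 0 2 4 5 6 7 ∧ dualPf6 x 1 4 = pf6 x 0 2 3 5 6 7 ∧
    dualPf6 x 1 5 = -pf6 x 0 2 3 4 6 7 ∧ dualPf6 x 1 6 = pf6 x 0 2 3 4 5 7 ∧
    dualPf6 x 1 7 = -pf6 x 0 2 3 4 5 6 ∧ dualPf6 x 2 3 = pf6 x 0 1 4 5 6 7 ∧
    dualPf6 x 2 4 = -pf6 x 0 1 3 5 6 7 ∧ dualPf6 x 2 5 = pf6 x 0 1 3 4 6 7 ∧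
    dualPf6 x 2 6 = -pf6 x 0 1 3 4 5 7 ∧ dualPf6 x 2 7 = pf6 x 0 1 3 4 5 6 ∧
    dualPf6 x 3 4 = pf6 x 0 1 2 5 6 7 ∧ dualPf6 x 3 5 = -pf6 x 0 1 2 4 6 7 ∧
    dualPf6 x 3 6 = pf6 x 0 1 2 4 5 7 ∧ dualPf6 x 3 7 = -pf6 x 0 1 2 4 5 6 ∧
    dualPf6 x 4 5 = pf6 x 0 1 2 3 6 7 ∧ dualPf6 x 4 6 = -pf6 x 0 1 2 3 5 7 ∧
    dualPf6 x 4 7 = pf6 x 0 1 2 3 5 6 ∧ dualPf6 x 5 6 = pf6 x 0 1 2 3 4 7 ∧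
    dualPf6 x 5 7 = -pf6 x 0 1 2 3 4 6 ∧ dualPf6 x 6 7 = pf6 x 0 1 2 3 4 5 := by
  refine ⟨?_, ?_, ?_, ?_, ?_, ?_, ?_, ?_, ?_, ?_, ?_, ?_, ?_, ?_, ?_, ?_, ?_, ?_, ?_, ?_, ?_, ?_, ?_, ?_, ?_, ?_, ?_, ?_⟩ <;>
  · simp [dualPf6, complPair, Fin.predAbove, Fin.succAbove]
    try norm_num

/-- The degree 4 part, an identity of polynomials in the 28 entries above the diagonal. The cross
term between `x` and its dual comes from the square of `π²₇(F + *F³/6)`. -/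
theorem quartic_identity (x : Fin 8 → Fin 8 → ℝ) :
    listPf4 cayleyList x ^ 2 + 2 * pf8 x 0 1 2 3 4 5 6 7
        - 2 * ∑ j, listSum2 (etaList j) x * listSum2 (etaList j) (dualPf6 x)
        + ∑ j, listPf4 (omegaList j) x ^ 2 =
      (quadTable.map fun J => pf4 x (J 0) (J 1) (J 2) (J 3) ^ 2).sum := by
  simp only [Fin.sum_univ_seven, listSum2, listPf4, etaList, cayleyList, omegaList, quadTable,
    Matrix.cons_val, List.map_cons, List.map_nil, List.sum_cons, List.sum_nil, dualPf6_values x]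
  simp only [pf8, pf6, pf4]
  push_cast
  ring

/-- Jacobi's identity for complementary minors, in Pfaffian form: a 4 by 4 Pfaffian of the dual is,
up to sign, `Pf₈` times the complementary one of `x`. Self-duality of `Φ` then restores the same
pairing. -/
theorem listPf4_cayley_dual (x : Fin 8 → Fin 8 → ℝ) :
    listPf4 cayleyList (dualPf6 x) = listPf4 cayleyList x * pf8 x 0 1 2 3 4 5 6 7 := by
  simp only [listPf4, cayleyList, Matrix.cons_val, List.map_cons, List.map_nil, List.sum_cons,
    List.sum_nil, pf4, dualPf6_values x]
  simp only [pf8, pf6, pf4]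
  push_cast
  ring

theorem listSum2_sub (l : List (ℤ × (Fin 2 → Fin 8))) (x y : Fin 8 → Fin 8 → ℝ) :
    listSum2 l (x - y) = listSum2 l x - listSum2 l y := by
  induction l with
  | nil => simp [listSum2]
  | cons t l ih =>
    simp only [listSum2, List.map_cons, List.sum_cons, Pi.sub_apply] at ih ⊢
    rw [ih]
    ring

/-- The pointwise identity for the skew-symmetric matrix `x` of the 2-form `-√-1 F`. -/
theorem cayley_det_identity (x : Fin 8 → Fin 8 → ℝ) (hx : ∀ i j, x j i = -x i j) :
    (1 - listPf4 cayleyList x + pf8 x 0 1 2 3 4 5 6 7) ^ 2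
        + ∑ j, listSum2 (etaList j) (x - dualPf6 x) ^ 2
        + ∑ j, listPf4 (omegaList j) x ^ 2 = (1 + Matrix.of x).det := by
  have h2 := sum_listSum2_eta_sq x
  have h4 := quartic_identity x
  -- The degree 2 identity at the dual matrix becomes the degree 6 part.
  have h6 := sum_listSum2_eta_sq (dualPf6 x)
  rw [listPf4_cayley_dual] at h6
  simp only [dualPf6_sq] at h6
  refine Eq.trans ?_ (det_one_add_skew (Matrix.of x) hx).symm
  change _ = 1 + (pairTable.map fun t => x t.1 t.2 ^ 2).sum
      + (quadTable.map fun J => pf4 x (J 0) (J 1) (J 2) (J 3) ^ 2).sum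
      + (pairTable.map fun t => pf6 x (complPair t.1 t.2 0) (complPair t.1 t.2 1) (complPair t.1 t.2 2)
          (complPair t.1 t.2 3) (complPair t.1 t.2 4) (complPair t.1 t.2 5) ^ 2).sum
      + pf8 x 0 1 2 3 4 5 6 7 ^ 2
  simp only [listSum2_sub, sub_sq, Finset.sum_add_distrib, Finset.sum_sub_distrib, mul_assoc,
    ← Finset.mul_sum]
  linear_combination h2 + h4 + h6

end CayleyIdentity

/-! ### From the 2-form to its real skew-symmetric matrix -/

section Pointwise

theorem pf4_const_mul {R : Type*} [CommRing R] {ι : Type*} (c : R) (f : ι → ι → R) (i j k l : ι) :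
    pf4 (fun u v => c * f u v) i j k l = c ^ 2 * pf4 f i j k l := by
  simp only [pf4]
  ring

theorem pf6_const_mul {R : Type*} [CommRing R] {ι : Type*} (c : R) (f : ι → ι → R)
    (i j k l m n : ι) :
    pf6 (fun u v => c * f u v) i j k l m n = c ^ 3 * pf6 f i j k l m n := by
  simp only [pf6, pf4_const_mul]
  ring

theorem pf8_const_mul {R : Type*} [CommRing R] {ι : Type*} (c : R) (f : ι → ι → R)
    (i j k l m n p q : ι) :
    pf8 (fun u v => c * f u v) i j k l m n p q = c ^ 4 * pf8 f i j k l m n p q := by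
  simp only [pf8, pf6_const_mul]
  ring

theorem pf4_ofReal {ι : Type*} (f : ι → ι → ℝ) (i j k l : ι) :
    pf4 (fun u v => (f u v : ℂ)) i j k l = (pf4 f i j k l : ℝ) := by
  simp [pf4]

theorem pf6_ofReal {ι : Type*} (f : ι → ι → ℝ) (i j k l m n : ι) :
    pf6 (fun u v => (f u v : ℂ)) i j k l m n = (pf6 f i j k l m n : ℝ) := by
  simp [pf6, pf4_ofReal]

theorem pf8_ofReal {ι : Type*} (f : ι → ι → ℝ) (i j k l m n p q : ι) :
    pf8 (fun u v => (f u v : ℂ)) i j k l m n p q = (pf8 f i j k l m n p q : ℝ) := by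
  simp [pf8, pf6_ofReal]

variable {W : Type*} [AddCommGroup W] [Module ℝ W] {e : Module.Basis (Fin 8) ℝ W}
  {F : CForm W 2} {x : Fin 8 → Fin 8 → ℝ}

/-- With `F = √-1 x`, the power `F^k` carries `(√-1)^k k!`; this is the source of the constants
`-2`, `-6 √-1` and `24`. -/
theorem wedgeSq_basis (hF : ∀ i j, F ![e i, e j] = Complex.I * x i j) (J : Fin 4 → Fin 8) :
    (wedgeSq F fun m => e (J m)) = ((-2 * pf4 x (J 0) (J 1) (J 2) (J 3) : ℝ) : ℂ) := by
  have h : pf4 (fun u v => F ![u, v]) (e (J 0)) (e (J 1)) (e (J 2)) (e (J 3)) =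
      pf4 (fun i j => Complex.I * (x i j : ℂ)) (J 0) (J 1) (J 2) (J 3) := by
    simp only [pf4, hF]
  rw [CForm.apply_vec4, wedgeSq_apply, h, pf4_const_mul, pf4_ofReal, Complex.I_sq]
  push_cast
  ring

theorem wedgeCube_basis (hF : ∀ i j, F ![e i, e j] = Complex.I * x i j) (J : Fin 6 → Fin 8) :
    (wedgeCube F fun m => e (J m)) =
      -6 * Complex.I * (pf6 x (J 0) (J 1) (J 2) (J 3) (J 4) (J 5) : ℝ) := by
  have h : pf6 (fun u v => F ![u, v]) (e (J 0)) (e (J 1)) (e (J 2)) (e (J 3)) (e (J 4)) (e (J 5)) =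
      pf6 (fun i j => Complex.I * (x i j : ℂ)) (J 0) (J 1) (J 2) (J 3) (J 4) (J 5) := by
    simp only [pf6, pf4, hF]
  rw [CForm.apply_vec6, wedgeCube_apply, h, pf6_const_mul, pf6_ofReal, Complex.I_pow_three]
  ring

theorem wedgeFourth_basis (hF : ∀ i j, F ![e i, e j] = Complex.I * x i j) :
    wedgeFourth F e = ((24 * pf8 x 0 1 2 3 4 5 6 7 : ℝ) : ℂ) := by
  have h : pf8 (fun u v => F ![u, v]) (e 0) (e 1) (e 2) (e 3) (e 4) (e 5) (e 6) (e 7) =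
      pf8 (fun i j => Complex.I * (x i j : ℂ)) 0 1 2 3 4 5 6 7 := by
    simp only [pf8, pf6, pf4, hF]
  have he : (e : Fin 8 → W) = ![e 0, e 1, e 2, e 3, e 4, e 5, e 6, e 7] := by
    ext i
    fin_cases i <;> rfl
  rw [he, wedgeFourth_apply, h, pf8_const_mul, pf8_ofReal, Complex.I_pow_four]
  push_cast
  ring

theorem formInner_sparseForm_wedgeSq (hF : ∀ i j, F ![e i, e j] = Complex.I * x i j)
    (l : List (ℤ × (Fin 4 → Fin 8))) :
    formInner e (sparseForm e l) (wedgeSq F) = ((-2 * listPf4 l x : ℝ) : ℂ) := by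
  rw [formInner_sparseForm, listPf4, ← List.sum_map_mul_left]
  simp only [wedgeSq_basis hF]
  rw [← Complex.ofRealHom_eq_coe, map_list_sum, List.map_map]
  congr 1
  refine List.map_congr_left fun t _ => ?_
  simp only [Function.comp_apply, Complex.ofRealHom_eq_coe]
  push_cast
  ring

theorem scalar_basis (hF : ∀ i j, F ![e i, e j] = Complex.I * x i j) :
    1 + 1 / 2 * formInner e (wedgeSq F) (complexify (cayleyForm e))
      + hodge e (k := 8) (l := 0) rfl (wedgeFourth F) ![] / 24 =
      ((1 - listPf4 cayleyList x + pf8 x 0 1 2 3 4 5 6 7 : ℝ) : ℂ) := by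
  -- The inner product is conjugate-linear in its first slot and `formInner_sparseForm` needs the
  -- tabulated form there; since the value is real, exchanging the slots is harmless.
  rw [← formInner_conj, complexify_cayleyForm, formInner_sparseForm_wedgeSq hF, Complex.conj_ofReal,
    hodge_eight_zero, wedgeFourth_basis hF]
  push_cast
  ring

theorem succAbove_predAbove_zero {p q : Fin 8} (h : p < q) :
    p.succAbove (Fin.predAbove 0 q) = q := by
  revert p q
  decide +kernel

theorem add_hodge_wedgeCube_basis (hF : ∀ i j, F ![e i, e j] = Complex.I * x i j) {p q : Fin 8}
    (h : p < q) :
    (F + (1 / 6 : ℂ) • hodge e (k := 6) (l := 2) rfl (wedgeCube F)) ![e p, e q] =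
      Complex.I * ((x p q - dualPf6 x p q : ℝ) : ℂ) := by
  have h1 := hodge_six_two e (wedgeCube F) p (Fin.predAbove 0 q)
  have h2 := wedgeCube_basis hF fun m => p.succAbove ((Fin.predAbove 0 q).succAbove m)
  rw [succAbove_predAbove_zero h, h2] at h1
  rw [AlternatingMap.add_apply, AlternatingMap.smul_apply, h1, hF, dualPf6, smul_eq_mul]
  simp only [complPair]
  push_cast
  ring

theorem formInner_eta_add_hodge_wedgeCube (hF : ∀ i j, F ![e i, e j] = Complex.I * x i j)
    (j : Fin 7) :
    formInner e (sparseForm e (etaList j))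
        (F + (1 / 6 : ℂ) • hodge e (k := 6) (l := 2) rfl (wedgeCube F)) =
      Complex.I * (listSum2 (etaList j) (x - dualPf6 x) : ℝ) := by
  rw [formInner_sparseForm, listSum2, ← Complex.ofRealHom_eq_coe, map_list_sum, List.map_map,
    ← List.sum_map_mul_left]
  congr 1
  refine List.map_congr_left fun t ht => ?_
  have h : t.2 0 < t.2 1 := etaList_strictMono j t ht (by decide)
  rw [CForm.apply_vec2, add_hodge_wedgeCube_basis hF h]
  simp only [Function.comp_apply, Complex.ofRealHom_eq_coe, Pi.sub_apply]
  push_cast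
  ring

/-- The factor 4 cancels the squared length of the `η_j`. -/
theorem four_mul_formNormSq_proj27 (hF : ∀ i j, F ![e i, e j] = Complex.I * x i j) :
    4 * formNormSq e (formProj e (Lambda27 e (cayleyForm e))
        (F + (1 / 6 : ℂ) • hodge e (k := 6) (l := 2) rfl (wedgeCube F))) =
      ∑ j, listSum2 (etaList j) (x - dualPf6 x) ^ 2 := by
  rw [formNormSq_formProj e (by norm_num) (formInner_eta e) (eta_mem_Lambda27 e) (Lambda27_le_span e),
    Finset.mul_sum]
  refine Finset.sum_congr rfl fun j _ => ?_
  rw [formInner_eta_add_hodge_wedgeCube hF, norm_mul, Complex.norm_I, one_mul, Complex.norm_real,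
    Real.norm_eq_abs, sq_abs]
  ring

/-- The square of the factor `-2` in `F²`, times 2, cancels the squared length 8 of the `ω_j`. -/
theorem two_mul_formNormSq_proj47 (hF : ∀ i j, F ![e i, e j] = Complex.I * x i j) :
    2 * formNormSq e (formProj e (Lambda47 e (cayleyForm e)) (wedgeSq F)) =
      ∑ j, listPf4 (omegaList j) x ^ 2 := by
  rw [formNormSq_formProj e (by norm_num) (formInner_omega e) (omega_mem_Lambda47 e)
    (Lambda47_le_span e), Finset.mul_sum]
  refine Finset.sum_congr rfl fun j _ => ?_
  rw [formInner_sparseForm_wedgeSq hF, Complex.norm_real, Real.norm_eq_abs, sq_abs]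
  ring

theorem det_id_add_sharp (hF : ∀ i j, F ![e i, e j] = Complex.I * x i j) :
    LinearMap.det (LinearMap.id + sharp e (-Complex.I • F)) = (1 + Matrix.of x).det := by
  -- The endomorphism sends `e_i` to `∑ x_{ij} e_j`, so its matrix is the transpose of `x`.
  rw [← LinearMap.det_toMatrix e, map_add, LinearMap.toMatrix_id, ← Matrix.det_transpose,
    Matrix.transpose_add, Matrix.transpose_one]
  congr 2
  ext i j
  have h : ∀ k, ((-Complex.I • F) ![e i, e k]).re = x i k := fun k => by
    rw [AlternatingMap.smul_apply, hF, smul_eq_mul, ← mul_assoc, neg_mul, Complex.I_mul_I]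
    simp
  change LinearMap.toMatrix e e (sharp e (-Complex.I • F)) j i = x i j
  rw [LinearMap.toMatrix_apply]
  change e.repr (∑ k, ((-Complex.I • F) ![e i, e k]).re • e k) j = x i j
  simp only [h]
  exact congrFun (e.repr_sum_self _) j

end Pointwise

/-! ### The identity at a point of the manifold -/

section Manifold

variable {X : Type*} [TopologicalSpace X] [ChartedSpace R8 X] [IsManifold (𝓡 8) ∞ X]
  {L : X → Type*} [∀ x, NormedAddCommGroup (L x)] [∀ x, InnerProductSpace ℂ (L x)]
  [TopologicalSpace (TotalSpace ℂ L)] [FiberBundle ℂ L]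
  [VectorBundle ℝ ℂ L] [ContMDiffVectorBundle ∞ ℂ L (𝓡 8)] [IsSmoothHermitian (𝓡 8) L]

theorem Spin7Structure.pointwise_identity (S : Spin7Structure X) (D : HermitianConnection (𝓡 8) L)
    (x : X) : ∃ s : ℝ, S.scalar D x = s ∧
      s ^ 2 + 4 * formNormSq (S.frame x) (S.proj27 D x) + 2 * formNormSq (S.frame x) (S.proj47 D x) =
        S.detTerm D x := by
  have hΦ : (S.Φ x).toAlternatingMap = cayleyForm (S.frame x) :=
    Classical.choose_spec (S.exists_frame x)
  -- Since the curvature is imaginary, its imaginary parts in the adapted frame are the matrix of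
  -- `-√-1 F`.
  let a : Fin 8 → Fin 8 → ℝ := fun i j => (D.curvature x ![S.frame x i, S.frame x j]).im
  have hF : ∀ i j, D.curvature x ![S.frame x i, S.frame x j] = Complex.I * a i j := fun i j => by
    apply Complex.ext
    · simp [D.curvature_re]
    · simp [a]
  have ha : ∀ i j, a j i = -a i j := fun i j => by
    simp only [a, CForm.swap (D.curvature x) (S.frame x i) (S.frame x j), Complex.neg_im]
  refine ⟨1 - listPf4 cayleyList a + pf8 a 0 1 2 3 4 5 6 7, ?_, ?_⟩
  · rw [Spin7Structure.scalar, hΦ]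
    exact scalar_basis hF
  · rw [Spin7Structure.proj27, Spin7Structure.proj47, Spin7Structure.detTerm, hΦ, det_id_add_sharp hF,
      ← cayley_det_identity a ha]
    congr 2
    · exact four_mul_formNormSq_proj27 hF
    · exact two_mul_formNormSq_proj47 hF

end Manifold
end Spin7dDT

theorem theorem4p2
    {X : Type*} [TopologicalSpace X] [ChartedSpace R8 X] [IsManifold (𝓡 8) ∞ X]
    (S : Spin7Structure X)
    {L : X → Type*} [∀ x, NormedAddCommGroup (L x)] [∀ x, InnerProductSpace ℂ (L x)]
    [TopologicalSpace (TotalSpace ℂ L)] [FiberBundle ℂ L] [VectorBundle ℂ ℂ L]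
    [VectorBundle ℝ ℂ L] [ContMDiffVectorBundle ∞ ℂ L (𝓡 8)] [IsSmoothHermitian (𝓡 8) L]
    (D : HermitianConnection (𝓡 8) L) :
    (∀ x : X, S.scalar D x ^ 2 + 4 * (formNormSq (S.frame x) (S.proj27 D x) : ℂ)
        + 2 * (formNormSq (S.frame x) (S.proj47 D x) : ℂ) = (S.detTerm D x : ℂ)) ∧
    (∀ x : X, ‖S.scalar D x‖ ≤ √(S.detTerm D x)) ∧
    ((∀ x : X, ‖S.scalar D x‖ = √(S.detTerm D x)) ↔ S.IsSpin7DDT D) := by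
  have key : ∀ x : X, ‖S.scalar D x‖ ^ 2 + 4 * formNormSq (S.frame x) (S.proj27 D x)
      + 2 * formNormSq (S.frame x) (S.proj47 D x) = S.detTerm D x := fun x => by
    obtain ⟨s, hs, h⟩ := S.pointwise_identity D x
    rw [hs, Complex.norm_real, Real.norm_eq_abs, sq_abs, h]
  have h27 := fun x => formNormSq_nonneg (S.frame x) (S.proj27 D x)
  have h47 := fun x => formNormSq_nonneg (S.frame x) (S.proj47 D x)
  -- Nonnegativity of the determinant comes from the identity itself, whose other side is a sum of
  -- nonnegative terms.
  have hdet : ∀ x, 0 ≤ S.detTerm D x := fun x => by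
    rw [← key x]
    linarith [h27 x, h47 x, sq_nonneg ‖S.scalar D x‖]
  have hiff : ∀ x, ‖S.scalar D x‖ = √(S.detTerm D x) ↔ S.proj27 D x = 0 ∧ S.proj47 D x = 0 := by
    intro x
    -- After squaring, equality says that the two nonnegative norm terms add up to zero.
    rw [eq_comm, Real.sqrt_eq_iff_eq_sq (hdet x) (norm_nonneg _),
      ← formNormSq_eq_zero (S.frame x) (α := S.proj27 D x),
      ← formNormSq_eq_zero (S.frame x) (α := S.proj47 D x), ← key x]
    constructor
    · intro h
      constructor <;> linarith [h27 x, h47 x]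
    · rintro ⟨h, h'⟩
      rw [h, h']
      ring
  refine ⟨fun x => ?_, fun x => ?_, ?_⟩
  · obtain ⟨s, hs, h⟩ := S.pointwise_identity D x
    rw [hs, ← h]
    push_cast
    rfl
  · refine Real.le_sqrt_of_sq_le ?_
    rw [← key x]
    linarith [h27 x, h47 x]
  · simp only [hiff]
    exact forall_and
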